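/- A *model of set theory* is a transitive class $V$ of sets with $(V,\in)\models\mathrm{ZFC}$. A *distance monoid* is a commutative monoid $(W,+,0)$ with a linear order $\le$ whose least element is $0$, such that $+$ is monotone and $b+\bigwedge A=\bigwedge_{a\in A}(b+a)$ for all $A\subseteq W$ having an infimum. It is *complete* if every subset has an infimum and a supremum, and *continuous* if it is complete and $\bigwedge_{a,b\ne 0}(a+b)=0$. An *initial sequence* is an order-reversing map from an ordinal to $W\setminus\{0\}$ with coinitial range; the *coinitiality* of $W$ is the least ordinal that is the domain of one; an initial sequence $\alpha$ is *nice* if $4\cdot\alpha(i+1)\le\alpha(i)$ for all $i$. A *completion* of $W$ is a complete distance monoid $\overline W\supseteq W$ extending $W$ whose order is the Dedekind–MacNeille completion of that of $W$. A *$W$-metric space* is a set $M$ with $d:M\times M\to W$ such that $d(x,z)\le d(x,y)+d(y,z)$, and $d(x,y)=d(y,x)=0$ iff $x=y$. A *Cauchy sequence* is a map $p:A\to M$ with $A\subseteq W\setminus\{0\}$, $\bigwedge_{a,b\in A}(a+b)=0$ and $d(p(a),p(b))\le a+b$; it *converges* to $x$ if for each $a\neq 0$ both $\bigwedge_{b\in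 A,\,b\le a}d(x,p(b))$ and $\bigwedge_{b\in A,\,b\le a}d(p(b),x)$ are $0$. For $W$ complete, a *$W$-dynamical system* is a $W$-metric space in which every Cauchy sequence converges, together with a non-expanding self-map $f$. Let $V_0\subseteq V_1$ be models of set theory and let $(M,f)\in V_0$ be, in $V_0$, a $W$-dynamical system. View triples $(M,f,W)$ as two-sorted structures with $+,0,\le,d,f$. A *relativization* of $(M,f,W)$ to $V_1$ is a structure $(N,g,X)\in V_1$ such that (a) in $V_1$, $X$ is a completion of $W$ and $(N,g)$ is an $X$-dynamical system; (b) $M\subseteq N$, $W\subseteq X$ and the inclusion is a homomorphism; (c) in $V_1$, every embedding of $(N,g,X)$ into itself that is the identity on $(M,W)$ is an automorphism; (d) for every other structure in $V_1$ with (a) and (b) there is in $V_1$ a homomorphism from $(N,g,X)$ to it that is the identity on $(M,W)$. For an infinite ordinal $\kappa$, a *$\kappa$-tree* is a partial order $T$ with a unique minimal element in which the strict predecessors of each $a$ are well-ordered of type $\mathrm{lev}(a)<\kappa$. It is *pruned* if for all $a\in T$ and $\mathrm{lev}(a)<\beta<\kappa$ there is $b\ge a$ with $\mathrm{lev}(b)=\beta$.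 A *path* is a strictly increasing $p:\kappa\to T$ with $\mathrm{lev}(p(i))=i$. The *tree metric* on $T$ given by an initial sequence $\alpha$ with domain $\kappa$ is $d(x,x)=0$ and $d(x,y)=\alpha\bigl(\sup\{\mathrm{lev}(c): c\le x,\ c\le y\}\bigr)$ for $x\ne y$. **Theorem.** Let $V_0\subseteq V_1$ be models of set theory, let $W\in V_0$ be, in $V_0$, a continuous distance monoid, let $\kappa$ be its coinitiality in $V_0$, and suppose that $\kappa>\omega$ and that $\kappa$ has cofinality $\omega$ in $V_1$. Then there is in $V_0$ a $W$-dynamical system $(M,f)$ without fixed points that has a relativization to $V_1$ and each of whose relativizations to $V_1$ has a fixed point. Moreover, $M$ can be taken to be a pruned $\kappa$-tree $T\in V_0$ having no path in $V_0$, with the tree metric given by a nice initial sequence $\alpha\in V_0$, and $f$ such that $f(t)>t$ for all $t\in T$. In every relativization $(N,g,X)$ to $V_1$ each point is the limit of a Cauchy sequence in $V_1$ with values in $T$; each path of $T$ in $V_1$ converges to exactly one point of $N$; and a point of $N$ is a fixed point of $g$ if and only if it is the limit of a path of $T$ in $V_1$, which is then unique. -/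

import Mathlib

universe u

/-! ### Transitive models of ZFC -/

namespace FixAbs

/-- The only non-logical symbol of the language of set theory: a binary relation symbol. -/
inductive MemRel : ℕ → Type
  | mem : MemRel 2

/-- The first-order language `{∈}` of set theory. -/
def setLang : FirstOrder.Language := ⟨fun _ => Empty, MemRel⟩

/-- A class `V` of sets as the `{∈}`-structure `(V, ∈)`. -/
instance memStructure (V : Set ZFSet.{u}) : setLang.Structure V where
  funMap := fun f => f.elim
  RelMap := fun {_} r =>
    match r with
    | MemRel.mem => fun x => (x 0).1 ∈ (x 1).1

/-- `V` is a transitive class of sets and `(V, ∈)` satisfies ZFC: every axiom is interpreted in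
`(V, ∈)`, all quantifiers ranging over `V`, and the two schemes range over the relations on `V`
that are first-order definable over `(V, ∈)` with parameters from `V`. -/
structure IsModelOfSetTheory (V : Set ZFSet.{u}) : Prop where
  transitive : ∀ x ∈ V, ∀ y ∈ x, y ∈ V
  extensionality : ∀ x y : V, (∀ z : V, z.1 ∈ x.1 ↔ z.1 ∈ y.1) → x = y
  foundation : ∀ x : V, (∃ y : V, y.1 ∈ x.1) →
    ∃ y : V, y.1 ∈ x.1 ∧ ∀ z : V, z.1 ∈ x.1 → z.1 ∉ y.1
  pairing : ∀ x y : V, ∃ z : V, ∀ w : V, w.1 ∈ z.1 ↔ w = x ∨ w = y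
  union : ∀ x : V, ∃ u : V, ∀ z : V, z.1 ∈ u.1 ↔ ∃ y : V, y.1 ∈ x.1 ∧ z.1 ∈ y.1
  powerset : ∀ x : V, ∃ p : V, ∀ y : V, y.1 ∈ p.1 ↔ ∀ z : V, z.1 ∈ y.1 → z.1 ∈ x.1
  infinity : ∃ w : V, (∃ e : V, e.1 ∈ w.1 ∧ ∀ z : V, z.1 ∉ e.1) ∧
    ∀ x : V, x.1 ∈ w.1 → ∃ y : V, y.1 ∈ w.1 ∧ ∀ z : V, z.1 ∈ y.1 ↔ z.1 ∈ x.1 ∨ z = x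
  separation : ∀ D : Set V, Set.univ.Definable₁ setLang D →
    ∀ x : V, ∃ y : V, ∀ z : V, z.1 ∈ y.1 ↔ z.1 ∈ x.1 ∧ z ∈ D
  replacement : ∀ F : Set (V × V), Set.univ.Definable₂ setLang F →
    ∀ x : V, (∀ y : V, y.1 ∈ x.1 → ∃! z : V, (y, z) ∈ F) →
      ∃ w : V, ∀ z : V, z.1 ∈ w.1 ↔ ∃ y : V, y.1 ∈ x.1 ∧ (y, z) ∈ F
  choice : ∀ x : V, (∀ y : V, y.1 ∈ x.1 → ∃ z : V, z.1 ∈ y.1) →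
    (∀ y y' : V, y.1 ∈ x.1 → y'.1 ∈ x.1 → (∃ z : V, z.1 ∈ y.1 ∧ z.1 ∈ y'.1) → y = y') →
      ∃ c : V, ∀ y : V, y.1 ∈ x.1 → ∃! z : V, z.1 ∈ y.1 ∧ z.1 ∈ c.1

/-! ### Subsets, relations and functions that belong to a model -/

/-- The collection `S` is (the extension of) a set belonging to `V`. -/
def SetIn (V S : Set ZFSet.{u}) : Prop := ∃ s ∈ V, ∀ z, z ∈ s ↔ z ∈ S

/-- The subset `S` of `A` belongs to `V`. -/
def SubIn (V : Set ZFSet.{u}) {A : ZFSet.{u}} (S : Set A) : Prop :=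
  SetIn V {z | ∃ a ∈ S, z = a.1}

/-- The relation `r` on `A`, as a set of ordered pairs, belongs to `V`. -/
def RelIn (V : Set ZFSet.{u}) {A : ZFSet.{u}} (r : A → A → Prop) : Prop :=
  SetIn V {z | ∃ a b : A, r a b ∧ z = ZFSet.pair a.1 b.1}

/-- The function `f : A → B`, as a set of ordered pairs, belongs to `V`. -/
def FunIn (V : Set ZFSet.{u}) {A B : ZFSet.{u}} (f : A → B) : Prop :=
  SetIn V {z | ∃ a : A, z = ZFSet.pair a.1 (f a).1}

/-- The function `f : A × B → C`, as a set of ordered pairs, belongs to `V`. -/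
def Fun₂In (V : Set ZFSet.{u}) {A B C : ZFSet.{u}} (f : A → B → C) : Prop :=
  SetIn V {z | ∃ (a : A) (b : B), z = ZFSet.pair (ZFSet.pair a.1 b.1) (f a b).1}

/-- The function `p : D → B` with domain `D ⊆ A`, as a set of ordered pairs, belongs to `V`. -/
def PFunIn (V : Set ZFSet.{u}) {A B : ZFSet.{u}} {D : Set A} (p : D → B) : Prop :=
  SetIn V {z | ∃ a : D, z = ZFSet.pair a.1.1 (p a).1}

/-- The inclusion map of `A` into a larger set `B`. -/
def incl {A B : ZFSet.{u}} (h : A ⊆ B) (a : A) : B := ⟨a.1, h a.2⟩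

/-- `c` is the cofinality of the ordinal `κ` in `V`: the least ordinal which is the domain of a
function in `V` whose range is cofinal in `κ`. -/
def IsCofinality (V : Set ZFSet.{u}) (κ c : ZFSet.{u}) : Prop :=
  let Reaches : ZFSet.{u} → Prop := fun d =>
    d.IsOrdinal ∧ ∃ g : d → κ, FunIn V g ∧ ∀ i : κ, ∃ j : d, i.1 ⊆ (g j).1
  Reaches c ∧ ∀ d, Reaches d → c ⊆ d

/-! ### Distance monoids -/

/-- A structure `(W, +, 0, ≤)` on a set. -/
structure DistStr : Type (u + 1) where
  carrier : ZFSet.{u}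
  add : carrier → carrier → carrier
  zero : carrier
  le : carrier → carrier → Prop

namespace DistStr

variable (V : Set ZFSet.{u}) (W : DistStr.{u})

/-- The structure `W` belongs to `V`. -/
def In : Prop := W.carrier ∈ V ∧ Fun₂In V W.add ∧ RelIn V W.le

/-- `m` is the infimum of `A`. -/
def IsInf (A : Set W.carrier) (m : W.carrier) : Prop :=
  (∀ a ∈ A, W.le m a) ∧ ∀ l, (∀ a ∈ A, W.le l a) → W.le l m

/-- `m` is the supremum of `A`. -/
def IsSup (A : Set W.carrier) (m : W.carrier) : Prop :=
  (∀ a ∈ A, W.le a m) ∧ ∀ l, (∀ a ∈ A, W.le a l) → W.le m l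

/-- `V` thinks that `W` is a distance monoid. -/
structure IsDistanceMonoid : Prop where
  add_assoc : ∀ a b c, W.add (W.add a b) c = W.add a (W.add b c)
  add_comm : ∀ a b, W.add a b = W.add b a
  zero_add : ∀ a, W.add W.zero a = a
  le_refl : ∀ a, W.le a a
  le_trans : ∀ a b c, W.le a b → W.le b c → W.le a c
  le_antisymm : ∀ a b, W.le a b → W.le b a → a = b
  le_total : ∀ a b, W.le a b ∨ W.le b a
  zero_le : ∀ a, W.le W.zero a
  add_le_add_left : ∀ a b c, W.le a b → W.le (W.add c a) (W.add c b)
  add_inf : ∀ A : Set W.carrier, SubIn V A → ∀ b m, W.IsInf A m →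
    W.IsInf {x | ∃ a ∈ A, x = W.add b a} (W.add b m)

/-- `V` thinks that the order of `W` is complete. -/
def IsComplete : Prop :=
  ∀ A : Set W.carrier, SubIn V A → (∃ m, W.IsInf A m) ∧ ∃ m, W.IsSup A m

/-- `W` is continuous at `0`: the infimum of all `a + b` with `a, b ≠ 0` is `0`. -/
def IsContinuousAtZero : Prop :=
  W.IsInf {x | ∃ a b, a ≠ W.zero ∧ b ≠ W.zero ∧ x = W.add a b} W.zero

/-- `V` thinks that `W` is a continuous distance monoid. -/
def IsContinuous : Prop :=
  W.IsDistanceMonoid V ∧ W.IsComplete V ∧ W.IsContinuousAtZero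

/-- `s` is an initial sequence of `W` in `V` with domain the ordinal `κ`. -/
def IsInitialSeq {κ : ZFSet.{u}} (s : κ → W.carrier) : Prop :=
  FunIn V s ∧ (∀ i, s i ≠ W.zero) ∧ (∀ i j : κ, i.1 ⊆ j.1 → W.le (s j) (s i)) ∧
    ∀ a, a ≠ W.zero → ∃ i, W.le (s i) a

/-- `κ` is the coinitiality of `W` in `V`: the least ordinal which is the domain of an initial
sequence in `V`. -/
def IsCoinitiality (κ : ZFSet.{u}) : Prop :=
  (κ.IsOrdinal ∧ ∃ s : κ → W.carrier, W.IsInitialSeq V s) ∧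
    ∀ d : ZFSet.{u}, d.IsOrdinal → (∃ s : d → W.carrier, W.IsInitialSeq V s) → κ ⊆ d

/-- `s` is nice: `4 · s (i + 1) ≤ s i`. -/
def IsNice {κ : ZFSet.{u}} (s : κ → W.carrier) : Prop :=
  ∀ i j : κ, j.1 = insert i.1 i.1 →
    W.le (W.add (W.add (s j) (s j)) (W.add (s j) (s j))) (s i)

/-- `V` thinks that `X ⊇ W` is a completion of the distance monoid `W`: a complete distance monoid
extending `W` whose order is the Dedekind–MacNeille completion of that of `W`, i.e. `W` is both
meet-dense and join-dense in it. -/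
structure IsCompletion (X : DistStr.{u}) : Prop where
  sub : W.carrier ⊆ X.carrier
  add_eq : ∀ a b, X.add (incl sub a) (incl sub b) = incl sub (W.add a b)
  zero_eq : X.zero = incl sub W.zero
  le_iff : ∀ a b, X.le (incl sub a) (incl sub b) ↔ W.le a b
  isDistanceMonoid : X.IsDistanceMonoid V
  isComplete : X.IsComplete V
  meet_dense : ∀ x, X.IsInf {y | ∃ w, y = incl sub w ∧ X.le x y} x
  join_dense : ∀ x, X.IsSup {y | ∃ w, y = incl sub w ∧ X.le y x} x

end DistStr

/-! ### Generalized metric spaces and dynamical systems -/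

/-- A set with a `W`-valued distance and a self-map. -/
structure DynStr (W : DistStr.{u}) : Type (u + 1) where
  points : ZFSet.{u}
  dist : points → points → W.carrier
  map : points → points

namespace DynStr

variable (V : Set ZFSet.{u}) {W X : DistStr.{u}} (S : DynStr W) (R : DynStr X)

/-- The structure belongs to `V`. -/
def In : Prop := W.In V ∧ S.points ∈ V ∧ Fun₂In V S.dist ∧ FunIn V S.map

/-- `(points, dist)` is a `W`-metric space (the distance need not be symmetric). -/
def IsMetric : Prop :=
  (∀ x y, (S.dist x y = W.zero ∧ S.dist y x = W.zero) ↔ x = y) ∧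
    ∀ x y z, W.le (S.dist x z) (W.add (S.dist x y) (S.dist y z))

/-- `p : A → points` is a Cauchy sequence belonging to `V`. -/
def IsCauchySeq {A : Set W.carrier} (p : A → S.points) : Prop :=
  PFunIn V p ∧ W.zero ∉ A ∧ W.IsInf {x | ∃ a ∈ A, ∃ b ∈ A, x = W.add a b} W.zero ∧
    ∀ a b : A, W.le (S.dist (p a) (p b)) (W.add a.1 b.1)

/-- `p` converges to `x`: `⋁_{a ≠ 0} ⋀_{b ≤ a, b ∈ A} d(x, p b) = 0`, and likewise for `d(p b, x)`.
(As `0` is the least element, the supremum is `0` iff all the infima are.) -/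
def ConvergesTo {A : Set W.carrier} (p : A → S.points) (x : S.points) : Prop :=
  ∀ a, a ≠ W.zero →
    W.IsInf {d | ∃ b : A, W.le b.1 a ∧ d = S.dist x (p b)} W.zero ∧
    W.IsInf {d | ∃ b : A, W.le b.1 a ∧ d = S.dist (p b) x} W.zero

/-- Every Cauchy sequence in `V` converges. -/
def IsCauchyComplete : Prop :=
  ∀ (A : Set W.carrier) (p : A → S.points), S.IsCauchySeq V p → ∃ x, S.ConvergesTo p x

/-- The self-map is non-expanding. -/
def IsNonExpanding : Prop := ∀ x y, W.le (S.dist (S.map x) (S.map y)) (S.dist x y)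

/-- `S` belongs to `V`, and `V` thinks that `W` is a complete distance monoid and that `S` is a
`W`-dynamical system. -/
structure IsDynSys : Prop where
  mem : S.In V
  isDistanceMonoid : W.IsDistanceMonoid V
  isComplete : W.IsComplete V
  isMetric : S.IsMetric
  isCauchyComplete : S.IsCauchyComplete V
  isNonExpanding : S.IsNonExpanding

/-- There is a fixed point. -/
def HasFixedPoint : Prop := ∃ x, S.map x = x

variable {S R} in
/-- `(h, k)` is a homomorphism of two-sorted structures in the language of distance monoids with
a distance symbol and a symbol for the self-map. -/
structure IsHom (S : DynStr W) (R : DynStr X) (h : W.carrier → X.carrier)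
    (k : S.points → R.points) : Prop where
  map_add : ∀ a b, h (W.add a b) = X.add (h a) (h b)
  map_zero : h W.zero = X.zero
  map_le : ∀ a b, W.le a b → X.le (h a) (h b)
  map_dist : ∀ x y, h (S.dist x y) = R.dist (k x) (k y)
  map_map : ∀ x, k (S.map x) = R.map (k x)

/-- `(h, k)` is an embedding. -/
structure IsEmb (S : DynStr W) (R : DynStr X) (h : W.carrier → X.carrier)
    (k : S.points → R.points) : Prop extends IsHom S R h k where
  injective_h : Function.Injective h
  injective_k : Function.Injective k
  le_of_map_le : ∀ a b, X.le (h a) (h b) → W.le a b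

/-- `R` is a relativization of `S` to `V` with respect to the property `P`: `R` has `P`, it
contains `S` as a substructure, embeddings of `R` into itself over `S` are automorphisms, and `R`
maps homomorphically over `S` to every structure in `V` which has `P` and contains `S`. -/
structure IsRelativization (P : ∀ Y : DistStr.{u}, DynStr Y → Prop) : Prop where
  mem : R.In V
  prop : P X R
  sub_dm : W.carrier ⊆ X.carrier
  sub_pt : S.points ⊆ R.points
  hom : IsHom S R (incl sub_dm) (incl sub_pt)
  rigid : ∀ (h : X.carrier → X.carrier) (k : R.points → R.points), FunIn V h → FunIn V k →
    IsEmb R R h k → (∀ w, h (incl sub_dm w) = incl sub_dm w) →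
    (∀ x, k (incl sub_pt x) = incl sub_pt x) → Function.Surjective h ∧ Function.Surjective k
  minimal : ∀ (Y : DistStr.{u}) (Q : DynStr Y), Q.In V → P Y Q →
    ∀ (s_dm : W.carrier ⊆ Y.carrier) (s_pt : S.points ⊆ Q.points),
    IsHom S Q (incl s_dm) (incl s_pt) →
    ∃ (h : X.carrier → Y.carrier) (k : R.points → Q.points), FunIn V h ∧ FunIn V k ∧
      IsHom R Q h k ∧ (∀ w, h (incl sub_dm w) = incl s_dm w) ∧
      ∀ x, k (incl sub_pt x) = incl s_pt x

/-- The property with respect to which dynamical systems over `W` are relativized to `V`: being,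
in `V`, a generalized dynamical system whose distance monoid is the completion of `W`. -/
def CompletedDynSys (W : DistStr.{u}) (Y : DistStr.{u}) (Q : DynStr Y) : Prop :=
  Q.IsDynSys V ∧ W.IsCompletion V Y

/-- Every point of `R` is the limit of a Cauchy sequence in `V` with values in `S`. -/
def IsDenseIn (h : S.points ⊆ R.points) : Prop :=
  ∀ x : R.points, ∃ (A : Set X.carrier) (p : A → S.points),
    R.IsCauchySeq V (fun a => incl h (p a)) ∧ R.ConvergesTo (fun a => incl h (p a)) x

end DynStr

/-! ### Trees -/

namespace Tree

variable {T : ZFSet.{u}} (le : T → T → Prop) (κ : ZFSet.{u})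

/-- The strict order. -/
def Lt (a b : T) : Prop := le a b ∧ a ≠ b

/-- The set of strict predecessors of `a` is well-ordered with order type the ordinal `i`. -/
def HasLevel (a : T) (i : ZFSet.{u}) : Prop :=
  i.IsOrdinal ∧ ∃ e : {b : T // Lt le b a} ≃ i,
    ∀ b c : {b : T // Lt le b a}, Lt le b.1 c.1 ↔ (e b).1 ∈ (e c).1

/-- `(T, ≤)` is a `κ`-tree. (For a partial order in a transitive model this does not depend on the
model, since well-orders and their order types do not.) -/
structure IsTree : Prop where
  refl : ∀ a, le a a
  trans : ∀ a b c, le a b → le b c → le a c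
  antisymm : ∀ a b, le a b → le b a → a = b
  root : ∃! r, ∀ b, ¬ Lt le b r
  level : ∀ a, ∃ i ∈ κ, HasLevel le a i

/-- `(T, ≤)` is pruned: every element has extensions at all higher levels below `κ`. -/
def IsPruned : Prop :=
  ∀ a : T, ∀ i, HasLevel le a i → ∀ β ∈ κ, i ∈ β → ∃ b, HasLevel le b β ∧ le a b

variable {κ} in
/-- `p` is a path through the `κ`-tree which belongs to `V`. -/
def IsPath (V : Set ZFSet.{u}) (p : κ → T) : Prop :=
  FunIn V p ∧ (∀ i, HasLevel le (p i) i.1) ∧ ∀ i j : κ, i.1 ∈ j.1 → Lt le (p i) (p j)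

/-- `j` is the join of two different elements `a`, `b`: the union of the levels of their common
lower bounds. -/
def IsJoin (a b : T) (j : ZFSet.{u}) : Prop :=
  ∀ z, z ∈ j ↔ ∃ c i, le c a ∧ le c b ∧ HasLevel le c i ∧ z ∈ i

end Tree

namespace DynStr

variable {W X : DistStr.{u}} (S : DynStr W) (R : DynStr X)

/-- The distance of `S` is the tree metric given by the tree order `le` on its set of points and
the initial sequence `α`: `d(x, x) = 0`, and `d(x, y) = α (join x y)` if `x ≠ y`. (This is the
whole space of the tree whenever the tree has no path.) -/
def IsTreeMetric (le : S.points → S.points → Prop) {κ : ZFSet.{u}} (α : κ → W.carrier) : Prop :=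
  (∀ x, S.dist x x = W.zero) ∧
    ∀ x y, x ≠ y → ∃ j : κ, Tree.IsJoin le x y j.1 ∧ S.dist x y = α j

/-- The `κ`-sequence `p` in `R` converges to `x`, in both directions of the distance. -/
def IsLimit {κ : ZFSet.{u}} (p : κ → R.points) (x : R.points) : Prop :=
  ∀ ε, ε ≠ X.zero → ∃ i : κ, ∀ j : κ, i.1 ⊆ j.1 →
    X.le (R.dist x (p j)) ε ∧ X.le (R.dist (p j) x) ε

end DynStr

end FixAbs

/-! The idea is to code a cofinal map from `ω` to `κ` as a path of a tree whose nodes do not depend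
on the model. A thread is a partial function on an initial segment of `κ`. At each stage `γ` it
holds a promise `x(γ) > γ`, which it keeps until stage `x(γ)`; and whenever it reaches a stage `l ≠
0`, some promise made below `l` lasts at least until `l`. So only finitely many promises occur below
any such `l`, and a thread of length less than `κ` consists of finitely many constant blocks. Such
threads therefore belong to every model containing `κ` (`IsThread.mem_model`).

A thread of full length `κ` amounts to a cofinal `ω`-sequence in `κ`. In `V₀` the coinitiality `κ`
is regular, and a recursion in the model produces a limit stage below `κ` closed under the promises
of a supposed full thread. This contradicts the limit condition (`IsThread.dom_ne`). In `V₁`, a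
cofinal `g : ω → κ` gives a full thread: promise the first `g n` above `γ` (`exists_full_thread`).

The system in `V₀` is the set of all its threads, ordered by inclusion, with distance `α` of the
length of agreement, where `α` is a strictly decreasing nice initial sequence (a scale). The map
extends each thread by one stage. It is non-expanding because extending two threads cannot shorten
their agreement. It moves exactly the threads that are not full, so it has no fixed point in `V₀`.
Cauchy sequences converge because the eventual pairs of a Cauchy sequence of threads form a thread.

Over the completion of `W`, built in `V₁` from closed cuts, the same construction in `V₁` adds
precisely the full threads, that is, the paths of the tree. They are fixed. This space is a
relativization: given any competitor, send a thread to the limit there of its proper restrictions,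
all of which lie in `V₀` (`exists_extension`). Conversely, composing this map for a relativization
with the map back provided by minimality gives a self-embedding over the original system. Rigidity
makes it surjective, so every relativization is a copy of the thread space of `V₁`
(`DynStr.IsRelativization.exists_iso`), from which density, limits of paths and fixed points are
read off.

Membership in a model is handled by a small calculus of definability: relations definable over `(V,
∈)` with parameters are closed under the logical operations, and separation turns them into sets of
the model. -/

namespace FixAbs

open FirstOrder FirstOrder.Language

/-! ### Definable relations and functions over a class of sets -/

/-- Assignments of elements of `V` to countably many variables. -/
abbrev Env (V : Set ZFSet.{u}) := ℕ → V

/-- Forget the variable `0`. -/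
abbrev Env.tail {V : Set ZFSet.{u}} (v : Env V) : Env V := fun n => v (n + 1)

/-- Add a new value for the variable `0`. -/
def Env.cons {V : Set ZFSet.{u}} (x : V) (v : Env V) : Env V
  | 0 => x
  | n + 1 => v n

variable {V : Set ZFSet.{u}}

@[simp] theorem Env.tail_apply (v : Env V) (n : ℕ) : v.tail n = v (n + 1) := rfl

/-- `P` is first-order definable over `(V, ∈)` with parameters. -/
class DefRel (P : Env V → Prop) : Prop where
  out : ∃ φ : (setLang[[(Set.univ : Set V)]]).Formula ℕ, ∀ v, P v ↔ φ.Realize v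

/-- `F` takes values in `V` and its graph is first-order definable over `(V, ∈)` with parameters. -/
class DefFun (F : Env V → ZFSet.{u}) : Prop where
  mem : ∀ v, F v ∈ V
  graph : DefRel (fun v : Env V => (v 0).1 = F v.tail)

theorem DefRel.congr {P Q : Env V → Prop} (h : DefRel P) (hPQ : ∀ v, Q v ↔ P v) : DefRel Q := by
  have : Q = P := funext fun v => propext (hPQ v)
  rwa [this]

/-- Parameters are constants of the expanded language, so variables and parameters can be
substituted alike. Renaming variables and freezing parameters are both special cases. -/
theorem DefRel.subst {P : Env V → Prop} (h : DefRel P) (σ : ℕ → ℕ ⊕ V) :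
    DefRel (fun v : Env V => P (fun n => Sum.elim v id (σ n))) := by
  obtain ⟨φ, hφ⟩ := h.out
  refine ⟨BoundedFormula.subst φ (fun n => Sum.elim (fun k => Term.var k)
    (fun c => (setLang.con (⟨c, trivial⟩ : (Set.univ : Set V))).term) (σ n)), fun v => ?_⟩
  rw [hφ]
  unfold Formula.Realize
  rw [BoundedFormula.realize_subst]
  apply iff_of_eq
  congr 1
  funext n
  rcases σ n with k | c
  · rfl
  · simp

theorem DefRel.relabel {P : Env V → Prop} (h : DefRel P) (σ : ℕ → ℕ) :
    DefRel (fun v : Env V => P (fun n => v (σ n))) :=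
  h.subst (fun n => Sum.inl (σ n))

/-- Fix the values of all variables but the first. -/
theorem DefRel.param {P : Env V → Prop} (h : DefRel P) (w : Env V) :
    DefRel (fun v : Env V => P (Env.cons (v 0) w)) := by
  refine (h.subst (fun n => Nat.casesOn n (Sum.inl 0) (fun k => Sum.inr (w k)))).congr fun v => ?_
  apply iff_of_eq
  congr 1
  funext n
  cases n <;> rfl

/-- Variables are handled in de Bruijn style: under the quantifier the bound variable is variable
`0` and the free ones are shifted by one, which is what `v.tail` undoes. -/
theorem DefRel.ex_model {Q : Env V → V → Prop}
    (h : DefRel (fun v : Env V => Q v.tail (v 0))) : DefRel (fun v => ∃ x : V, Q v x) := by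
  obtain ⟨φ, hφ⟩ := h.out
  refine ⟨Formula.iExs (Fin 1) (Formula.relabel
    (fun n : ℕ => (Nat.casesOn n (Sum.inr 0) (fun k => Sum.inl k) : ℕ ⊕ Fin 1)) φ), fun v => ?_⟩
  rw [Formula.realize_iExs]
  have key : ∀ x : V, Q v x ↔ φ.Realize (Env.cons x v) := fun x => hφ (Env.cons x v)
  have aux : ∀ i : Fin 1 → V, (Sum.elim v i ∘
      (fun n : ℕ => (Nat.casesOn n (Sum.inr 0) (fun k => Sum.inl k) : ℕ ⊕ Fin 1))) =
      Env.cons (i 0) v := by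
    intro i
    funext n
    cases n <;> rfl
  constructor
  · rintro ⟨x, hx⟩
    refine ⟨fun _ => x, ?_⟩
    rw [Formula.realize_relabel, aux]
    exact (key x).1 hx
  · rintro ⟨i, hi⟩
    rw [Formula.realize_relabel, aux] at hi
    exact ⟨i 0, (key _).2 hi⟩

/-- The closure properties are instances, so that `inferInstance` proves definability from the
syntactic shape of a relation. For this reason the formulas used later speak of sets instead of
subtypes and bound their quantifiers explicitly. -/
instance DefRel.const (p : Prop) : DefRel (fun _ : Env V => p) := by
  by_cases h : p
  · exact ⟨⊤, fun v => by simp [h]⟩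
  · exact ⟨⊥, fun v => by simp [h]⟩

instance DefRel.not {P : Env V → Prop} [h : DefRel P] : DefRel (fun v => ¬ P v) := by
  obtain ⟨φ, hφ⟩ := h.out
  exact ⟨φ.not, fun v => by rw [Formula.realize_not, hφ]⟩

instance DefRel.imp {P Q : Env V → Prop} [h : DefRel P] [h' : DefRel Q] :
    DefRel (fun v => P v → Q v) := by
  obtain ⟨φ, hφ⟩ := h.out
  obtain ⟨ψ, hψ⟩ := h'.out
  exact ⟨φ.imp ψ, fun v => by rw [Formula.realize_imp, hφ, hψ]⟩

instance DefRel.and {P Q : Env V → Prop} [DefRel P] [DefRel Q] :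
    DefRel (fun v => P v ∧ Q v) :=
  (inferInstance : DefRel (fun v : Env V => ¬ (P v → ¬ Q v))).congr fun v => by tauto

instance DefRel.or {P Q : Env V → Prop} [DefRel P] [DefRel Q] :
    DefRel (fun v => P v ∨ Q v) :=
  (inferInstance : DefRel (fun v : Env V => ¬ P v → Q v)).congr fun v => by tauto

instance DefRel.iff {P Q : Env V → Prop} [DefRel P] [DefRel Q] :
    DefRel (fun v => P v ↔ Q v) :=
  (inferInstance : DefRel (fun v : Env V => (P v → Q v) ∧ (Q v → P v))).congr
    fun v => by tauto

theorem DefRel.all_model {Q : Env V → V → Prop}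
    (h : DefRel (fun v : Env V => Q v.tail (v 0))) : DefRel (fun v => ∀ x : V, Q v x) := by
  have h1 := DefRel.ex_model (Q := fun v x => ¬ Q v x) (@DefRel.not V _ h)
  exact (@DefRel.not V _ h1).congr fun v => by simp

theorem DefRel.var_mem (i j : ℕ) : DefRel (fun v : Env V => (v i).1 ∈ (v j).1) := by
  have : ∃ φ : setLang.Formula ℕ, ∀ v : Env V, (v i).1 ∈ (v j).1 ↔ φ.Realize v := by
    let r : setLang.Relations 2 := MemRel.mem
    refine ⟨r.formula₂ (Term.var i) (Term.var j), fun v => ?_⟩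
    have := Formula.realize_rel₂ (M := V) (R := r) (t₁ := Term.var i) (t₂ := Term.var j) (v := v)
    rw [this]
    rfl
  obtain ⟨φ, hφ⟩ := this
  exact ⟨(lhomWithConstants setLang _).onFormula φ, fun v => by
    rw [LHom.realize_onFormula, hφ]⟩

theorem DefRel.var_eq (i j : ℕ) : DefRel (fun v : Env V => (v i).1 = (v j).1) :=
  ⟨Term.equal (Term.var i) (Term.var j), fun v => by
    rw [Formula.realize_equal]
    exact Subtype.ext_iff.symm⟩

theorem DefRel.var_eq_const (i : ℕ) (c : V) : DefRel (fun v : Env V => (v i).1 = c.1) := by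
  refine ((DefRel.var_eq 0 1).subst (fun n => if n = 0 then Sum.inl i else Sum.inr c)).congr
    fun v => ?_
  simp

instance DefFun.var (n : ℕ) : DefFun (fun v : Env V => (v n).1) :=
  ⟨fun v => (v n).2, DefRel.var_eq 0 (n + 1)⟩

instance DefFun.const (c : ZFSet.{u}) [h : Fact (c ∈ V)] : DefFun (fun _ : Env V => c) :=
  ⟨fun _ => h.out, DefRel.var_eq_const 0 ⟨c, h.out⟩⟩

theorem DefFun.tail {F : Env V → ZFSet.{u}} (h : DefFun F) :
    DefFun (fun v : Env V => F v.tail) := by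
  refine ⟨fun v => h.mem _, ?_⟩
  refine (h.graph.relabel (fun n => Nat.casesOn n 0 (fun k => k + 2))).congr fun v => Iff.rfl

/-- Substitution of a definable function into a definable relation. -/
theorem DefRel.app {Q : Env V → ZFSet.{u} → Prop} {F : Env V → ZFSet.{u}}
    (h : DefRel (fun v : Env V => Q v.tail (v 0).1)) (hF : DefFun F) :
    DefRel (fun v => Q v (F v)) := by
  have h1 := hF.graph
  -- The quantifier ranges over `V` only; `hF.mem` guarantees that the value of `F` is available as
  -- a witness.
  have := DefRel.ex_model (Q := fun v x => x.1 = F v ∧ Q v x.1) (@DefRel.and V _ _ h1 h)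
  refine this.congr fun v => ⟨fun hQ => ⟨⟨F v, hF.mem v⟩, rfl, hQ⟩, ?_⟩
  rintro ⟨x, hx, hQ⟩
  rwa [← hx]

theorem DefRel.comp₁ {R : ZFSet.{u} → Prop} (h : DefRel (fun v : Env V => R (v 0).1))
    {F : Env V → ZFSet.{u}} (hF : DefFun F) : DefRel (fun v => R (F v)) :=
  DefRel.app (Q := fun _ x => R x) h hF

theorem DefRel.comp₂ {R : ZFSet.{u} → ZFSet.{u} → Prop}
    (h : DefRel (fun v : Env V => R (v 0).1 (v 1).1))
    {F G : Env V → ZFSet.{u}} (hF : DefFun F) (hG : DefFun G) :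
    DefRel (fun v => R (F v) (G v)) :=
  DefRel.app (Q := fun v x => R x (G v))
    (DefRel.app (Q := fun v y => R (v 0).1 y)
      -- `1 - n` exchanges the variables 0 and 1, because nested substitution introduces the
      -- arguments in reverse order.
      (h.relabel fun n => 1 - n) hG.tail) hF

theorem DefRel.comp₃ {R : ZFSet.{u} → ZFSet.{u} → ZFSet.{u} → Prop}
    (h : DefRel (fun v : Env V => R (v 0).1 (v 1).1 (v 2).1))
    {F G H : Env V → ZFSet.{u}} (hF : DefFun F) (hG : DefFun G) (hH : DefFun H) :
    DefRel (fun v => R (F v) (G v) (H v)) :=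
  DefRel.app (Q := fun v x => R x (G v) (H v))
    (DefRel.app (Q := fun v y => R (v 0).1 y (H v.tail))
      (DefRel.app (Q := fun v z => R (v 1).1 (v 0).1 z)
        (h.relabel fun n => 2 - n)
        hH.tail.tail) hG.tail) hF

instance DefRel.mem {F G : Env V → ZFSet.{u}} [hF : DefFun F] [hG : DefFun G] :
    DefRel (fun v => F v ∈ G v) :=
  DefRel.comp₂ (R := fun a b => a ∈ b) (DefRel.var_mem 0 1) hF hG

instance DefRel.eq {F G : Env V → ZFSet.{u}} [hF : DefFun F] [hG : DefFun G] :
    DefRel (fun v => F v = G v) :=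
  DefRel.comp₂ (R := fun a b => a = b) (DefRel.var_eq 0 1) hF hG

instance DefRel.ne {F G : Env V → ZFSet.{u}} [DefFun F] [DefFun G] :
    DefRel (fun v => F v ≠ G v) :=
  inferInstanceAs (DefRel fun v => ¬ F v = G v)

instance DefRel.ex_inModel {Q : Env V → ZFSet.{u} → Prop}
    [h : DefRel (fun v : Env V => Q v.tail (v 0).1)] :
    DefRel (fun v => ∃ x : ZFSet.{u}, x ∈ V ∧ Q v x) :=
  (DefRel.ex_model (Q := fun v x => Q v x.1) h).congr fun v => by simp

end FixAbs

namespace FixAbs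

/-! ### Closure properties of models of set theory -/

variable {V : Set ZFSet.{u}}

theorem DefFun.comp₁ {op : ZFSet.{u} → ZFSet.{u}} (h : DefFun (fun v : Env V => op (v 0).1))
    {F : Env V → ZFSet.{u}} (hF : DefFun F) : DefFun (fun v => op (F v)) := by
  refine ⟨fun v => h.mem (fun _ => ⟨F v, hF.mem v⟩), ?_⟩
  have hg : DefRel (fun v : Env V => (v 0).1 = op (v 1).1) := h.graph
  exact DefRel.comp₂ (R := fun a b => a = op b) hg (DefFun.var 0) hF.tail

theorem DefFun.comp₂ {op : ZFSet.{u} → ZFSet.{u} → ZFSet.{u}}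
    (h : DefFun (fun v : Env V => op (v 0).1 (v 1).1))
    {F G : Env V → ZFSet.{u}} (hF : DefFun F) (hG : DefFun G) :
    DefFun (fun v => op (F v) (G v)) := by
  refine ⟨fun v => h.mem (Env.cons ⟨F v, hF.mem v⟩ (fun _ => ⟨G v, hG.mem v⟩)), ?_⟩
  have hg : DefRel (fun v : Env V => (v 0).1 = op (v 1).1 (v 2).1) := h.graph
  exact DefRel.comp₃ (R := fun a b c => a = op b c) hg (DefFun.var 0) hF.tail hG.tail

section Model

variable [hV : Fact (IsModelOfSetTheory V)]

theorem mem_of_mem_mem {x y : ZFSet.{u}} (hx : x ∈ V) (hy : y ∈ x) : y ∈ V :=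
  hV.out.transitive x hx y hy

theorem DefFun.mem_of_mem {F : Env V → ZFSet.{u}} (h : DefFun F) {v : Env V} {x : ZFSet.{u}}
    (hx : x ∈ F v) : x ∈ V := mem_of_mem_mem (h.mem v) hx

/-- By transitivity the elements of a value of `F` lie in `V`, so a bounded quantifier over all sets
agrees with the quantifier of the model. -/
instance DefRel.ex_mem {F : Env V → ZFSet.{u}} {Q : Env V → ZFSet.{u} → Prop} [hF : DefFun F]
    [h : DefRel (fun v : Env V => Q v.tail (v 0).1)] :
    DefRel (fun v => ∃ x : ZFSet.{u}, x ∈ F v ∧ Q v x) := by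
  have h1 : DefRel (fun v : Env V => (v 0).1 ∈ F v.tail) :=
    @DefRel.mem V _ _ (DefFun.var 0) hF.tail
  refine (DefRel.ex_model (Q := fun v x => x.1 ∈ F v ∧ Q v x.1) (@DefRel.and V _ _ h1 h)).congr
    fun v => ⟨?_, ?_⟩
  · rintro ⟨x, hx, hQ⟩
    exact ⟨⟨x, hF.mem_of_mem hx⟩, hx, hQ⟩
  · rintro ⟨x, hx, hQ⟩
    exact ⟨x, hx, hQ⟩

instance DefRel.all_mem {F : Env V → ZFSet.{u}} {Q : Env V → ZFSet.{u} → Prop} [hF : DefFun F]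
    [h : DefRel (fun v : Env V => Q v.tail (v 0).1)] :
    DefRel (fun v => ∀ x : ZFSet.{u}, x ∈ F v → Q v x) := by
  have h1 := @DefRel.ex_mem V hV F (fun v x => ¬ Q v x) hF (@DefRel.not V _ h)
  exact (@DefRel.not V _ h1).congr fun v => by simp

instance DefRel.subset {F G : Env V → ZFSet.{u}} [hF : DefFun F] [hG : DefFun G] :
    DefRel (fun v => F v ⊆ G v) :=
  DefRel.comp₂ (R := fun a b => a ⊆ b)
    ((inferInstance : DefRel (fun v : Env V => ∀ x : ZFSet.{u}, x ∈ (v 0).1 → x ∈ (v 1).1)).congr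
      fun v => by rw [ZFSet.subset_def]) hF hG

/-- Both sides of `v 0 = F v.tail` are subsets of `V`, so by extensionality equality amounts to
having the same members in `V`. -/
theorem DefFun.of_mem {F : Env V → ZFSet.{u}} (hF : ∀ v, F v ∈ V)
    (h : DefRel (fun v : Env V => (v 0).1 ∈ F v.tail)) : DefFun F := by
  refine ⟨hF, ?_⟩
  have h1 : DefRel (fun v : Env V => ∀ x : V, (x.1 ∈ (v 0).1 ↔ x.1 ∈ F v.tail)) := by
    refine DefRel.all_model (Q := fun v x => (x.1 ∈ (v 0).1 ↔ x.1 ∈ F v.tail)) ?_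
    have := h.relabel (fun n => Nat.casesOn n 0 (fun k => k + 2))
    exact @DefRel.iff V _ _ (inferInstance : DefRel fun v : Env V => (v 0).1 ∈ (v.tail 0).1) this
  refine h1.congr fun v => ⟨fun h x => by rw [h], fun h => ?_⟩
  ext x
  constructor
  · intro hx
    exact (h ⟨x, mem_of_mem_mem (v 0).2 hx⟩).1 hx
  · intro hx
    exact (h ⟨x, mem_of_mem_mem (hF _) hx⟩).2 hx

theorem sep_mem_model {x : ZFSet.{u}} (hx : x ∈ V) {P : ZFSet.{u} → Prop}
    (h : DefRel (fun v : Env V => P (v 0).1)) : ZFSet.sep P x ∈ V := by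
  obtain ⟨φ, hφ⟩ := h.out
  have hD : Set.univ.Definable₁ setLang {y : V | P y.1} := by
    -- `P` looks at the variable 0 only, so all variables of `φ` may be identified with it.
    refine ⟨φ.relabel (fun _ => (0 : Fin 1)), ?_⟩
    ext y
    simp only [Set.mem_ofPred_eq, FirstOrder.Language.Formula.realize_relabel]
    exact hφ (fun _ => y 0)
  obtain ⟨y, hy⟩ := hV.out.separation _ hD ⟨x, hx⟩
  have : ZFSet.sep P x = y.1 := by
    ext z
    rw [ZFSet.mem_sep]
    constructor
    · rintro ⟨hz, hP⟩
      exact (hy ⟨z, mem_of_mem_mem hx hz⟩).2 ⟨hz, hP⟩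
    · intro hz
      exact (hy ⟨z, mem_of_mem_mem y.2 hz⟩).1 hz
  rw [this]
  exact y.2

instance DefFun.sep {F : Env V → ZFSet.{u}} {Q : Env V → ZFSet.{u} → Prop} [hF : DefFun F]
    [h : DefRel (fun v : Env V => Q v.tail (v 0).1)] :
    DefFun (fun v => ZFSet.sep (Q v) (F v)) := by
  refine DefFun.of_mem (fun v => sep_mem_model (hF.mem v) (h.param v)) ?_
  have h1 : DefRel (fun v : Env V => (v 0).1 ∈ F v.tail) :=
    @DefRel.mem V _ _ (DefFun.var 0) hF.tail
  exact (@DefRel.and V _ _ h1 h).congr fun v => by rw [ZFSet.mem_sep]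

theorem upair_mem_model {x y : ZFSet.{u}} (hx : x ∈ V) (hy : y ∈ V) : ({x, y} : ZFSet) ∈ V := by
  obtain ⟨z, hz⟩ := hV.out.pairing ⟨x, hx⟩ ⟨y, hy⟩
  have : ({x, y} : ZFSet) = z.1 := by
    ext w
    rw [ZFSet.mem_pair]
    constructor
    · rintro (rfl | rfl)
      · exact (hz ⟨_, hx⟩).2 (Or.inl rfl)
      · exact (hz ⟨_, hy⟩).2 (Or.inr rfl)
    · intro hw
      simpa [Subtype.ext_iff] using (hz ⟨w, mem_of_mem_mem z.2 hw⟩).1 hw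
  rw [this]
  exact z.2

theorem sUnion_mem_model {x : ZFSet.{u}} (hx : x ∈ V) : (ZFSet.sUnion x : ZFSet) ∈ V := by
  obtain ⟨z, hz⟩ := hV.out.union ⟨x, hx⟩
  have : (ZFSet.sUnion x : ZFSet) = z.1 := by
    ext w
    rw [ZFSet.mem_sUnion]
    constructor
    · rintro ⟨y, hy, hw⟩
      have hy' := mem_of_mem_mem hx hy
      exact (hz ⟨w, mem_of_mem_mem hy' hw⟩).2 ⟨⟨y, hy'⟩, hy, hw⟩
    · intro hw
      obtain ⟨y, hy, hw⟩ := (hz ⟨w, mem_of_mem_mem z.2 hw⟩).1 hw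
      exact ⟨y, hy, hw⟩
  rw [this]
  exact z.2

/-- The power set in the sense of the model. -/
theorem powerset_mem_model {x : ZFSet.{u}} (hx : x ∈ V) :
    ZFSet.sep (· ∈ V) (ZFSet.powerset x) ∈ V := by
  obtain ⟨z, hz⟩ := hV.out.powerset ⟨x, hx⟩
  have : ZFSet.sep (· ∈ V) (ZFSet.powerset x) = z.1 := by
    ext w
    rw [ZFSet.mem_sep, ZFSet.mem_powerset]
    constructor
    · rintro ⟨h, hw⟩
      exact (hz ⟨w, hw⟩).2 fun y hy => h hy
    · intro hw
      have hwV := mem_of_mem_mem z.2 hw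
      exact ⟨fun y hy => (hz ⟨w, hwV⟩).1 hw ⟨y, mem_of_mem_mem hwV hy⟩ hy, hwV⟩
  rw [this]
  exact z.2

theorem empty_mem_model : (∅ : ZFSet.{u}) ∈ V := by
  obtain ⟨w, -⟩ := hV.out.infinity
  have : ZFSet.sep (fun _ => False) w.1 ∈ V := sep_mem_model w.2 inferInstance
  convert this
  ext z
  simp

instance : Fact ((∅ : ZFSet.{u}) ∈ V) := ⟨empty_mem_model⟩

theorem union_mem_model {x y : ZFSet.{u}} (hx : x ∈ V) (hy : y ∈ V) : x ∪ y ∈ V :=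
  sUnion_mem_model (upair_mem_model hx hy)

theorem singleton_mem_model {x : ZFSet.{u}} (hx : x ∈ V) : ({x} : ZFSet) ∈ V := by
  rw [← ZFSet.pair_eq_singleton]
  exact upair_mem_model hx hx

theorem insert_mem_model {x y : ZFSet.{u}} (hx : x ∈ V) (hy : y ∈ V) : insert x y ∈ V := by
  rw [ZFSet.insert_eq]
  exact union_mem_model (singleton_mem_model hx) hy

theorem pair_mem_model {x y : ZFSet.{u}} (hx : x ∈ V) (hy : y ∈ V) : ZFSet.pair x y ∈ V :=
  upair_mem_model (singleton_mem_model hx) (upair_mem_model hx hy)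

theorem mem_model_of_pair {x y : ZFSet.{u}} (h : ZFSet.pair x y ∈ V) : x ∈ V ∧ y ∈ V := by
  have h1 : ({x, y} : ZFSet) ∈ V := mem_of_mem_mem h (by simp [ZFSet.pair])
  exact ⟨mem_of_mem_mem h1 (by simp), mem_of_mem_mem h1 (by simp)⟩

instance DefFun.insert {F G : Env V → ZFSet.{u}} [hF : DefFun F] [hG : DefFun G] :
    DefFun (fun v => Insert.insert (F v) (G v)) :=
  DefFun.comp₂ (op := fun a b => Insert.insert a b)
    (DefFun.of_mem (fun v => insert_mem_model (v 0).2 (v 1).2)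
      ((inferInstance : DefRel (fun v : Env V => (v 0).1 = (v 1).1 ∨ (v 0).1 ∈ (v 2).1)).congr
        fun _ => ZFSet.mem_insert_iff)) hF hG

instance DefFun.singleton {F : Env V → ZFSet.{u}} [hF : DefFun F] :
    DefFun (fun v => ({F v} : ZFSet.{u})) :=
  DefFun.comp₁ (op := fun a => {a})
    (DefFun.of_mem (fun v => singleton_mem_model (v 0).2)
      ((inferInstance : DefRel (fun v : Env V => (v 0).1 = (v 1).1)).congr
        fun _ => ZFSet.mem_singleton)) hF

instance DefFun.union {F G : Env V → ZFSet.{u}} [hF : DefFun F] [hG : DefFun G] :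
    DefFun (fun v => F v ∪ G v) :=
  DefFun.comp₂ (op := fun a b => a ∪ b)
    (DefFun.of_mem (fun v => union_mem_model (v 0).2 (v 1).2)
      ((inferInstance : DefRel (fun v : Env V => (v 0).1 ∈ (v 1).1 ∨ (v 0).1 ∈ (v 2).1)).congr
        fun _ => ZFSet.mem_union)) hF hG

instance DefFun.pair {F G : Env V → ZFSet.{u}} [DefFun F] [DefFun G] :
    DefFun (fun v => ZFSet.pair (F v) (G v)) := by
  unfold ZFSet.pair
  infer_instance

/-- Kuratowski pairs are subsets of the power set of `x ∪ y`; the product is separated from the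
iterated power set of the model. -/
theorem prod_mem_model {x y : ZFSet.{u}} (hx : x ∈ V) (hy : y ∈ V) : ZFSet.prod x y ∈ V := by
  have : Fact (x ∈ V) := ⟨hx⟩
  have : Fact (y ∈ V) := ⟨hy⟩
  have h1 := powerset_mem_model (powerset_mem_model (union_mem_model hx hy))
  have h2 := sep_mem_model h1 (P := fun z => ∃ a, a ∈ x ∧ ∃ b, b ∈ y ∧ z = ZFSet.pair a b)
    inferInstance
  convert h2 using 1
  ext z
  rw [ZFSet.mem_prod, ZFSet.mem_sep, ZFSet.mem_sep]
  constructor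
  · rintro ⟨a, ha, b, hb, rfl⟩
    have haV := mem_of_mem_mem hx ha
    have hbV := mem_of_mem_mem hy hb
    refine ⟨⟨?_, pair_mem_model haV hbV⟩, a, ha, b, hb, rfl⟩
    rw [ZFSet.mem_powerset]
    intro w hw
    rw [ZFSet.mem_sep, ZFSet.mem_powerset]
    rcases ZFSet.mem_pair.1 hw with rfl | rfl
    · refine ⟨fun c hc => ?_, singleton_mem_model haV⟩
      rw [ZFSet.mem_singleton.1 hc, ZFSet.mem_union]
      exact Or.inl ha
    · refine ⟨fun c hc => ?_, upair_mem_model haV hbV⟩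
      rw [ZFSet.mem_union]
      rcases ZFSet.mem_pair.1 hc with rfl | rfl
      · exact Or.inl ha
      · exact Or.inr hb
  · rintro ⟨-, a, ha, b, hb, rfl⟩
    exact ⟨a, ha, b, hb, rfl⟩

/-! ### Building subsets, relations and functions in a model -/

theorem setIn_of_sep {S : Set ZFSet.{u}} {x : ZFSet.{u}} (hx : x ∈ V) {P : ZFSet.{u} → Prop}
    (h : DefRel (fun v : Env V => P (v 0).1)) (hS : ∀ z, z ∈ S ↔ z ∈ x ∧ P z) : SetIn V S :=
  ⟨_, sep_mem_model hx h, fun z => by rw [ZFSet.mem_sep, hS]⟩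

variable {A B C : ZFSet.{u}}

theorem subIn_of_def (hA : A ∈ V) {S : Set A} {P : ZFSet.{u} → Prop}
    (h : DefRel (fun v : Env V => P (v 0).1)) (hS : ∀ a : A, a ∈ S ↔ P a.1) : SubIn V S := by
  refine setIn_of_sep hA h fun z => ?_
  constructor
  · rintro ⟨a, ha, rfl⟩
    exact ⟨a.2, (hS a).1 ha⟩
  · rintro ⟨hz, hP⟩
    exact ⟨⟨z, hz⟩, (hS ⟨z, hz⟩).2 hP, rfl⟩

theorem setIn_of_pairs (hA : A ∈ V) (hB : B ∈ V) {S : Set ZFSet.{u}}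
    {P : ZFSet.{u} → ZFSet.{u} → Prop} (h : DefRel (fun v : Env V => P (v 0).1 (v 1).1))
    (hS : ∀ z, z ∈ S ↔ ∃ a ∈ A, ∃ b ∈ B, P a b ∧ z = ZFSet.pair a b) : SetIn V S := by
  have : Fact (A ∈ V) := ⟨hA⟩
  have : Fact (B ∈ V) := ⟨hB⟩
  have hP : ∀ {F G : Env V → ZFSet.{u}}, DefFun F → DefFun G → DefRel (fun v => P (F v) (G v)) :=
    fun hF hG => DefRel.comp₂ h hF hG
  have : DefRel (fun v : Env V => P (v.tail 0).1 (v 0).1) := hP inferInstance inferInstance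
  refine setIn_of_sep (prod_mem_model hA hB)
    (P := fun z => ∃ a, a ∈ A ∧ ∃ b, b ∈ B ∧ (P a b ∧ z = ZFSet.pair a b)) inferInstance
    fun z => ?_
  rw [hS]
  constructor
  · rintro ⟨a, ha, b, hb, hP, rfl⟩
    exact ⟨ZFSet.pair_mem_prod.2 ⟨ha, hb⟩, a, ha, b, hb, hP, rfl⟩
  · rintro ⟨-, h⟩
    exact h

theorem relIn_of_def (hA : A ∈ V) {r : A → A → Prop} {P : ZFSet.{u} → ZFSet.{u} → Prop}
    (h : DefRel (fun v : Env V => P (v 0).1 (v 1).1)) (hr : ∀ a b : A, r a b ↔ P a.1 b.1) :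
    RelIn V r := by
  refine setIn_of_pairs hA hA h fun z => ?_
  constructor
  · rintro ⟨a, b, hab, rfl⟩
    exact ⟨a, a.2, b, b.2, (hr a b).1 hab, rfl⟩
  · rintro ⟨a, ha, b, hb, hP, rfl⟩
    exact ⟨⟨a, ha⟩, ⟨b, hb⟩, (hr ⟨a, ha⟩ ⟨b, hb⟩).2 hP, rfl⟩

theorem funIn_of_graph (hA : A ∈ V) (hB : B ∈ V) {f : A → B} {P : ZFSet.{u} → ZFSet.{u} → Prop}
    (h : DefRel (fun v : Env V => P (v 0).1 (v 1).1)) (hf : ∀ a b, f a = b ↔ P a.1 b.1) :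
    FunIn V f := by
  refine setIn_of_pairs hA hB h fun z => ?_
  constructor
  · rintro ⟨a, rfl⟩
    exact ⟨a, a.2, f a, (f a).2, (hf a _).1 rfl, rfl⟩
  · rintro ⟨a, ha, b, hb, hP, rfl⟩
    refine ⟨⟨a, ha⟩, ?_⟩
    rw [(hf ⟨a, ha⟩ ⟨b, hb⟩).2 hP]

theorem funIn_of_def (hA : A ∈ V) (hB : B ∈ V) {f : A → B} {F : ZFSet.{u} → ZFSet.{u}}
    (h : DefFun (fun v : Env V => F (v 0).1)) (hf : ∀ a, (f a).1 = F a.1) : FunIn V f := by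
  refine funIn_of_graph hA hB (P := fun a b => b = F a) ?_ fun a b => ?_
  · exact @DefRel.eq V _ _ (DefFun.var 1) h
  · rw [Subtype.ext_iff, hf, eq_comm]

theorem fun₂In_of_graph (hA : A ∈ V) (hB : B ∈ V) (hC : C ∈ V) {f : A → B → C}
    {P : ZFSet.{u} → ZFSet.{u} → ZFSet.{u} → Prop}
    (h : DefRel (fun v : Env V => P (v 0).1 (v 1).1 (v 2).1))
    (hf : ∀ a b c, f a b = c ↔ P a.1 b.1 c.1) : Fun₂In V f := by
  have : Fact (A ∈ V) := ⟨hA⟩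
  have : Fact (B ∈ V) := ⟨hB⟩
  have : Fact (C ∈ V) := ⟨hC⟩
  have hP : ∀ {F G H : Env V → ZFSet.{u}}, DefFun F → DefFun G → DefFun H →
      DefRel (fun v => P (F v) (G v) (H v)) :=
    fun hF hG hH => DefRel.comp₃ h hF hG hH
  have : DefRel (fun v : Env V => P (v.tail 0).1 (v 0).1 (v.tail.tail 1).1) :=
    hP inferInstance inferInstance inferInstance
  refine setIn_of_pairs (prod_mem_model hA hB) hC
    (P := fun z c => ∃ a, a ∈ A ∧ ∃ b, b ∈ B ∧ (P a b c ∧ z = ZFSet.pair a b)) inferInstance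
    fun z => ?_
  constructor
  · rintro ⟨a, b, rfl⟩
    exact ⟨_, ZFSet.pair_mem_prod.2 ⟨a.2, b.2⟩, f a b, (f a b).2,
      ⟨a, a.2, b, b.2, (hf a b _).1 rfl, rfl⟩, rfl⟩
  · rintro ⟨_, -, c, hc, ⟨a, ha, b, hb, hP, rfl⟩, rfl⟩
    refine ⟨⟨a, ha⟩, ⟨b, hb⟩, ?_⟩
    rw [(hf ⟨a, ha⟩ ⟨b, hb⟩ ⟨c, hc⟩).2 hP]

theorem fun₂In_of_def (hA : A ∈ V) (hB : B ∈ V) (hC : C ∈ V) {f : A → B → C}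
    {F : ZFSet.{u} → ZFSet.{u} → ZFSet.{u}}
    (h : DefFun (fun v : Env V => F (v 0).1 (v 1).1)) (hf : ∀ a b, (f a b).1 = F a.1 b.1) :
    Fun₂In V f := by
  refine fun₂In_of_graph hA hB hC (P := fun a b c => c = F a b) ?_ fun a b c => ?_
  · exact @DefRel.eq V _ _ (DefFun.var 2) h
  · rw [Subtype.ext_iff, hf, eq_comm]

theorem pfunIn_of_graph (hA : A ∈ V) (hB : B ∈ V) {D : Set A} {p : D → B}
    {P : ZFSet.{u} → ZFSet.{u} → Prop} (h : DefRel (fun v : Env V => P (v 0).1 (v 1).1))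
    (hf : ∀ a b, (∃ h : a ∈ D, p ⟨a, h⟩ = b) ↔ P a.1 b.1) : PFunIn V p := by
  refine setIn_of_pairs hA hB h fun z => ?_
  constructor
  · rintro ⟨a, rfl⟩
    exact ⟨a.1, a.1.2, p a, (p a).2, (hf a.1 _).1 ⟨a.2, rfl⟩, rfl⟩
  · rintro ⟨a, ha, b, hb, hP, rfl⟩
    obtain ⟨hD, hp⟩ := (hf ⟨a, ha⟩ ⟨b, hb⟩).2 hP
    refine ⟨⟨⟨a, ha⟩, hD⟩, ?_⟩
    rw [hp]

end Model

/-! ### Total versions of functions and relations in a model -/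

section Total

variable {A B C : ZFSet.{u}}

open Classical in
/-- The function `f`, extended by `∅`. -/
noncomputable def app (f : A → B) (a : ZFSet.{u}) : ZFSet.{u} :=
  if h : a ∈ A then (f ⟨a, h⟩).1 else ∅

open Classical in
/-- The function `f` of two arguments, extended by `∅`. -/
noncomputable def app₂ (f : A → B → C) (a b : ZFSet.{u}) : ZFSet.{u} :=
  if h : a ∈ A ∧ b ∈ B then (f ⟨a, h.1⟩ ⟨b, h.2⟩).1 else ∅

/-- The relation `r`, as a relation between sets. -/
def rel (r : A → A → Prop) (a b : ZFSet.{u}) : Prop :=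
  ∃ (ha : a ∈ A) (hb : b ∈ A), r ⟨a, ha⟩ ⟨b, hb⟩

/-- The graph of a partial function, as a relation between sets. -/
def pgraph {D : Set A} (p : D → B) (a b : ZFSet.{u}) : Prop :=
  ∃ (ha : a ∈ A) (hD : ⟨a, ha⟩ ∈ D), (p ⟨⟨a, ha⟩, hD⟩).1 = b

@[simp] theorem app_coe (f : A → B) (a : A) : app f a.1 = (f a).1 := by
  simp [app]

theorem app_of_mem (f : A → B) {a : ZFSet.{u}} (h : a ∈ A) : app f a = (f ⟨a, h⟩).1 :=
  app_coe f ⟨a, h⟩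

@[simp] theorem app₂_coe (f : A → B → C) (a : A) (b : B) : app₂ f a.1 b.1 = (f a b).1 := by
  simp [app₂]

@[simp] theorem rel_coe (r : A → A → Prop) (a b : A) : rel r a.1 b.1 ↔ r a b := by
  simp [rel]

@[simp] theorem pgraph_coe {D : Set A} (p : D → B) (a : D) (b : B) :
    pgraph p a.1.1 b.1 ↔ p a = b := by
  constructor
  · rintro ⟨_, _, h⟩
    exact Subtype.ext h
  · rintro rfl
    exact ⟨a.1.2, a.2, rfl⟩

theorem exists_app_graph {f : A → B} (hf : FunIn V f) : ∃ s ∈ V, ∀ a b,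
    ZFSet.pair a b ∈ s ↔ a ∈ A ∧ b = app f a := by
  obtain ⟨s, hs, h⟩ := hf
  refine ⟨s, hs, fun a b => ?_⟩
  rw [h]
  constructor
  · rintro ⟨c, he⟩
    obtain ⟨rfl, rfl⟩ := ZFSet.pair_inj.1 he
    exact ⟨c.2, (app_coe f c).symm⟩
  · rintro ⟨ha, rfl⟩
    exact ⟨⟨a, ha⟩, by rw [app_of_mem f ha]⟩

theorem exists_app₂_graph {f : A → B → C} (hf : Fun₂In V f) : ∃ s ∈ V, ∀ a b c,
    ZFSet.pair (ZFSet.pair a b) c ∈ s ↔ (a ∈ A ∧ b ∈ B) ∧ c = app₂ f a b := by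
  obtain ⟨s, hs, h⟩ := hf
  refine ⟨s, hs, fun a b c => ?_⟩
  rw [h]
  constructor
  · rintro ⟨a, b, he⟩
    obtain ⟨h1, rfl⟩ := ZFSet.pair_inj.1 he
    obtain ⟨rfl, rfl⟩ := ZFSet.pair_inj.1 h1
    exact ⟨⟨a.2, b.2⟩, (app₂_coe f a b).symm⟩
  · rintro ⟨⟨ha, hb⟩, rfl⟩
    exact ⟨⟨a, ha⟩, ⟨b, hb⟩, by rw [← app₂_coe f]⟩

variable [hV : Fact (IsModelOfSetTheory V)]

instance DefRel.rel {r : A → A → Prop} [hr : Fact (RelIn V r)] {F G : Env V → ZFSet.{u}}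
    [hF : DefFun F] [hG : DefFun G] : DefRel (fun v => rel r (F v) (G v)) := by
  obtain ⟨s, hs, h⟩ := hr.out
  have : Fact (s ∈ V) := ⟨hs⟩
  refine (inferInstance : DefRel fun v => ZFSet.pair (F v) (G v) ∈ s).congr fun v => ?_
  rw [h]
  constructor
  · rintro ⟨ha, hb, hab⟩
    exact ⟨_, _, hab, rfl⟩
  · rintro ⟨a, b, hab, he⟩
    obtain ⟨h1, h2⟩ := ZFSet.pair_inj.1 he
    rw [h1, h2]
    exact ⟨a.2, b.2, hab⟩

instance DefRel.pgraph {D : Set A} {p : D → B} [hr : Fact (PFunIn V p)] {F G : Env V → ZFSet.{u}}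
    [hF : DefFun F] [hG : DefFun G] : DefRel (fun v => pgraph p (F v) (G v)) := by
  obtain ⟨s, hs, h⟩ := hr.out
  have : Fact (s ∈ V) := ⟨hs⟩
  refine (inferInstance : DefRel fun v => ZFSet.pair (F v) (G v) ∈ s).congr fun v => ?_
  rw [h]
  constructor
  · rintro ⟨ha, hD, hab⟩
    exact ⟨⟨⟨_, ha⟩, hD⟩, by rw [← hab]⟩
  · rintro ⟨a, he⟩
    obtain ⟨h1, h2⟩ := ZFSet.pair_inj.1 he
    rw [h1, h2]
    exact ⟨a.1.2, a.2, rfl⟩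

/-- The first coordinates of the pairs in a graph `s` lie in `⋃ ⋃ s`, from which the domain is
separated. -/
theorem FunIn.dom_mem {f : A → B} (hf : FunIn V f) : A ∈ V := by
  obtain ⟨s, hs, h⟩ := exists_app_graph hf
  have : Fact (s ∈ V) := ⟨hs⟩
  have h2 := sep_mem_model (sUnion_mem_model (sUnion_mem_model hs))
    (P := fun a => ∃ b, b ∈ V ∧ ZFSet.pair a b ∈ s) inferInstance
  convert h2 using 1
  ext a
  simp only [ZFSet.mem_sep, h]
  constructor
  · intro ha
    have hp := (h a _).2 ⟨ha, rfl⟩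
    have hpV := mem_of_mem_mem hs hp
    refine ⟨?_, _, (mem_model_of_pair hpV).2, ha, rfl⟩
    simp only [ZFSet.mem_sUnion]
    exact ⟨{a}, ⟨_, hp, by simp [ZFSet.pair]⟩, by simp⟩
  · rintro ⟨-, b, -, ha, -⟩
    exact ha

instance DefFun.app {f : A → B} [hf : Fact (FunIn V f)] {F : Env V → ZFSet.{u}}
    [hF : DefFun F] : DefFun (fun v => app f (F v)) := by
  refine DefFun.comp₁ (op := FixAbs.app f) ?_ hF
  obtain ⟨s, hs, h⟩ := exists_app_graph hf.out
  have : Fact (s ∈ V) := ⟨hs⟩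
  have : Fact (A ∈ V) := ⟨hf.out.dom_mem⟩
  refine ⟨fun v => ?_, ?_⟩
  · by_cases ha : (v 0).1 ∈ A
    · exact (mem_model_of_pair (mem_of_mem_mem hs ((h _ _).2 ⟨ha, rfl⟩))).2
    · simp [FixAbs.app, ha, empty_mem_model]
  · refine (inferInstance : DefRel fun v : Env V => ZFSet.pair (v 1).1 (v 0).1 ∈ s ∨
      ((v 1).1 ∉ A ∧ (v 0).1 = ∅)).congr fun v => ?_
    rw [h, Env.tail_apply]
    by_cases ha : (v 1).1 ∈ A
    · simp [ha]
    · simp [FixAbs.app, ha]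

instance DefFun.app₂ {f : A → B → C} [hf : Fact (Fun₂In V f)] {F G : Env V → ZFSet.{u}}
    [hF : DefFun F] [hG : DefFun G] : DefFun (fun v => app₂ f (F v) (G v)) := by
  refine DefFun.comp₂ (op := FixAbs.app₂ f) ?_ hF hG
  obtain ⟨s, hs, h⟩ := exists_app₂_graph hf.out
  have : Fact (s ∈ V) := ⟨hs⟩
  have hmem : ∀ {a b : ZFSet.{u}}, a ∈ A ∧ b ∈ B → FixAbs.app₂ f a b ∈ V := fun hab =>
    (mem_model_of_pair (mem_of_mem_mem hs ((h _ _ _).2 ⟨hab, rfl⟩))).2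
  refine ⟨fun v => ?_, ?_⟩
  · by_cases ha : (v 0).1 ∈ A ∧ (v 1).1 ∈ B
    · exact hmem ha
    · simp [FixAbs.app₂, ha, empty_mem_model]
  -- The sets `A` and `B` are not known to lie in `V`, so being outside the domain is expressed by
  -- the absence of a pair in the graph.
  · refine (inferInstance : DefRel fun v : Env V =>
      ZFSet.pair (ZFSet.pair (v 1).1 (v 2).1) (v 0).1 ∈ s ∨
      ((¬ ∃ c, c ∈ V ∧ ZFSet.pair (ZFSet.pair (v 1).1 (v 2).1) c ∈ s) ∧ (v 0).1 = ∅)).congr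
      fun v => ?_
    simp only [h]
    by_cases ha : (v 1).1 ∈ A ∧ (v 2).1 ∈ B
    · have := hmem ha
      simp [ha, this]
    · have h0 : FixAbs.app₂ f (v 1).1 (v 2).1 = ∅ := by simp [FixAbs.app₂, ha]
      simp [ha, h0]

/-- Membership in a subset that belongs to the model. -/
def inSub (S : Set A) (a : ZFSet.{u}) : Prop := ∃ h : a ∈ A, (⟨a, h⟩ : A) ∈ S

@[simp] theorem inSub_coe (S : Set A) (a : A) : inSub S a.1 ↔ a ∈ S := by
  simp [inSub]

instance DefRel.inSub {S : Set A} [hS : Fact (SubIn V S)] {F : Env V → ZFSet.{u}}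
    [hF : DefFun F] : DefRel (fun v => inSub S (F v)) := by
  obtain ⟨s, hs, h⟩ := hS.out
  have : Fact (s ∈ V) := ⟨hs⟩
  refine (inferInstance : DefRel fun v => F v ∈ s).congr fun v => ?_
  rw [h]
  constructor
  · rintro ⟨ha, hab⟩
    exact ⟨_, hab, rfl⟩
  · rintro ⟨a, ha, he⟩
    rw [he]
    exact ⟨a.2, ha⟩

end Total

end FixAbs

namespace FixAbs

/-! ### Distance monoids -/

namespace DistStr

variable {V : Set ZFSet.{u}} {X : DistStr.{u}}

namespace IsDistanceMonoid

theorem le_of_not_le (hX : X.IsDistanceMonoid V) {a b : X.carrier} (h : ¬ X.le a b) :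
    X.le b a := (hX.le_total a b).resolve_left h

theorem add_le_add (hX : X.IsDistanceMonoid V) {a b c d : X.carrier} (h : X.le a b)
    (h' : X.le c d) : X.le (X.add a c) (X.add b d) := by
  refine hX.le_trans _ _ _ (hX.add_le_add_left _ _ a h') ?_
  rw [hX.add_comm a, hX.add_comm b]
  exact hX.add_le_add_left _ _ d h

theorem add_zero (hX : X.IsDistanceMonoid V) (a : X.carrier) : X.add a X.zero = a := by
  rw [hX.add_comm, hX.zero_add]

theorem le_add_right (hX : X.IsDistanceMonoid V) (a b : X.carrier) : X.le a (X.add a b) := by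
  have := hX.add_le_add_left _ _ a (hX.zero_le b)
  rwa [hX.add_zero] at this

theorem le_add_left (hX : X.IsDistanceMonoid V) (a b : X.carrier) : X.le a (X.add b a) := by
  rw [hX.add_comm]
  exact hX.le_add_right a b

theorem eq_zero_of_le (hX : X.IsDistanceMonoid V) {a : X.carrier} (h : X.le a X.zero) :
    a = X.zero := hX.le_antisymm _ _ h (hX.zero_le a)

/-- In a distance monoid of the model, addition is distributive over all infima, also over those
of subsets that do not belong to the model. -/
theorem add_isInf [hV : Fact (IsModelOfSetTheory V)] (hX : X.IsDistanceMonoid V) (hXV : X.In V)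
    {A : Set X.carrier} {m : X.carrier} (b : X.carrier) (hm : X.IsInf A m) :
    X.IsInf {x | ∃ a ∈ A, x = X.add b a} (X.add b m) := by
  refine ⟨?_, fun l hl => ?_⟩
  · rintro _ ⟨a, ha, rfl⟩
    exact hX.add_le_add_left _ _ _ (hm.1 a ha)
  by_cases hmA : m ∈ A
  · exact hl _ ⟨m, hmA, rfl⟩
  have : Fact (RelIn V X.le) := ⟨hXV.2.2⟩
  have : Fact (m.1 ∈ V) := ⟨mem_of_mem_mem hXV.1 m.2⟩
  -- If `m ∉ A`, the ray strictly above `m` has the same infimum as `A`; it is definable, so the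
  -- axiom of the model applies to it in place of `A`.
  have hS : SubIn V {a | ¬ X.le a m} :=
    subIn_of_def hXV.1 (P := fun a => ¬ rel X.le a m.1) inferInstance fun a => by simp
  have hAS : ∀ a ∈ A, ¬ X.le a m := fun a ha h =>
    hmA (hX.le_antisymm _ _ h (hm.1 a ha) ▸ ha)
  have hinf : X.IsInf {a | ¬ X.le a m} m :=
    ⟨fun a ha => hX.le_of_not_le ha, fun l hl => hm.2 l fun a ha => hl a (hAS a ha)⟩
  refine (hX.add_inf _ hS b m hinf).2 l ?_
  rintro _ ⟨a, ha, rfl⟩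
  have : ∃ a' ∈ A, ¬ X.le a a' := by
    by_contra! h
    exact ha (hm.2 a h)
  obtain ⟨a', ha', h⟩ := this
  exact hX.le_trans _ _ _ (hl _ ⟨a', ha', rfl⟩) (hX.add_le_add_left _ _ _ (hX.le_of_not_le h))

/-- Otherwise `ε` would be a lower bound of all the sums. This makes the domain of a Cauchy sequence
meet every initial segment above zero. -/
theorem exists_le_of_isInf_add (hX : X.IsDistanceMonoid V) {A : Set X.carrier}
    (h : X.IsInf {x | ∃ a ∈ A, ∃ b ∈ A, x = X.add a b} X.zero) {ε : X.carrier}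
    (hε : ε ≠ X.zero) : ∃ a ∈ A, X.le a ε := by
  by_contra! hA
  refine hε (hX.eq_zero_of_le (h.2 ε ?_))
  rintro _ ⟨a, ha, b, -, rfl⟩
  exact hX.le_trans _ _ _ (hX.le_of_not_le (hA a ha)) (hX.le_add_right _ _)

end IsDistanceMonoid

/-- A strictly decreasing nice initial sequence whose length is a limit ordinal. -/
structure IsScale (X : DistStr.{u}) {κ : ZFSet.{u}} (α : κ → X.carrier) : Prop where
  isOrdinal : κ.IsOrdinal
  zero_mem : ∅ ∈ κ
  succ_mem : ∀ i ∈ κ, insert i i ∈ κ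
  ne_zero : ∀ i, α i ≠ X.zero
  strict : ∀ i j : κ, i.1 ∈ j.1 → ¬ X.le (α i) (α j)
  nice : X.IsNice α
  coinitial : ∀ a, a ≠ X.zero → ∃ i, X.le (α i) a

namespace IsScale

variable {κ : ZFSet.{u}} {α : κ → X.carrier} (hα : X.IsScale α) (hX : X.IsDistanceMonoid V)

include hα in
theorem ordinal_of_mem {i : ZFSet.{u}} (hi : i ∈ κ) : i.IsOrdinal := hα.isOrdinal.mem hi

/-- The successor of an index. -/
def succ (i : κ) : κ := ⟨insert i.1 i.1, hα.succ_mem _ i.2⟩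

include hα hX in
theorem anti {i j : κ} (h : i.1 ⊆ j.1) : X.le (α j) (α i) := by
  rcases ((hα.ordinal_of_mem i.2).subset_iff_eq_or_mem (hα.ordinal_of_mem j.2)).1 h with h | h
  · rw [Subtype.ext h]
    exact hX.le_refl _
  · exact hX.le_of_not_le (hα.strict i j h)

include hα hX in
theorem le_iff {i j : κ} : X.le (α j) (α i) ↔ i.1 ⊆ j.1 := by
  refine ⟨fun h => ?_, hα.anti hX⟩
  by_contra h'
  exact hα.strict j i
    (((hα.ordinal_of_mem i.2).not_subset_iff_mem (hα.ordinal_of_mem j.2)).1 h') h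

include hα hX in
theorem injective : Function.Injective α := fun i j h => by
  have h1 := (hα.le_iff hX (i := i) (j := j)).1 (h ▸ hX.le_refl _)
  have h2 := (hα.le_iff hX (i := j) (j := i)).1 (h ▸ hX.le_refl _)
  exact Subtype.ext (le_antisymm h1 h2)

theorem four_le (i : κ) :
    X.le (X.add (X.add (α (hα.succ i)) (α (hα.succ i)))
      (X.add (α (hα.succ i)) (α (hα.succ i)))) (α i) :=
  hα.nice i (hα.succ i) rfl

include hX in
theorem two_le (i : κ) : X.le (X.add (α (hα.succ i)) (α (hα.succ i))) (α i) :=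
  hX.le_trans _ _ _ (hX.le_add_right _ _) (hα.four_le i)

include hα in
theorem sup_index (i j : κ) : ∃ k : κ, i.1 ⊆ k.1 ∧ j.1 ⊆ k.1 := by
  rcases (hα.ordinal_of_mem i.2).subset_total (hα.ordinal_of_mem j.2) with h | h
  · exact ⟨j, h, fun _ => id⟩
  · exact ⟨i, fun _ => id, h⟩

theorem lt_succ (i : κ) : i.1 ∈ (hα.succ i).1 := ZFSet.mem_insert _ _

include hα hX in
theorem eq_zero {a : X.carrier} (h : ∀ i, X.le a (α i)) : a = X.zero := by
  by_contra ha
  obtain ⟨i, hi⟩ := hα.coinitial a ha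
  exact hα.strict i (hα.succ i) (hα.lt_succ i) (hX.le_trans _ _ _ hi (h _))

include hα hX in
theorem isInf_range : X.IsInf (Set.range α) X.zero := by
  refine ⟨fun a _ => hX.zero_le a, fun l hl => ?_⟩
  rw [hα.eq_zero hX fun i => hl _ ⟨i, rfl⟩]
  exact hX.le_refl _

include hα hX in
-- Addition distributes over the infimum of the scale, which is zero. This is the epsilon principle
-- of the metric arguments; there is no subtraction to fall back on.
theorem le_of_forall_le_add [Fact (IsModelOfSetTheory V)] (hXV : X.In V) {a c : X.carrier}
    (h : ∀ i, X.le a (X.add c (α i))) : X.le a c := by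
  have := (hX.add_isInf hXV c (hα.isInf_range hX)).2 a (by
    rintro _ ⟨_, ⟨i, rfl⟩, rfl⟩
    exact h i)
  rwa [hX.add_zero] at this

end IsScale

end DistStr

/-! ### Limits of sequences -/

namespace DynStr

open DistStr

variable {V : Set ZFSet.{u}} {X Y : DistStr.{u}} {κ : ZFSet.{u}} {α : κ → X.carrier}
  {R : DynStr X}

theorem IsMetric.dist_self (hR : R.IsMetric) (x : R.points) : R.dist x x = X.zero :=
  ((hR.1 x x).2 rfl).1

theorem IsLimit.two (hα : X.IsScale α) {p q : κ → R.points} {x y : R.points} (hx : R.IsLimit p x)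
    (hy : R.IsLimit q y) {ε : X.carrier} (hε : ε ≠ X.zero) : ∃ i : κ,
    (X.le (R.dist x (p i)) ε ∧ X.le (R.dist (p i) x) ε) ∧
    (X.le (R.dist y (q i)) ε ∧ X.le (R.dist (q i) y) ε) := by
  obtain ⟨i, hi⟩ := hx ε hε
  obtain ⟨j, hj⟩ := hy ε hε
  rcases (hα.ordinal_of_mem i.2).subset_total (hα.ordinal_of_mem j.2) with h | h
  · exact ⟨j, hi j h, hj j fun _ => id⟩
  · exact ⟨i, hi i fun _ => id, hj i h⟩

theorem eq_of_dist_le (hα : X.IsScale α) (hX : X.IsDistanceMonoid V) (hR : R.IsMetric)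
    {x y : R.points} (h : ∀ i, X.le (R.dist x y) (α i) ∧ X.le (R.dist y x) (α i)) : x = y :=
  (hR.1 x y).1 ⟨hα.eq_zero hX fun i => (h i).1, hα.eq_zero hX fun i => (h i).2⟩

theorem IsLimit.unique (hα : X.IsScale α) (hX : X.IsDistanceMonoid V) (hR : R.IsMetric)
    {p : κ → R.points} {x y : R.points} (hx : R.IsLimit p x) (hy : R.IsLimit p y) : x = y := by
  refine eq_of_dist_le hα hX hR fun i => ?_
  obtain ⟨j, ⟨h1, h2⟩, h3, h4⟩ := hx.two hα hy (hα.ne_zero (hα.succ i))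
  exact ⟨hX.le_trans _ _ _ (hR.2 _ (p j) _)
      (hX.le_trans _ _ _ (hX.add_le_add h1 h4) (hα.two_le hX i)),
    hX.le_trans _ _ _ (hR.2 _ (p j) _)
      (hX.le_trans _ _ _ (hX.add_le_add h3 h2) (hα.two_le hX i))⟩

/-- Two points whose distances to all members of a convergent sequence agree with those of its
limit are equal. -/
theorem IsLimit.eq_of_dist_eq (hα : X.IsScale α) (hX : X.IsDistanceMonoid V) (hR : R.IsMetric)
    {p : κ → R.points} {x y : R.points} (hx : R.IsLimit p x)
    (h : ∀ i, R.dist y (p i) = R.dist x (p i) ∧ R.dist (p i) y = R.dist (p i) x) : y = x := by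
  refine IsLimit.unique hα hX hR (p := p) (fun ε hε => ?_) hx
  obtain ⟨i, hi⟩ := hx ε hε
  refine ⟨i, fun j hj => ?_⟩
  rw [(h j).1, (h j).2]
  exact hi j hj

/-- Distances of limits are determined by the distances of the members of the sequences. -/
theorem IsLimit.dist_eq [Fact (IsModelOfSetTheory V)] {β : κ → Y.carrier} {Q : DynStr Y}
    (hα : X.IsScale α) (hβ : Y.IsScale β) (hX : X.IsDistanceMonoid V) (hY : Y.IsDistanceMonoid V)
    (hYV : Y.In V) (hR : R.IsMetric) (hQ : Q.IsMetric) {h : X.carrier → Y.carrier}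
    (h_add : ∀ a b, h (X.add a b) = Y.add (h a) (h b)) (h_le : ∀ a b, X.le a b → Y.le (h a) (h b))
    (h_α : ∀ i, h (α i) = β i) {p p' : κ → R.points} {q q' : κ → Q.points}
    {x x' : R.points} {y y' : Q.points} (hx : R.IsLimit p x) (hx' : R.IsLimit p' x')
    (hy : Q.IsLimit q y) (hy' : Q.IsLimit q' y')
    (hpq : ∀ i, h (R.dist (p i) (p' i)) = Q.dist (q i) (q' i)) :
    h (R.dist x x') = Q.dist y y' := by
  have tri : ∀ a b c d : Q.points, Y.le (Q.dist a d)
      (Y.add (Q.dist a b) (Y.add (Q.dist b c) (Q.dist c d))) := fun a b c d =>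
    hY.le_trans _ _ _ (hQ.2 a b d) (hY.add_le_add_left _ _ _ (hQ.2 b c d))
  have triR : ∀ a b c d : R.points, X.le (R.dist a d)
      (X.add (R.dist a b) (X.add (R.dist b c) (R.dist c d))) := fun a b c d =>
    hX.le_trans _ _ _ (hR.2 a b d) (hX.add_le_add_left _ _ _ (hR.2 b c d))
  -- Replacing both points by approximants and going back costs four errors of size `β (i + 1)`,
  -- which niceness absorbs into `β i`.
  have four : ∀ (i : κ) (b : Y.carrier),
      Y.le (Y.add (β (hβ.succ i)) (Y.add (Y.add (β (hβ.succ i)) (Y.add b (β (hβ.succ i))))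
        (β (hβ.succ i)))) (Y.add b (β i)) := by
    intro i b
    have := hY.add_le_add_left _ _ b (hβ.four_le i)
    convert this using 1
    generalize β (hβ.succ i) = e
    have : Std.Associative Y.add := ⟨hY.add_assoc⟩
    have : Std.Commutative Y.add := ⟨hY.add_comm⟩
    ac_rfl
  have key : ∀ i : κ, ∃ j : κ, j.1 ∈ κ ∧
      ((X.le (R.dist x (p j)) (α (hβ.succ i)) ∧ X.le (R.dist (p j) x) (α (hβ.succ i))) ∧
      (X.le (R.dist x' (p' j)) (α (hβ.succ i)) ∧ X.le (R.dist (p' j) x') (α (hβ.succ i)))) ∧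
      ((Y.le (Q.dist y (q j)) (β (hβ.succ i)) ∧ Y.le (Q.dist (q j) y) (β (hβ.succ i))) ∧
      (Y.le (Q.dist y' (q' j)) (β (hβ.succ i)) ∧ Y.le (Q.dist (q' j) y') (β (hβ.succ i)))) := by
    intro i
    obtain ⟨i1, h1⟩ := hx _ (hα.ne_zero (hβ.succ i))
    obtain ⟨i2, h2⟩ := hx' _ (hα.ne_zero (hβ.succ i))
    obtain ⟨i3, h3⟩ := hy _ (hβ.ne_zero (hβ.succ i))
    obtain ⟨i4, h4⟩ := hy' _ (hβ.ne_zero (hβ.succ i))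
    obtain ⟨j, hj1, hj2⟩ := hα.sup_index i1 i2
    obtain ⟨k, hk1, hk2⟩ := hα.sup_index i3 i4
    obtain ⟨l, hl1, hl2⟩ := hα.sup_index j k
    exact ⟨l, l.2, ⟨h1 l fun z hz => hl1 (hj1 hz), h2 l fun z hz => hl1 (hj2 hz)⟩,
      h3 l fun z hz => hl2 (hk1 hz), h4 l fun z hz => hl2 (hk2 hz)⟩
  apply hY.le_antisymm
  · refine hβ.le_of_forall_le_add hY hYV fun i => ?_
    obtain ⟨j, -, ⟨⟨a1, a2⟩, a3, a4⟩, ⟨b1, b2⟩, b3, b4⟩ := key i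
    refine hY.le_trans _ _ _ ?_ (four i _)
    have e1 := h_le _ _ (hX.le_trans _ _ _ (triR x (p j) (p' j) x')
      (hX.add_le_add a1 (hX.add_le_add (hX.le_refl _) a4)))
    rw [h_add, h_add, hpq, h_α] at e1
    refine hY.le_trans _ _ _ e1 (hY.add_le_add_left _ _ _ (hY.add_le_add ?_ (hY.le_refl _)))
    exact hY.le_trans _ _ _ (tri _ y y' _) (hY.add_le_add b2 (hY.add_le_add (hY.le_refl _) b3))
  · refine hβ.le_of_forall_le_add hY hYV fun i => ?_
    obtain ⟨j, -, ⟨⟨a1, a2⟩, a3, a4⟩, ⟨b1, b2⟩, b3, b4⟩ := key i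
    refine hY.le_trans _ _ _ ?_ (four i _)
    refine hY.le_trans _ _ _ (tri y (q j) (q' j) y') (hY.add_le_add b1 (hY.add_le_add ?_ b4))
    rw [← hpq]
    have e1 := h_le _ _ (hX.le_trans _ _ _ (triR (p j) x x' (p' j))
      (hX.add_le_add a2 (hX.add_le_add (hX.le_refl _) a3)))
    rwa [h_add, h_add, h_α] at e1

end DynStr

end FixAbs

namespace FixAbs

/-! ### Threads

A thread is a partial function `x` on an ordinal `κ`, defined on an initial segment, which announces
at each stage `γ` an ordinal `x(γ) > γ` and keeps this value until stage `x(γ)`. Below any non-zero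
stage `l < κ` that it reaches, it announces a value `≥ l`, so that it changes its value only finitely
often below `l`. -/

/-- `x` is a thread through `κ`. -/
structure IsThread (κ x : ZFSet.{u}) : Prop where
  sub : x ⊆ ZFSet.prod κ κ
  func : ∀ {γ y y'}, ZFSet.pair γ y ∈ x → ZFSet.pair γ y' ∈ x → y = y'
  down : ∀ {γ y δ}, ZFSet.pair γ y ∈ x → δ ∈ γ → ∃ y', ZFSet.pair δ y' ∈ x
  lt : ∀ {γ y}, ZFSet.pair γ y ∈ x → γ ∈ y
  const : ∀ {γ y δ y'}, ZFSet.pair γ y ∈ x → ZFSet.pair δ y' ∈ x → γ ∈ δ → δ ∈ y → y' = y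
  lim : ∀ l ∈ κ, l ≠ ∅ → (∀ δ ∈ l, ∃ y, ZFSet.pair δ y ∈ x) →
    ∃ γ ∈ l, ∃ y, ZFSet.pair γ y ∈ x ∧ l ⊆ y

/-- The domain of a thread. -/
def dom (κ x : ZFSet.{u}) : ZFSet.{u} :=
  ZFSet.sep (fun γ => ∃ y, y ∈ κ ∧ ZFSet.pair γ y ∈ x) κ

/-- The restriction of a thread. -/
def restrict (κ x i : ZFSet.{u}) : ZFSet.{u} :=
  ZFSet.sep (fun z => ∃ δ, δ ∈ i ∧ ∃ y, y ∈ κ ∧ z = ZFSet.pair δ y) x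

/-- The largest initial segment of the common domain of two threads on which they agree. -/
def join (κ x y : ZFSet.{u}) : ZFSet.{u} :=
  ZFSet.sep (fun γ => ∀ δ, δ ∈ insert γ γ →
    ∃ v, v ∈ κ ∧ (ZFSet.pair δ v ∈ x ∧ ZFSet.pair δ v ∈ y)) κ

/-- `x` and `y` agree below `i`. -/
def Agree (x y i : ZFSet.{u}) : Prop := ∀ δ ∈ i, ∀ v, ZFSet.pair δ v ∈ x ↔ ZFSet.pair δ v ∈ y

/-- The extension of the thread `x` to the domain `β` which announces `β` when it is due to. -/
def extend (κ x β : ZFSet.{u}) : ZFSet.{u} :=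
  x ∪ ZFSet.sep (fun z => ∃ γ, γ ∈ β ∧ ∃ y, y ∈ κ ∧ (z = ZFSet.pair γ y ∧ γ ∉ dom κ x ∧
    ((∃ δ, δ ∈ κ ∧ (ZFSet.pair δ y ∈ x ∧ γ ∈ y)) ∨
      ((∀ δ, δ ∈ κ → ∀ y', y' ∈ κ → ZFSet.pair δ y' ∈ x → γ ∉ y') ∧ y = β)))) (ZFSet.prod κ κ)

variable {κ x y z i j β : ZFSet.{u}}

theorem Agree.refl (x i : ZFSet.{u}) : Agree x x i := fun _ _ _ => Iff.rfl

theorem Agree.symm (h : Agree x y i) : Agree y x i := fun δ hδ v => (h δ hδ v).symm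

theorem Agree.trans (h : Agree x y i) (h' : Agree y z i) : Agree x z i :=
  fun δ hδ v => (h δ hδ v).trans (h' δ hδ v)

theorem Agree.mono (h : Agree x y i) (hj : j ⊆ i) : Agree x y j := fun δ hδ => h δ (hj hδ)

/-- Extending two threads preserves their agreement; this is why the one-stage extension does not
expand distances. -/
theorem join_mono {x' y' : ZFSet.{u}} (hx : x ⊆ x') (hy : y ⊆ y') :
    join κ x y ⊆ join κ x' y' := by
  intro γ hγ
  rw [join, ZFSet.mem_sep] at hγ ⊢
  refine ⟨hγ.1, fun δ hδ => ?_⟩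
  obtain ⟨v, hv, h1, h2⟩ := hγ.2 δ hδ
  exact ⟨v, hv, hx h1, hy h2⟩

namespace IsThread

theorem mem_left (hx : IsThread κ x) {γ v : ZFSet.{u}} (h : ZFSet.pair γ v ∈ x) : γ ∈ κ :=
  (ZFSet.pair_mem_prod.1 (hx.sub h)).1

theorem mem_right (hx : IsThread κ x) {γ v : ZFSet.{u}} (h : ZFSet.pair γ v ∈ x) : v ∈ κ :=
  (ZFSet.pair_mem_prod.1 (hx.sub h)).2

theorem mem_dom (hx : IsThread κ x) {γ : ZFSet.{u}} :
    γ ∈ dom κ x ↔ ∃ v, ZFSet.pair γ v ∈ x := by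
  rw [dom, ZFSet.mem_sep]
  constructor
  · rintro ⟨-, v, -, h⟩
    exact ⟨v, h⟩
  · rintro ⟨v, h⟩
    exact ⟨hx.mem_left h, v, hx.mem_right h, h⟩

theorem dom_subset : dom κ x ⊆ κ := ZFSet.sep_subset

theorem isOrdinal_dom (hκ : κ.IsOrdinal) (hx : IsThread κ x) : (dom κ x).IsOrdinal := by
  rw [ZFSet.isOrdinal_iff_forall_mem_isOrdinal]
  refine ⟨fun γ hγ δ hδ => ?_, fun γ hγ => hκ.mem (dom_subset hγ)⟩
  obtain ⟨v, hv⟩ := hx.mem_dom.1 hγ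
  exact hx.mem_dom.2 (hx.down hv hδ)

theorem ext_pair (hx : x ⊆ ZFSet.prod κ κ) (hy : y ⊆ ZFSet.prod κ κ)
    (h : ∀ γ v, ZFSet.pair γ v ∈ x ↔ ZFSet.pair γ v ∈ y) : x = y := by
  ext z
  constructor
  · intro hz
    obtain ⟨a, _, b, _, rfl⟩ := ZFSet.mem_prod.1 (hx hz)
    exact (h a b).1 hz
  · intro hz
    obtain ⟨a, _, b, _, rfl⟩ := ZFSet.mem_prod.1 (hy hz)
    exact (h a b).2 hz

theorem subset_of_pair (hx : x ⊆ ZFSet.prod κ κ)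
    (h : ∀ γ v, ZFSet.pair γ v ∈ x → ZFSet.pair γ v ∈ y) : x ⊆ y := by
  intro z hz
  obtain ⟨a, _, b, _, rfl⟩ := ZFSet.mem_prod.1 (hx hz)
  exact h a b hz

theorem pair_mem_restrict (hx : IsThread κ x) {γ v : ZFSet.{u}} :
    ZFSet.pair γ v ∈ restrict κ x i ↔ γ ∈ i ∧ ZFSet.pair γ v ∈ x := by
  rw [restrict, ZFSet.mem_sep]
  constructor
  · rintro ⟨h, δ, hδ, w, _, he⟩
    obtain ⟨rfl, rfl⟩ := ZFSet.pair_inj.1 he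
    exact ⟨hδ, h⟩
  · rintro ⟨hi, h⟩
    exact ⟨h, γ, hi, v, hx.mem_right h, rfl⟩

theorem restrict_subset : restrict κ x i ⊆ x := ZFSet.sep_subset

theorem agree_restrict (hx : IsThread κ x) : Agree (restrict κ x i) x i := fun δ hδ v => by
  rw [hx.pair_mem_restrict, and_iff_right hδ]

theorem restrict (hx : IsThread κ x) (hi : i.IsOrdinal) : IsThread κ (restrict κ x i) where
  sub := fun _ h => hx.sub (restrict_subset h)
  func := fun h h' => hx.func (restrict_subset h) (restrict_subset h')
  down := by
    intro γ y δ h hδ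
    rw [hx.pair_mem_restrict] at h
    obtain ⟨y', hy'⟩ := hx.down h.2 hδ
    exact ⟨y', hx.pair_mem_restrict.2 ⟨hi.mem_trans hδ h.1, hy'⟩⟩
  lt := fun h => hx.lt (restrict_subset h)
  const := fun h h' => hx.const (restrict_subset h) (restrict_subset h')
  lim := by
    intro l hl h0 h
    obtain ⟨γ, hγ, y, hy, hly⟩ := hx.lim l hl h0 fun δ hδ => by
      obtain ⟨y, hy⟩ := h δ hδ
      exact ⟨y, restrict_subset hy⟩
    obtain ⟨y', hy'⟩ := h γ hγ
    refine ⟨γ, hγ, y, ?_, hly⟩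
    rwa [hx.func hy (restrict_subset hy')]

theorem dom_restrict (hx : IsThread κ x) (hi : i.IsOrdinal) :
    dom κ (FixAbs.restrict κ x i) = i ∩ dom κ x := by
  ext γ
  rw [(hx.restrict hi).mem_dom, ZFSet.mem_inter, hx.mem_dom]
  simp only [hx.pair_mem_restrict, exists_and_left]

theorem dom_restrict_of_subset (hx : IsThread κ x) (hi : i.IsOrdinal) (h : i ⊆ dom κ x) :
    dom κ (FixAbs.restrict κ x i) = i := by
  rw [hx.dom_restrict hi, ZFSet.inter_eq_left_of_subset h]

theorem restrict_eq_self (hx : IsThread κ x) (h : dom κ x ⊆ i) :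
    FixAbs.restrict κ x i = x :=
  ext_pair (fun _ h => hx.sub (restrict_subset h)) hx.sub fun γ v => by
    rw [hx.pair_mem_restrict]
    exact ⟨fun h => h.2, fun hv => ⟨h (hx.mem_dom.2 ⟨v, hv⟩), hv⟩⟩

theorem dom_mono (hx : IsThread κ x) (hy : IsThread κ y) (h : x ⊆ y) : dom κ x ⊆ dom κ y := by
  intro γ hγ
  obtain ⟨v, hv⟩ := hx.mem_dom.1 hγ
  exact hy.mem_dom.2 ⟨v, h hv⟩

theorem eq_restrict_of_subset (hx : IsThread κ x) (hy : IsThread κ y) (h : x ⊆ y) :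
    x = FixAbs.restrict κ y (dom κ x) := by
  refine ext_pair hx.sub (fun _ h => hy.sub (restrict_subset h)) fun γ v => ?_
  rw [hy.pair_mem_restrict, hx.mem_dom]
  constructor
  · exact fun hv => ⟨⟨v, hv⟩, h hv⟩
  · rintro ⟨⟨w, hw⟩, hv⟩
    rwa [hy.func hv (h hw)]

theorem eq_of_subset_of_dom (hx : IsThread κ x) (hy : IsThread κ y) (h : x ⊆ y)
    (hd : dom κ x = dom κ y) : x = y := by
  rw [hx.eq_restrict_of_subset hy h, hd]
  exact hy.restrict_eq_self fun _ => id

theorem restrict_subset_restrict (hx : IsThread κ x) (h : i ⊆ j) :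
    FixAbs.restrict κ x i ⊆ FixAbs.restrict κ x j :=
  subset_of_pair (fun _ h => hx.sub (restrict_subset h)) fun γ v hv => by
    rw [hx.pair_mem_restrict] at hv ⊢
    exact ⟨h hv.1, hv.2⟩

theorem join_subset : join κ x y ⊆ κ := ZFSet.sep_subset

theorem isOrdinal_join (hκ : κ.IsOrdinal) : (join κ x y).IsOrdinal := by
  rw [ZFSet.isOrdinal_iff_forall_mem_isOrdinal]
  refine ⟨fun γ hγ δ hδ => ?_, fun γ hγ => hκ.mem (join_subset hγ)⟩
  rw [join, ZFSet.mem_sep] at hγ ⊢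
  refine ⟨hκ.mem_trans hδ hγ.1, fun ε hε => hγ.2 ε ?_⟩
  rcases ZFSet.mem_insert_iff.1 hε with rfl | hε
  · exact ZFSet.mem_insert_of_mem _ hδ
  · exact ZFSet.mem_insert_of_mem _ ((hκ.mem hγ.1).mem_trans hε hδ)

theorem exists_of_mem_join {γ : ZFSet.{u}} (h : γ ∈ join κ x y) :
    ∃ v, ZFSet.pair γ v ∈ x ∧ ZFSet.pair γ v ∈ y := by
  rw [join, ZFSet.mem_sep] at h
  obtain ⟨v, -, hv⟩ := h.2 γ (ZFSet.mem_insert _ _)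
  exact ⟨v, hv⟩

theorem agree_join (hx : IsThread κ x) (hy : IsThread κ y) : Agree x y (join κ x y) := by
  intro δ hδ v
  obtain ⟨w, hw, hw'⟩ := exists_of_mem_join hδ
  constructor
  · intro hv
    rwa [hx.func hv hw]
  · intro hv
    rwa [hy.func hv hw']

/-- Threads that agree on all of `κ` are equal. Hence the join of distinct threads is a legitimate
index for `α`. -/
theorem join_mem (hκ : κ.IsOrdinal) (hx : IsThread κ x) (hy : IsThread κ y) (hxy : x ≠ y) :
    join κ x y ∈ κ := by
  rcases ((isOrdinal_join hκ).subset_iff_eq_or_mem hκ).1 join_subset with h | h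
  · exfalso
    apply hxy
    refine ext_pair hx.sub hy.sub fun γ v => ?_
    have hag := hx.agree_join hy
    rw [h] at hag
    exact ⟨fun hv => (hag γ (hx.mem_left hv) v).1 hv, fun hv => (hag γ (hy.mem_left hv) v).2 hv⟩
  · exact h

theorem subset_join (hx : IsThread κ x) (hi : i.IsOrdinal) (hid : i ⊆ dom κ x)
    (h : Agree x y i) : i ⊆ join κ x y := by
  intro γ hγ
  rw [join, ZFSet.mem_sep]
  refine ⟨dom_subset (hid hγ), fun δ hδ => ?_⟩
  have hδi : δ ∈ i := by
    rcases ZFSet.mem_insert_iff.1 hδ with rfl | hδ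
    · exact hγ
    · exact hi.mem_trans hδ hγ
  obtain ⟨v, hv⟩ := hx.mem_dom.1 (hid hδi)
  exact ⟨v, hx.mem_right hv, hv, (h δ hδi v).1 hv⟩

/-- If `x` stops before `i`, then `y`, having the same pairs below `i`, must stop at the same stage.
So agreement below `i` is either equality or an honest common initial segment of length at least
`i`. -/
theorem eq_or_subset_join (hκ : κ.IsOrdinal) (hx : IsThread κ x) (hy : IsThread κ y)
    (hi : i.IsOrdinal) (h : Agree x y i) : x = y ∨ i ⊆ join κ x y := by
  by_cases hid : i ⊆ dom κ x
  · exact Or.inr (hx.subset_join hi hid h)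
  left
  have hdi := (hi.not_subset_iff_mem (hx.isOrdinal_dom hκ)).1 hid
  have hdy : dom κ y ⊆ dom κ x := by
    rw [← ((hx.isOrdinal_dom hκ).notMem_iff_subset (hy.isOrdinal_dom hκ))]
    intro hd
    obtain ⟨v, hv⟩ := hy.mem_dom.1 hd
    exact ZFSet.mem_irrefl _ (hx.mem_dom.2 ⟨v, (h _ hdi v).2 hv⟩)
  have hdi' := hi.subset_of_mem hdi
  refine ext_pair hx.sub hy.sub fun γ v => ?_
  constructor
  · exact fun hv => (h γ (hdi' (hx.mem_dom.2 ⟨v, hv⟩)) v).1 hv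
  · exact fun hv => (h γ (hdi' (hdy (hy.mem_dom.2 ⟨v, hv⟩))) v).2 hv

/-- Being a thread is a local property. -/
theorem of_local (hsucc : ∀ i ∈ κ, insert i i ∈ κ) (hx : x ⊆ ZFSet.prod κ κ)
    (h : ∀ i ∈ κ, ∃ t, IsThread κ t ∧ Agree x t i) :
    IsThread κ x := by
  have hl : ∀ {γ v}, ZFSet.pair γ v ∈ x → γ ∈ κ := fun hv => (ZFSet.pair_mem_prod.1 (hx hv)).1
  refine ⟨hx, ?_, ?_, ?_, ?_, ?_⟩
  · intro γ y y' h1 h2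
    obtain ⟨t, ht, hxt⟩ := h _ (hsucc γ (hl h1))
    exact ht.func ((hxt γ (ZFSet.mem_insert _ _) _).1 h1) ((hxt γ (ZFSet.mem_insert _ _) _).1 h2)
  · intro γ y δ h1 hδ
    obtain ⟨t, ht, hxt⟩ := h _ (hsucc γ (hl h1))
    obtain ⟨y', hy'⟩ := ht.down ((hxt γ (ZFSet.mem_insert _ _) _).1 h1) hδ
    exact ⟨y', (hxt δ (ZFSet.mem_insert_of_mem _ hδ) _).2 hy'⟩
  · intro γ y h1
    obtain ⟨t, ht, hxt⟩ := h _ (hsucc γ (hl h1))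
    exact ht.lt ((hxt γ (ZFSet.mem_insert _ _) _).1 h1)
  · intro γ y δ y' h1 h2 hγδ hδy
    obtain ⟨t, ht, hxt⟩ := h _ (hsucc δ (hl h2))
    exact ht.const ((hxt γ (ZFSet.mem_insert_of_mem _ hγδ) _).1 h1)
      ((hxt δ (ZFSet.mem_insert _ _) _).1 h2) hγδ hδy
  · intro l hl h0 hd
    obtain ⟨t, ht, hxt⟩ := h l hl
    obtain ⟨γ, hγ, y, hy, hly⟩ := ht.lim l hl h0 fun δ hδ => by
      obtain ⟨y, hy⟩ := hd δ hδ
      exact ⟨y, (hxt δ hδ _).1 hy⟩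
    exact ⟨γ, hγ, y, (hxt γ hγ _).2 hy, hly⟩

theorem empty : IsThread κ (∅ : ZFSet.{u}) where
  sub := fun z hz => absurd hz (ZFSet.notMem_empty z)
  func := fun h => absurd h (ZFSet.notMem_empty _)
  down := fun h => absurd h (ZFSet.notMem_empty _)
  lt := fun h => absurd h (ZFSet.notMem_empty _)
  const := fun h => absurd h (ZFSet.notMem_empty _)
  lim := by
    intro l _ h0 h
    exfalso
    apply h0
    rw [ZFSet.eq_empty]
    intro δ hδ
    obtain ⟨y, hy⟩ := h δ hδ
    exact ZFSet.notMem_empty _ hy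

/-- Two values of a thread beyond the same point outside its domain are equal. -/
theorem value_unique (hκ : κ.IsOrdinal) (hx : IsThread κ x) {γ δ δ' v v' : ZFSet.{u}}
    (hγκ : γ ∈ κ) (hγ : γ ∉ dom κ x) (h : ZFSet.pair δ v ∈ x) (h' : ZFSet.pair δ' v' ∈ x)
    (hv : γ ∈ v) (hv' : γ ∈ v') : v = v' := by
  have hdγ : ∀ {ε w}, ZFSet.pair ε w ∈ x → ε ∈ γ := fun hw =>
    ((hκ.mem hγκ).notMem_iff_subset (hx.isOrdinal_dom hκ)).1 hγ (hx.mem_dom.2 ⟨_, hw⟩)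
  have hδ := hκ.mem (hx.mem_left h)
  have hδ' := hκ.mem (hx.mem_left h')
  rcases hδ.mem_trichotomous hδ' with hd | rfl | hd
  · exact (hx.const h h' hd ((hκ.mem (hx.mem_right h)).mem_trans (hdγ h') hv)).symm
  · exact hx.func h h'
  · exact hx.const h' h hd ((hκ.mem (hx.mem_right h')).mem_trans (hdγ h) hv')

theorem subset_extend : x ⊆ extend κ x β := fun _ h => ZFSet.mem_union.2 (Or.inl h)

/-- Beyond the domain of `x`, a promise that has not run out is kept, and otherwise `β` is promised.
The bounds on the quantifiers in `extend` serve definability only and disappear here. -/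
theorem pair_mem_extend (hκ : κ.IsOrdinal) (hx : IsThread κ x) (hβ : β ∈ κ) {γ v : ZFSet.{u}} :
    ZFSet.pair γ v ∈ extend κ x β ↔ ZFSet.pair γ v ∈ x ∨ (γ ∈ β ∧ γ ∉ dom κ x ∧
      ((∃ δ, ZFSet.pair δ v ∈ x ∧ γ ∈ v) ∨
        ((∀ δ v', ZFSet.pair δ v' ∈ x → γ ∉ v') ∧ v = β))) := by
  rw [extend, ZFSet.mem_union, ZFSet.mem_sep, ZFSet.pair_mem_prod]
  refine or_congr Iff.rfl ⟨?_, ?_⟩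
  · rintro ⟨-, γ', hγ, v', hv, he, hd, h⟩
    obtain ⟨rfl, rfl⟩ := ZFSet.pair_inj.1 he
    refine ⟨hγ, hd, ?_⟩
    rcases h with ⟨δ, -, h⟩ | ⟨h, rfl⟩
    · exact Or.inl ⟨δ, h⟩
    · exact Or.inr ⟨fun δ v' h' => h δ (hx.mem_left h') v' (hx.mem_right h') h', rfl⟩
  · rintro ⟨hγ, hd, h⟩
    have hγκ := hκ.mem_trans hγ hβ
    have hv : v ∈ κ := by
      rcases h with ⟨δ, h, -⟩ | ⟨-, rfl⟩
      · exact hx.mem_right h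
      · exact hβ
    refine ⟨⟨hγκ, hv⟩, γ, hγ, v, hv, rfl, hd, ?_⟩
    rcases h with ⟨δ, h, h'⟩ | ⟨h, rfl⟩
    · exact Or.inl ⟨δ, hx.mem_left h, h, h'⟩
    · exact Or.inr ⟨fun δ _ v' _ h' => h δ v' h', rfl⟩

theorem exists_pair_mem_extend (hκ : κ.IsOrdinal) (hx : IsThread κ x) (hβ : β ∈ κ)
    {γ : ZFSet.{u}} (hγ : γ ∈ β) : ∃ v, ZFSet.pair γ v ∈ extend κ x β := by
  by_cases hd : γ ∈ dom κ x
  · obtain ⟨v, hv⟩ := hx.mem_dom.1 hd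
    exact ⟨v, subset_extend hv⟩
  by_cases hv : ∃ δ v, ZFSet.pair δ v ∈ x ∧ γ ∈ v
  · obtain ⟨δ, v, hv⟩ := hv
    exact ⟨v, (hx.pair_mem_extend hκ hβ).2 (Or.inr ⟨hγ, hd, Or.inl ⟨δ, hv⟩⟩)⟩
  · push Not at hv
    exact ⟨β, (hx.pair_mem_extend hκ hβ).2 (Or.inr ⟨hγ, hd, Or.inr ⟨hv, rfl⟩⟩)⟩

/-- Values of the extension outside the domain of the thread. -/
theorem lim_extend (hκ : κ.IsOrdinal) (hx : IsThread κ x) (hβ : β ∈ κ) {l : ZFSet.{u}}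
    (hl : l ∈ κ) (hlβ : l ⊆ β) (h0 : l ≠ ∅) :
    ∃ γ ∈ l, ∃ v, ZFSet.pair γ v ∈ extend κ x β ∧ l ⊆ v := by
  have hlo := hκ.mem hl
  by_cases hld : l ⊆ dom κ x
  · obtain ⟨γ, hγ, v, hv, h⟩ := hx.lim l hl h0 fun δ hδ => hx.mem_dom.1 (hld hδ)
    exact ⟨γ, hγ, v, subset_extend hv, h⟩
  have hdl := (hlo.not_subset_iff_mem (hx.isOrdinal_dom hκ)).1 hld
  have hdκ := hκ.mem_trans hdl hl
  by_cases hd0 : dom κ x = ∅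
  · have hno : ∀ δ v, ZFSet.pair δ v ∉ x := fun δ v hv =>
      ZFSet.notMem_empty δ (hd0 ▸ hx.mem_dom.2 ⟨v, hv⟩)
    rw [hd0] at hdl
    refine ⟨∅, hdl, β, (hx.pair_mem_extend hκ hβ).2 (Or.inr ⟨hlβ hdl, ?_, Or.inr
      ⟨fun δ v hv => absurd hv (hno δ v), rfl⟩⟩), hlβ⟩
    rw [hd0]
    exact ZFSet.notMem_empty _
  -- `m` is the promise still open when `x` ends. If `m ∈ l`, it runs out at stage `m`, where the
  -- extension promises `β`, which covers `l`; otherwise `m` itself covers `l`.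
  obtain ⟨γ, hγ, m, hm, hdm⟩ := hx.lim _ hdκ hd0 fun δ hδ => hx.mem_dom.1 hδ
  have hmo := hκ.mem (hx.mem_right hm)
  have hval : ∀ δ v, ZFSet.pair δ v ∈ x → dom κ x ∈ v → v = m := by
    intro δ v hv hdv
    have hδd : δ ∈ dom κ x := hx.mem_dom.2 ⟨v, hv⟩
    rcases (hκ.mem (hx.mem_left hv)).mem_trichotomous (hκ.mem (hx.mem_left hm)) with h | rfl | h
    · exact (hx.const hv hm h ((hκ.mem (hx.mem_right hv)).mem_trans hγ hdv)).symm
    · exact hx.func hv hm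
    · exact hx.const hm hv h (hdm hδd)
  rcases hmo.mem_or_subset hlo with hml | hlm
  · refine ⟨m, hml, β, (hx.pair_mem_extend hκ hβ).2 (Or.inr ⟨hlβ hml, ?_, Or.inr
      ⟨fun δ v hv hmv => ?_, rfl⟩⟩), hlβ⟩
    · intro h
      exact ZFSet.mem_irrefl _ (hdm h)
    · have hdv : dom κ x ∈ v :=
        (hx.isOrdinal_dom hκ).mem_of_subset_of_mem (hκ.mem (hx.mem_right hv)) hdm hmv
      rw [hval δ v hv hdv] at hmv
      exact ZFSet.mem_irrefl _ hmv
  · exact ⟨γ, hlo.mem_trans hγ hdl, m, subset_extend hm, hlm⟩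

/-- At most one promise of `x` is open at a stage outside the domain of `x`, so the new values are
unambiguous. The final promise `β` runs to the end of the new domain, so it never has to be renewed.
-/
theorem extend (hκ : κ.IsOrdinal) (hx : IsThread κ x) (hβ : β ∈ κ) (hd : dom κ x ⊆ β) :
    IsThread κ (extend κ x β) := by
  have hβo := hκ.mem hβ
  have hmem : ∀ {γ v}, ZFSet.pair γ v ∈ FixAbs.extend κ x β → γ ∈ β := by
    intro γ v hv
    rcases (hx.pair_mem_extend hκ hβ).1 hv with hv | hv
    · exact hd (hx.mem_dom.2 ⟨v, hv⟩)
    · exact hv.1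
  have hdx : ∀ {γ v}, ZFSet.pair γ v ∈ x → γ ∈ dom κ x := fun hv => hx.mem_dom.2 ⟨_, hv⟩
  refine ⟨?_, ?_, ?_, ?_, ?_, ?_⟩
  · intro z hz
    rw [FixAbs.extend, ZFSet.mem_union, ZFSet.mem_sep] at hz
    rcases hz with hz | hz
    · exact hx.sub hz
    · exact hz.1
  · intro γ v v' h h'
    rw [hx.pair_mem_extend hκ hβ] at h h'
    rcases h with h | ⟨hγ, hγd, h⟩ <;> rcases h' with h' | ⟨hγ', hγd', h'⟩
    · exact hx.func h h'
    · exact absurd (hdx h) hγd'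
    · exact absurd (hdx h') hγd
    · rcases h with ⟨δ, h, hv⟩ | ⟨h, rfl⟩ <;> rcases h' with ⟨δ', h', hv'⟩ | ⟨h', rfl⟩
      · exact hx.value_unique hκ (hκ.mem_trans hγ hβ) hγd h h' hv hv'
      · exact absurd hv (h' _ _ h)
      · exact absurd hv' (h _ _ h')
      · rfl
  · intro γ v δ h hδ
    exact hx.exists_pair_mem_extend hκ hβ (hβo.mem_trans hδ (hmem h))
  · intro γ v h
    rw [hx.pair_mem_extend hκ hβ] at h
    rcases h with h | ⟨hγ, -, ⟨δ, -, h⟩ | ⟨-, rfl⟩⟩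
    · exact hx.lt h
    · exact h
    · exact hγ
  · intro γ v δ v' h h' hγδ hδv
    have hδβ := hmem h'
    have hδo := hβo.mem hδβ
    rw [hx.pair_mem_extend hκ hβ] at h h'
    rcases h with h | ⟨hγ, hγd, h⟩ <;> rcases h' with h' | ⟨hδ, hδd, h'⟩
    · exact hx.const h h' hγδ hδv
    · rcases h' with ⟨δ', h', hv'⟩ | ⟨h', rfl⟩
      · exact hx.value_unique hκ (hκ.mem_trans hδ hβ) hδd h' h hv' hδv
      · exact absurd hδv (h' _ _ h)
    · exact absurd ((hx.isOrdinal_dom hκ).mem_trans hγδ (hdx h')) hγd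
    · rcases h with ⟨ε, h, hv⟩ | ⟨h, rfl⟩ <;> rcases h' with ⟨ε', h', hv'⟩ | ⟨h', rfl⟩
      · exact hx.value_unique hκ (hκ.mem_trans hδ hβ) hδd h' h hv' hδv
      · exact absurd hδv (h' _ _ h)
      · exact absurd ((hκ.mem (hx.mem_right h')).mem_trans hγδ hv') (h _ _ h')
      · rfl
  · intro l hl h0 h
    refine hx.lim_extend hκ hβ hl (fun δ hδ => ?_) h0
    obtain ⟨v, hv⟩ := h δ hδ
    exact hmem hv

theorem dom_extend (hκ : κ.IsOrdinal) (hx : IsThread κ x) (hβ : β ∈ κ) (hd : dom κ x ⊆ β) :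
    dom κ (FixAbs.extend κ x β) = β := by
  ext γ
  rw [(hx.extend hκ hβ hd).mem_dom]
  constructor
  · rintro ⟨v, hv⟩
    rcases (hx.pair_mem_extend hκ hβ).1 hv with hv | hv
    · exact hd (hx.mem_dom.2 ⟨v, hv⟩)
    · exact hv.1
  · exact fun hγ => hx.exists_pair_mem_extend hκ hβ hγ

end IsThread

/-- The bounded form of the definition, with all quantifiers restricted to `κ` or its elements,
which makes threads definable in any model containing `κ`. -/
theorem isThread_iff : IsThread κ x ↔ x ⊆ ZFSet.prod κ κ ∧
    (∀ γ, γ ∈ κ → ∀ y, y ∈ κ → ZFSet.pair γ y ∈ x → (γ ∈ y ∧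
      (∀ y', y' ∈ κ → ZFSet.pair γ y' ∈ x → y = y') ∧
      (∀ δ, δ ∈ γ → ∃ y', y' ∈ κ ∧ ZFSet.pair δ y' ∈ x) ∧
      (∀ δ, δ ∈ κ → ∀ y', y' ∈ κ → ZFSet.pair δ y' ∈ x → γ ∈ δ → δ ∈ y → y' = y))) ∧
    (∀ l, l ∈ κ → l ≠ ∅ → (∀ δ, δ ∈ l → ∃ y, y ∈ κ ∧ ZFSet.pair δ y ∈ x) →
      ∃ γ, γ ∈ l ∧ ∃ y, y ∈ κ ∧ (ZFSet.pair γ y ∈ x ∧ l ⊆ y)) := by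
  constructor
  · intro h
    refine ⟨h.sub, fun γ _ y _ hy => ⟨h.lt hy, fun y' _ hy' => h.func hy hy', fun δ hδ => ?_,
      fun δ _ y' _ hy' => h.const hy hy'⟩, fun l hl h0 hd => ?_⟩
    · obtain ⟨y', hy'⟩ := h.down hy hδ
      exact ⟨y', h.mem_right hy', hy'⟩
    · obtain ⟨γ, hγ, y, hy, hly⟩ := h.lim l hl h0 fun δ hδ => by
        obtain ⟨y, -, hy⟩ := hd δ hδ
        exact ⟨y, hy⟩
      exact ⟨γ, hγ, y, h.mem_right hy, hy, hly⟩
  · rintro ⟨hs, h, hl⟩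
    have hp : ∀ {γ v}, ZFSet.pair γ v ∈ x → γ ∈ κ ∧ v ∈ κ := fun hv =>
      ZFSet.pair_mem_prod.1 (hs hv)
    refine ⟨hs, fun {γ y y'} h1 h2 => (h γ (hp h1).1 y (hp h1).2 h1).2.1 y' (hp h2).2 h2, ?_,
      fun {γ y} h1 => (h γ (hp h1).1 y (hp h1).2 h1).1,
      fun {γ y δ y'} h1 h2 => (h γ (hp h1).1 y (hp h1).2 h1).2.2.2 δ (hp h2).1 y' (hp h2).2 h2, ?_⟩
    · intro γ y δ h1 hδ
      obtain ⟨y', -, hy'⟩ := (h γ (hp h1).1 y (hp h1).2 h1).2.2.1 δ hδ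
      exact ⟨y', hy'⟩
    · intro l hlκ h0 hd
      obtain ⟨γ, hγ, y, -, hy⟩ := hl l hlκ h0 fun δ hδ => by
        obtain ⟨y, hy⟩ := hd δ hδ
        exact ⟨y, (hp hy).2, hy⟩
      exact ⟨γ, hγ, y, hy⟩

/-! ### Definability of threads and absoluteness of short threads -/

section Definability

variable {V : Set ZFSet.{u}} [hV : Fact (IsModelOfSetTheory V)] [hκ : Fact (κ ∈ V)]

instance : Fact (ZFSet.prod κ κ ∈ V) := ⟨prod_mem_model hκ.out hκ.out⟩

instance DefRel.isThread {F : Env V → ZFSet.{u}} [hF : DefFun F] :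
    DefRel (fun v => IsThread κ (F v)) :=
  DefRel.comp₁ (R := fun x => IsThread κ x) (by simp only [isThread_iff]; infer_instance) hF

instance DefFun.dom {F : Env V → ZFSet.{u}} [hF : DefFun F] :
    DefFun (fun v => dom κ (F v)) :=
  DefFun.comp₁ (op := fun x => FixAbs.dom κ x) (by unfold FixAbs.dom; infer_instance) hF

instance DefFun.restrict {F G : Env V → ZFSet.{u}} [hF : DefFun F] [hG : DefFun G] :
    DefFun (fun v => restrict κ (F v) (G v)) :=
  DefFun.comp₂ (op := fun x i => FixAbs.restrict κ x i)
    (by unfold FixAbs.restrict; infer_instance) hF hG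

instance DefFun.join {F G : Env V → ZFSet.{u}} [hF : DefFun F] [hG : DefFun G] :
    DefFun (fun v => join κ (F v) (G v)) :=
  DefFun.comp₂ (op := fun x y => FixAbs.join κ x y)
    (by unfold FixAbs.join; infer_instance) hF hG

instance DefFun.extend {F G : Env V → ZFSet.{u}} [hF : DefFun F] [hG : DefFun G] :
    DefFun (fun v => extend κ (F v) (G v)) :=
  DefFun.comp₂ (op := fun x b => FixAbs.extend κ x b)
    (by unfold FixAbs.extend; infer_instance) hF hG

/-- Every thread with a domain below `κ` belongs to all models that contain `κ`. -/
theorem IsThread.mem_model (hκo : κ.IsOrdinal) (hx : IsThread κ x) (hd : dom κ x ∈ κ) :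
    x ∈ V := by
  have main : ∀ i : ZFSet.{u}, i ∈ κ → ∀ x, IsThread κ x → dom κ x = i → x ∈ V := by
    intro i
    induction i using ZFSet.inductionOn with
    | _ i ih =>
      intro hi x hx hdi
      by_cases h0 : i = ∅
      · have : x = ∅ := by
          rw [ZFSet.eq_empty]
          intro z hz
          obtain ⟨a, _, b, _, rfl⟩ := ZFSet.mem_prod.1 (hx.sub hz)
          exact ZFSet.notMem_empty a (h0 ▸ hdi ▸ hx.mem_dom.2 ⟨b, hz⟩)
        rw [this]
        exact empty_mem_model
      have hio := hκo.mem hi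
      -- The promise `v` made at `γ` lasts until the end `i` of `x`. So `x` is its restriction to
      -- `γ`, which lies in `V` by induction, together with a constant block on the stages from `γ`
      -- to `i`.
      obtain ⟨γ, hγ, v, hv, hiv⟩ := hx.lim i hi h0 fun δ hδ => hx.mem_dom.1 (hdi ▸ hδ)
      have hγo := hio.mem hγ
      have h1 : FixAbs.restrict κ x γ ∈ V := ih γ hγ (hκo.mem_trans hγ hi) _ (hx.restrict hγo)
        (hx.dom_restrict_of_subset hγo (hdi ▸ hio.subset_of_mem hγ))
      have : Fact (i ∈ V) := ⟨mem_of_mem_mem hκ.out hi⟩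
      have : Fact (γ ∈ V) := ⟨mem_of_mem_mem hκ.out (hκo.mem_trans hγ hi)⟩
      have : Fact (v ∈ V) := ⟨mem_of_mem_mem hκ.out (hx.mem_right hv)⟩
      have h2 : ZFSet.sep (fun z => ∃ δ, δ ∈ i ∧ (δ ∉ γ ∧ z = ZFSet.pair δ v))
          (ZFSet.prod κ κ) ∈ V := sep_mem_model (prod_mem_model hκ.out hκ.out) inferInstance
      convert union_mem_model h1 h2 using 1
      have hconst : ∀ δ, δ ∈ i → δ ∉ γ → ∀ w, ZFSet.pair δ w ∈ x → w = v := by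
        intro δ hδ hδγ w hw
        rcases ((hγo.subset_iff_eq_or_mem (hio.mem hδ))).1
          (((hio.mem hδ).notMem_iff_subset hγo).1 hδγ) with rfl | h
        · exact hx.func hw hv
        · exact hx.const hv hw h (hiv hδ)
      ext z
      rw [ZFSet.mem_union, ZFSet.mem_sep]
      constructor
      · intro hz
        obtain ⟨a, ha, b, hb, rfl⟩ := ZFSet.mem_prod.1 (hx.sub hz)
        have hai : a ∈ i := hdi ▸ hx.mem_dom.2 ⟨b, hz⟩
        by_cases haγ : a ∈ γ
        · exact Or.inl (hx.pair_mem_restrict.2 ⟨haγ, hz⟩)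
        · refine Or.inr ⟨hx.sub hz, a, hai, haγ, ?_⟩
          rw [hconst a hai haγ b hz]
      · rintro (hz | ⟨-, δ, hδ, hδγ, rfl⟩)
        · exact IsThread.restrict_subset hz
        · obtain ⟨w, hw⟩ := hx.mem_dom.1 (hdi.symm ▸ hδ)
          rwa [← hconst δ hδ hδγ w hw]
  exact main _ hd x hx rfl

end Definability

end FixAbs

namespace FixAbs

open DistStr

/-! ### The space of threads -/

section ThreadSet

variable (V : Set ZFSet.{u}) (κ : ZFSet.{u})

/-- The set of threads through `κ` that belong to `V`. -/
def threadSet : ZFSet.{u} :=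
  ZFSet.sep (fun x => x ∈ V ∧ IsThread κ x) (ZFSet.powerset (ZFSet.prod κ κ))

variable {V κ}

theorem mem_threadSet {x : ZFSet.{u}} : x ∈ threadSet V κ ↔ x ∈ V ∧ IsThread κ x := by
  rw [threadSet, ZFSet.mem_sep, ZFSet.mem_powerset]
  exact ⟨fun h => h.2, fun h => ⟨h.2.sub, h⟩⟩

theorem isThread_of_mem (x : threadSet V κ) : IsThread κ x.1 := (mem_threadSet.1 x.2).2

open Classical in
/-- The map that extends each thread by one stage, if possible. -/
noncomputable def step (κ x : ZFSet.{u}) : ZFSet.{u} :=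
  if dom κ x = κ then x else extend κ x (insert (dom κ x) (dom κ x))

theorem subset_step {x : ZFSet.{u}} : x ⊆ step κ x := by
  unfold step
  split_ifs
  · exact fun _ => id
  · exact IsThread.subset_extend

theorem dom_mem {x : ZFSet.{u}} (hκo : κ.IsOrdinal) (hx : IsThread κ x) (hd : dom κ x ≠ κ) :
    dom κ x ∈ κ :=
  (((hx.isOrdinal_dom hκo).subset_iff_eq_or_mem hκo).1 IsThread.dom_subset).resolve_left hd

variable [hV : Fact (IsModelOfSetTheory V)] [hκ : Fact (κ ∈ V)]

instance : Fact (threadSet V κ ∈ V) := ⟨by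
  have h := sep_mem_model (powerset_mem_model (prod_mem_model hκ.out hκ.out))
    (P := fun x => IsThread κ x) inferInstance
  convert h using 1
  ext x
  rw [mem_threadSet, ZFSet.mem_sep, ZFSet.mem_sep, ZFSet.mem_powerset]
  exact ⟨fun h => ⟨⟨h.2.sub, h.1⟩, h.2⟩, fun h => ⟨h.1.2, h.2⟩⟩⟩

/-- The thread `x` need not belong to `V`: its restriction to `i ∈ κ` is short and hence absolute.
Threads of a larger model are thus approximated by points of the smaller one. -/
theorem restrict_mem_threadSet {x i : ZFSet.{u}} (hκo : κ.IsOrdinal) (hx : IsThread κ x)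
    (hi : i ∈ κ) : restrict κ x i ∈ threadSet V κ := by
  have hio := hκo.mem hi
  have hr := hx.restrict hio
  refine mem_threadSet.2 ⟨hr.mem_model hκo ?_, hr⟩
  refine (hr.isOrdinal_dom hκo).mem_of_subset_of_mem hκo ?_ hi
  rw [hx.dom_restrict hio]
  exact fun z hz => (ZFSet.mem_inter.1 hz).1

theorem step_isThread {x : ZFSet.{u}} (hκo : κ.IsOrdinal) (hsucc : ∀ i ∈ κ, insert i i ∈ κ)
    (hx : IsThread κ x) (hd : dom κ x ≠ κ) : IsThread κ (step κ x) ∧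
    dom κ (step κ x) = insert (dom κ x) (dom κ x) := by
  have h1 := hsucc _ (dom_mem hκo hx hd)
  have h2 : dom κ x ⊆ insert (dom κ x) (dom κ x) := fun z hz => ZFSet.mem_insert_of_mem _ hz
  rw [step, if_neg hd]
  exact ⟨hx.extend hκo h1 h2, hx.dom_extend hκo h1 h2⟩

theorem step_mem_threadSet (hκo : κ.IsOrdinal) (hsucc : ∀ i ∈ κ, insert i i ∈ κ)
    (x : threadSet V κ) : step κ x.1 ∈ threadSet V κ := by
  by_cases hd : dom κ x.1 = κ
  · rw [step, if_pos hd]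
    exact x.2
  · have hx := isThread_of_mem x
    obtain ⟨h1, h2⟩ := step_isThread hκo hsucc hx hd
    exact mem_threadSet.2 ⟨h1.mem_model hκo (h2 ▸ hsucc _ (dom_mem hκo hx hd)), h1⟩

end ThreadSet

/-! ### The tree metric on threads and its completeness -/

section TreeSpace

variable (V : Set ZFSet.{u}) {κ : ZFSet.{u}} [hV : Fact (IsModelOfSetTheory V)]
  [hκ : Fact (κ ∈ V)] {X : DistStr.{u}} {α : κ → X.carrier}

open Classical in
/-- The space of all threads of `V` with the tree metric given by `α`. -/
noncomputable def treeSpace (hα : X.IsScale α) : DynStr X where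
  points := threadSet V κ
  dist x y := if h : x = y then X.zero else
    α ⟨join κ x.1 y.1, (isThread_of_mem x).join_mem hα.isOrdinal (isThread_of_mem y)
      fun h' => h (Subtype.ext h')⟩
  map x := ⟨step κ x.1, step_mem_threadSet hα.isOrdinal hα.succ_mem x⟩

variable {V} {hα : X.IsScale α}

theorem treeSpace_dist_self (x : (treeSpace V hα).points) :
    (treeSpace V hα).dist x x = X.zero := dif_pos rfl

theorem treeSpace_dist_of_ne {x y : (treeSpace V hα).points} (h : x ≠ y) :
    ∃ j : κ, j.1 = join κ x.1 y.1 ∧ (treeSpace V hα).dist x y = α j :=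
  ⟨⟨join κ x.1 y.1, (isThread_of_mem x).join_mem hα.isOrdinal (isThread_of_mem y)
    fun h' => h (Subtype.ext h')⟩, rfl, dif_neg h⟩

/-- For distinct points, strictness of `α` converts the inequality into inclusion of indices, and
`eq_or_subset_join` covers agreement beyond the end of a thread. Metric estimates thereby become
statements about agreement. -/
theorem treeSpace_dist_le_iff (hX : X.IsDistanceMonoid V) {x y : (treeSpace V hα).points}
    {i : κ} : X.le ((treeSpace V hα).dist x y) (α i) ↔ Agree x.1 y.1 i.1 := by
  by_cases h : x = y
  · subst h
    rw [treeSpace_dist_self]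
    exact iff_of_true (hX.zero_le _) (Agree.refl _ _)
  · obtain ⟨j, hj, hd⟩ := treeSpace_dist_of_ne h
    rw [hd, hα.le_iff hX, hj]
    constructor
    · exact fun hi => ((isThread_of_mem x).agree_join (isThread_of_mem y)).mono hi
    · intro hag
      refine ((isThread_of_mem x).eq_or_subset_join hα.isOrdinal (isThread_of_mem y)
        (hα.ordinal_of_mem i.2) hag).resolve_left fun h' => h (Subtype.ext h')

/-- Agreement below an ordinal is transitive, so a distance is bounded by the larger of the other
two and hence by their sum. -/
theorem treeSpace_isMetric (hX : X.IsDistanceMonoid V) : (treeSpace V hα).IsMetric := by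
  refine ⟨fun x y => ⟨fun h => ?_, ?_⟩, fun x y z => ?_⟩
  · by_contra hxy
    obtain ⟨j, -, hd⟩ := treeSpace_dist_of_ne hxy
    exact hα.ne_zero j (hd ▸ h.1)
  · rintro rfl
    exact ⟨treeSpace_dist_self x, treeSpace_dist_self x⟩
  · by_cases hxy : x = y
    · subst hxy
      exact hX.le_add_left _ _
    by_cases hyz : y = z
    · subst hyz
      exact hX.le_add_right _ _
    obtain ⟨j, hj, hd⟩ := treeSpace_dist_of_ne hxy
    obtain ⟨k, hk, hd'⟩ := treeSpace_dist_of_ne hyz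
    have h1 : Agree x.1 y.1 j.1 := hj ▸ (isThread_of_mem x).agree_join (isThread_of_mem y)
    have h2 : Agree y.1 z.1 k.1 := hk ▸ (isThread_of_mem y).agree_join (isThread_of_mem z)
    rw [hd, hd']
    rcases (hα.ordinal_of_mem j.2).subset_total (hα.ordinal_of_mem k.2) with h | h
    · exact hX.le_trans _ _ _ ((treeSpace_dist_le_iff hX).2 (h1.trans (h2.mono h)))
        (hX.le_add_right _ _)
    · exact hX.le_trans _ _ _ ((treeSpace_dist_le_iff hX).2 ((h1.mono h).trans h2))
        (hX.le_add_left _ _)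

theorem treeSpace_isNonExpanding (hX : X.IsDistanceMonoid V) :
    (treeSpace V hα).IsNonExpanding := by
  intro x y
  by_cases hxy : x = y
  · subst hxy
    rw [treeSpace_dist_self, treeSpace_dist_self]
    exact hX.le_refl _
  obtain ⟨j, hj, hd⟩ := treeSpace_dist_of_ne hxy
  rw [hd, treeSpace_dist_le_iff hX, hj]
  exact ((isThread_of_mem _).agree_join (isThread_of_mem _)).mono
    (join_mono subset_step subset_step)

theorem treeSpace_in (hXV : X.In V) (hαV : FunIn V α) : (treeSpace V hα).In V := by
  have : Fact (FunIn V α) := ⟨hαV⟩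
  have : Fact (X.zero.1 ∈ V) := ⟨mem_of_mem_mem hXV.1 X.zero.2⟩
  have hT : threadSet V κ ∈ V := Fact.out
  refine ⟨hXV, hT, ?_, ?_⟩
  · refine fun₂In_of_graph hT hT hXV.1 (P := fun a b c => (a = b ∧ c = X.zero.1) ∨
      (a ≠ b ∧ c = app α (join κ a b))) inferInstance
      fun (a b : (treeSpace V hα).points) c => ?_
    by_cases hab : a = b
    · subst hab
      simp only [treeSpace_dist_self, true_and, ne_eq, not_true_eq_false, false_and, or_false]
      rw [Subtype.ext_iff, eq_comm]
    · obtain ⟨j, hj, hd⟩ := treeSpace_dist_of_ne (V := V) (hα := hα) hab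
      have hab' : a.1 ≠ b.1 := fun h => hab (Subtype.ext h)
      simp only [hab', false_and, ne_eq, not_false_eq_true, true_and, false_or]
      rw [hd, ← hj, app_coe, Subtype.ext_iff, eq_comm]
  · refine funIn_of_graph hT hT (P := fun a c => (dom κ a = κ ∧ c = a) ∨
      (dom κ a ≠ κ ∧ c = extend κ a (insert (dom κ a) (dom κ a)))) inferInstance fun a c => ?_
    refine Subtype.ext_iff.trans ?_
    rw [eq_comm]
    change c.1 = step κ a.1 ↔ _
    unfold step
    split_ifs with h <;> simp [h]

/-- The restriction of a point to an index, as a point. -/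
def restrictPt {x : ZFSet.{u}} (hα : X.IsScale α) (hx : IsThread κ x) (i : κ) :
    threadSet V κ :=
  ⟨restrict κ x i.1, restrict_mem_threadSet hα.isOrdinal hx i.2⟩

theorem treeSpace_isLimit_of_agree (hX : X.IsDistanceMonoid V)
    {p : κ → (treeSpace V hα).points} {x : (treeSpace V hα).points}
    (h : ∀ i : κ, Agree (p i).1 x.1 i.1) : (treeSpace V hα).IsLimit p x := by
  intro ε hε
  obtain ⟨i, hi⟩ := hα.coinitial ε hε
  refine ⟨i, fun j hj => ?_⟩
  have hag := (h j).mono hj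
  exact ⟨hX.le_trans _ _ _ ((treeSpace_dist_le_iff hX).2 hag.symm) hi,
    hX.le_trans _ _ _ ((treeSpace_dist_le_iff hX).2 hag) hi⟩

/-- The limit `L` consists of the pairs that belong to `p a` for all sufficiently small `a`. It is
definable from `p`, hence in `V`. Below each index it agrees with some `p a`, and being a thread is
a local property. -/
theorem treeSpace_isCauchyComplete (hX : X.IsDistanceMonoid V) (hXV : X.In V)
    (hαV : FunIn V α) : (treeSpace V hα).IsCauchyComplete V := by
  rintro A p ⟨hpV, -, hinf, hp⟩
  have : Fact (FunIn V α) := ⟨hαV⟩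
  have : Fact (PFunIn V p) := ⟨hpV⟩
  have : Fact (RelIn V X.le) := ⟨hXV.2.2⟩
  have : Fact (X.carrier ∈ V) := ⟨hXV.1⟩
  have hsmall : ∀ i j : κ, ∃ a : A, X.le a.1 (α i) ∧ X.le a.1 (α j) := by
    intro i j
    obtain ⟨k, hik, hjk⟩ := hα.sup_index i j
    obtain ⟨a, ha, hak⟩ := hX.exists_le_of_isInf_add hinf (hα.ne_zero k)
    exact ⟨⟨a, ha⟩, hX.le_trans _ _ _ hak (hα.anti hX hik), hX.le_trans _ _ _ hak (hα.anti hX hjk)⟩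
  have hag : ∀ (i : κ) (a b : A), X.le a.1 (α (hα.succ i)) → X.le b.1 (α (hα.succ i)) →
      Agree (p a).1 (p b).1 i.1 := fun i a b ha hb =>
    (treeSpace_dist_le_iff hX).1 (hX.le_trans _ _ _ (hp a b)
      (hX.le_trans _ _ _ (hX.add_le_add ha hb) (hα.two_le hX i)))
  let L : ZFSet.{u} := ZFSet.sep (fun z => ∃ i, i ∈ κ ∧ ∀ a, a ∈ X.carrier → ∀ t,
    t ∈ threadSet V κ → pgraph p a t → rel X.le a (app α i) → z ∈ t) (ZFSet.prod κ κ)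
  have hLV : L ∈ V := sep_mem_model (prod_mem_model hκ.out hκ.out) inferInstance
  have hL : ∀ z, z ∈ L ↔ z ∈ ZFSet.prod κ κ ∧
      ∃ i : κ, ∀ a : A, X.le a.1 (α i) → z ∈ (p a).1 := by
    intro z
    rw [ZFSet.mem_sep]
    refine and_congr Iff.rfl ⟨?_, ?_⟩
    · rintro ⟨i, hi, h⟩
      refine ⟨⟨i, hi⟩, fun a ha => h a.1.1 a.1.2 (p a).1 (p a).2 ((pgraph_coe p a _).2 rfl) ?_⟩
      rw [app_of_mem α hi]
      exact (rel_coe _ _ _).2 ha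
    · rintro ⟨i, h⟩
      refine ⟨i.1, i.2, fun a ha t ht hat hle => ?_⟩
      obtain ⟨_, hD, rfl⟩ := hat
      rw [app_coe] at hle
      exact h ⟨⟨a, ha⟩, hD⟩ ((rel_coe _ ⟨a, ha⟩ _).1 hle)
  have hLag : ∀ (i : κ) (a : A), X.le a.1 (α (hα.succ i)) → Agree L (p a).1 i.1 := by
    intro i a ha δ hδ v
    constructor
    · intro h
      obtain ⟨-, i', hi'⟩ := (hL _).1 h
      obtain ⟨b, hb, hb'⟩ := hsmall i' (hα.succ i)
      exact (hag i a b ha hb' δ hδ v).2 (hi' b hb)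
    · intro h
      exact (hL _).2 ⟨(isThread_of_mem (p a)).sub h, hα.succ i, fun b hb =>
        (hag i a b ha hb δ hδ v).1 h⟩
  have hLT : IsThread κ L := by
    refine IsThread.of_local hα.succ_mem ZFSet.sep_subset fun i hi => ?_
    obtain ⟨a, ha, -⟩ := hsmall (hα.succ ⟨i, hi⟩) (hα.succ ⟨i, hi⟩)
    exact ⟨(p a).1, isThread_of_mem (p a), hLag ⟨i, hi⟩ a ha⟩
  refine ⟨⟨L, mem_threadSet.2 ⟨hLV, hLT⟩⟩, fun a ha => ?_⟩
  have key : ∀ i : κ, ∃ b : A, X.le b.1 a ∧ Agree L (p b).1 i.1 := by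
    intro i
    obtain ⟨j, hj⟩ := hα.coinitial a ha
    obtain ⟨b, hb, hb'⟩ := hsmall j (hα.succ i)
    exact ⟨b, hX.le_trans _ _ _ hb hj, hLag i b hb'⟩
  constructor
  · refine ⟨fun d _ => hX.zero_le d, fun l hl => ?_⟩
    rw [hα.eq_zero hX (a := l) fun i => ?_]
    · exact hX.le_refl _
    · obtain ⟨b, hb, hLb⟩ := key i
      exact hX.le_trans _ _ _ (hl _ ⟨b, hb, rfl⟩) ((treeSpace_dist_le_iff hX).2 hLb)
  · refine ⟨fun d _ => hX.zero_le d, fun l hl => ?_⟩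
    rw [hα.eq_zero hX (a := l) fun i => ?_]
    · exact hX.le_refl _
    · obtain ⟨b, hb, hLb⟩ := key i
      exact hX.le_trans _ _ _ (hl _ ⟨b, hb, rfl⟩) ((treeSpace_dist_le_iff hX).2 hLb.symm)

theorem treeSpace_isDynSys (hX : X.IsDistanceMonoid V) (hXc : X.IsComplete V) (hXV : X.In V)
    (hαV : FunIn V α) : (treeSpace V hα).IsDynSys V :=
  ⟨treeSpace_in hXV hαV, hX, hXc, treeSpace_isMetric hX,
    treeSpace_isCauchyComplete hX hXV hαV, treeSpace_isNonExpanding hX⟩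

end TreeSpace

end FixAbs

/-! ### Passing to a larger model -/

namespace FixAbs

theorem SetIn.mono {V V' S : Set ZFSet.{u}} (hV : V ⊆ V') (h : SetIn V S) : SetIn V' S := by
  obtain ⟨s, hs, h⟩ := h
  exact ⟨s, hV hs, h⟩

@[simp] theorem incl_coe {A B : ZFSet.{u}} (h : A ⊆ B) (a : A) : (incl h a).1 = a.1 := rfl

theorem funIn_incl_comp {V : Set ZFSet.{u}} {A B C : ZFSet.{u}} {f : A → B} (h : B ⊆ C)
    (hf : FunIn V f) : FunIn V (fun a => incl h (f a)) := hf

namespace DistStr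

variable {V : Set ZFSet.{u}} {W X Y : DistStr.{u}}

theorem In.mono {V' : Set ZFSet.{u}} (hV : V ⊆ V') (h : W.In V) : W.In V' :=
  ⟨hV h.1, h.2.1.mono hV, h.2.2.mono hV⟩

/-- By `add_isInf` distributivity holds for all subsets, including those that a larger model adds.
-/
theorem IsDistanceMonoid.of_model {V' : Set ZFSet.{u}} [Fact (IsModelOfSetTheory V)]
    (hW : W.IsDistanceMonoid V) (hWV : W.In V) : W.IsDistanceMonoid V' :=
  { hW with add_inf := fun _ _ b _ hm => hW.add_isInf hWV b hm }

/-! ### Properties of completions -/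

namespace IsCompletion

variable (hc : W.IsCompletion V X)

include hc

theorem le_iff_forall_ge {x y : X.carrier} :
    X.le x y ↔ ∀ w, X.le y (incl hc.sub w) → X.le x (incl hc.sub w) := by
  refine ⟨fun h w hw => hc.isDistanceMonoid.le_trans _ _ _ h hw, fun h => ?_⟩
  refine (hc.meet_dense y).2 x ?_
  rintro _ ⟨w, rfl, hw⟩
  exact h w hw

theorem le_iff_forall_le {x y : X.carrier} :
    X.le x y ↔ ∀ w, X.le (incl hc.sub w) x → X.le (incl hc.sub w) y := by
  refine ⟨fun h w hw => hc.isDistanceMonoid.le_trans _ _ _ hw h, fun h => ?_⟩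
  refine (hc.join_dense x).2 y ?_
  rintro _ ⟨w, rfl, hw⟩
  exact h w hw

theorem incl_le_iff {l : W.carrier} {x : X.carrier} :
    X.le (incl hc.sub l) x ↔ ∀ a, X.le x (incl hc.sub a) → W.le l a := by
  rw [hc.le_iff_forall_ge]
  simp only [hc.le_iff]

/-- By meet-density and distributivity, `x + y` is the infimum of the sums `a + b` of elements of
`W` above `x` and `y`. Addition in a completion is therefore determined by `W`. -/
theorem incl_le_add_iff [Fact (IsModelOfSetTheory V)] (hXV : X.In V) {l : W.carrier}
    {x y : X.carrier} : X.le (incl hc.sub l) (X.add x y) ↔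
      ∀ a b, X.le x (incl hc.sub a) → X.le y (incl hc.sub b) → W.le l (W.add a b) := by
  have hX := hc.isDistanceMonoid
  constructor
  · intro h a b ha hb
    rw [← hc.le_iff, ← hc.add_eq]
    exact hX.le_trans _ _ _ h (hX.add_le_add ha hb)
  · intro h
    have h1 : ∀ a, X.le x (incl hc.sub a) →
        X.le (incl hc.sub l) (X.add (incl hc.sub a) y) := by
      intro a ha
      refine (hX.add_isInf hXV (incl hc.sub a) (hc.meet_dense y)).2 _ ?_
      rintro _ ⟨_, ⟨b, rfl, hb⟩, rfl⟩
      rw [hc.add_eq, hc.le_iff]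
      exact h a b ha hb
    rw [hX.add_comm]
    refine (hX.add_isInf hXV y (hc.meet_dense x)).2 _ ?_
    rintro _ ⟨_, ⟨a, rfl, ha⟩, rfl⟩
    rw [hX.add_comm]
    exact h1 a ha

/-- A monotone map fixing `W` preserves the bounds in `W` from either side, and by density these
determine an element. Every rigidity argument needs this for the distance sort. -/
theorem eq_id_of_monotone {h : X.carrier → X.carrier} (h_le : ∀ a b, X.le a b → X.le (h a) (h b))
    (h_incl : ∀ w, h (incl hc.sub w) = incl hc.sub w) (x : X.carrier) : h x = x := by
  apply hc.isDistanceMonoid.le_antisymm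
  · rw [hc.le_iff_forall_ge]
    intro w hw
    simpa only [h_incl] using h_le _ _ hw
  · rw [hc.le_iff_forall_le]
    intro w hw
    simpa only [h_incl] using h_le _ _ hw

/-- By join-density every non-zero element of `X` is above a non-zero element of `W`, so the
sequence remains coinitial. -/
theorem isScale {κ : ZFSet.{u}} {α : κ → W.carrier} (hα : W.IsScale α) :
    X.IsScale (fun i => incl hc.sub (α i)) where
  isOrdinal := hα.isOrdinal
  zero_mem := hα.zero_mem
  succ_mem := hα.succ_mem
  ne_zero := fun i h => hα.ne_zero i (by
    rw [hc.zero_eq, Subtype.ext_iff] at h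
    exact Subtype.ext h)
  strict := fun i j h => by
    rw [hc.le_iff]
    exact hα.strict i j h
  nice := fun i j h => by
    simp only [hc.add_eq, hc.le_iff]
    exact hα.nice i j h
  coinitial := by
    intro a ha
    have : ∃ w, w ≠ W.zero ∧ X.le (incl hc.sub w) a := by
      by_contra! h
      refine ha (hc.isDistanceMonoid.eq_zero_of_le ((hc.join_dense a).2 _ ?_))
      rintro _ ⟨w, rfl, hw⟩
      by_cases hw0 : w = W.zero
      · rw [hw0, ← hc.zero_eq]
        exact hc.isDistanceMonoid.le_refl _
      · exact absurd hw (h w hw0)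
    obtain ⟨w, hw0, hw⟩ := this
    obtain ⟨i, hi⟩ := hα.coinitial w hw0
    exact ⟨i, hc.isDistanceMonoid.le_trans _ _ _ ((hc.le_iff _ _).2 hi) hw⟩

/-- Take for `y` the infimum in `Y` of the elements of `W` above `x`. No further elements of `W` get
above `y`, because every `l` in `W` below `x` is also below `y` and such `l` are join-dense. -/
theorem exists_corresponding [Fact (IsModelOfSetTheory V)] (hWV : W.In V) (hXV : X.In V)
    (hd : W.IsCompletion V Y) (hYV : Y.In V) (x : X.carrier) :
    ∃ y : Y.carrier, ∀ w, X.le x (incl hc.sub w) ↔ Y.le y (incl hd.sub w) := by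
  have : Fact (W.carrier ∈ V) := ⟨hWV.1⟩
  have : Fact (RelIn V X.le) := ⟨hXV.2.2⟩
  have : Fact (x.1 ∈ V) := ⟨mem_of_mem_mem hXV.1 x.2⟩
  have hS : SubIn V {y | ∃ w, y = incl hd.sub w ∧ X.le x (incl hc.sub w)} := by
    refine subIn_of_def hYV.1 (P := fun y => y ∈ W.carrier ∧ rel X.le x.1 y) inferInstance
      fun y => ?_
    constructor
    · rintro ⟨w, rfl, hw⟩
      exact ⟨w.2, (rel_coe X.le x (incl hc.sub w)).2 hw⟩
    · rintro ⟨hy, hxy⟩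
      exact ⟨⟨y.1, hy⟩, rfl, (rel_coe X.le x (incl hc.sub ⟨y.1, hy⟩)).1 hxy⟩
  obtain ⟨y, hy⟩ := (hd.isComplete _ hS).1
  refine ⟨y, fun w => ⟨fun hw => hy.1 _ ⟨w, rfl, hw⟩, fun hw => ?_⟩⟩
  rw [hc.le_iff_forall_le]
  intro l hl
  rw [hc.le_iff, ← hd.le_iff]
  refine hd.isDistanceMonoid.le_trans _ _ _ (hy.2 _ ?_) hw
  rintro _ ⟨a, rfl, ha⟩
  rw [hd.le_iff, ← hc.le_iff]
  exact hc.isDistanceMonoid.le_trans _ _ _ hl ha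

/-- Any two completions are isomorphic in the model. -/
theorem exists_iso [Fact (IsModelOfSetTheory V)] (hWV : W.In V) (hXV : X.In V)
    (hd : W.IsCompletion V Y) (hYV : Y.In V) : ∃ h : X.carrier → Y.carrier, FunIn V h ∧
    (∀ a b, h (X.add a b) = Y.add (h a) (h b)) ∧ h X.zero = Y.zero ∧
    (∀ a b, X.le a b → Y.le (h a) (h b)) ∧ ∀ w, h (incl hc.sub w) = incl hd.sub w := by
  have : Fact (W.carrier ∈ V) := ⟨hWV.1⟩
  have : Fact (RelIn V X.le) := ⟨hXV.2.2⟩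
  have : Fact (RelIn V Y.le) := ⟨hYV.2.2⟩
  choose h hh using hc.exists_corresponding hWV hXV hd hYV
  have hl : ∀ x w, X.le (incl hc.sub w) x ↔ Y.le (incl hd.sub w) (h x) := by
    intro x w
    rw [hc.incl_le_iff, hd.incl_le_iff]
    simp only [hh]
  have hext : ∀ y y' : Y.carrier,
      (∀ w, Y.le y (incl hd.sub w) ↔ Y.le y' (incl hd.sub w)) → y = y' := by
    intro y y' h
    apply hd.isDistanceMonoid.le_antisymm
    · exact hd.le_iff_forall_ge.2 fun w => (h w).2
    · exact hd.le_iff_forall_ge.2 fun w => (h w).1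
  have hincl : ∀ w, h (incl hc.sub w) = incl hd.sub w := by
    intro w
    apply hext
    intro a
    rw [← hh, hc.le_iff, hd.le_iff]
  refine ⟨h, ?_, ?_, ?_, ?_, hincl⟩
  · refine funIn_of_graph hXV.1 hYV.1
      (P := fun a b => ∀ w, w ∈ W.carrier → (rel X.le a w ↔ rel Y.le b w)) inferInstance
      fun x y => ?_
    constructor
    · rintro rfl w hw
      have := hh x ⟨w, hw⟩
      rwa [← rel_coe X.le, ← rel_coe Y.le] at this
    · intro hP
      apply hext
      intro w
      rw [← hh, ← rel_coe X.le, ← rel_coe Y.le]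
      exact hP w.1 w.2
  · intro a b
    apply hd.isDistanceMonoid.le_antisymm
    · rw [hd.le_iff_forall_le]
      intro w hw
      rw [← hl, hc.incl_le_add_iff hXV] at hw
      rw [hd.incl_le_add_iff hYV]
      simpa only [hh] using hw
    · rw [hd.le_iff_forall_le]
      intro w hw
      rw [hd.incl_le_add_iff hYV] at hw
      rw [← hl, hc.incl_le_add_iff hXV]
      simpa only [hh] using hw
  · rw [hc.zero_eq, hd.zero_eq, hincl]
  · intro a b hab
    rw [hd.le_iff_forall_ge]
    intro w hw
    rw [← hh] at hw ⊢
    exact hc.isDistanceMonoid.le_trans _ _ _ hab hw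

end IsCompletion

/-! ### Existence of the completion -/

section Completion

variable (V W)

/-- The element `a` of `W` is above the (old or new) element `x` of the completion. -/
def cutAbove (x a : ZFSet.{u}) : Prop :=
  a ∈ W.carrier ∧ ((x ∈ W.carrier ∧ rel W.le x a) ∨ (x ∉ W.carrier ∧ a ∈ x))

/-- `x` codes a new element of the completion: apart from the marker `W.carrier` it consists of the
members of a closed upper cut without least element. -/
def IsCut (x : ZFSet.{u}) : Prop :=
  x ⊆ insert W.carrier W.carrier ∧ W.carrier ∈ x ∧
    (∀ c, c ∈ W.carrier → (∀ l, l ∈ W.carrier →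
      (∀ a, a ∈ W.carrier → a ∈ x → rel W.le l a) → rel W.le l c) → c ∈ x) ∧
    ∀ m, m ∈ W.carrier → m ∈ x → ∃ a, a ∈ W.carrier ∧ (a ∈ x ∧ ¬ rel W.le m a)

/-- The elements of the completion. -/
def cutSet : ZFSet.{u} :=
  W.carrier ∪ ZFSet.sep (fun x => x ∈ V ∧ IsCut W x)
    (ZFSet.powerset (insert W.carrier W.carrier))

variable {V W}

theorem mem_cutSet {x : ZFSet.{u}} : x ∈ cutSet V W ↔ x ∈ W.carrier ∨ (x ∈ V ∧ IsCut W x) := by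
  rw [cutSet, ZFSet.mem_union, ZFSet.mem_sep, ZFSet.mem_powerset]
  exact or_congr Iff.rfl ⟨fun h => h.2, fun h => ⟨h.2.1, h⟩⟩

theorem subset_cutSet : W.carrier ⊆ cutSet V W := fun _ h => mem_cutSet.2 (Or.inl h)

/-- By foundation `W.carrier ∈ x` excludes `x ∈ W.carrier`. The marker keeps new elements apart from
old ones, so that `W` is literally a subset of its completion. -/
theorem IsCut.notMem {x : ZFSet.{u}} (h : IsCut W x) : x ∉ W.carrier := fun hx =>
  ZFSet.mem_asymm hx h.2.1

/-- The elements of `W` above `x`. -/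
def upper (x : cutSet V W) : Set W.carrier := {a | cutAbove W x.1 a.1}

/-- `U` contains all upper bounds of its lower bounds. -/
def IsClosedCut (U : Set W.carrier) : Prop :=
  ∀ c, (∀ l, (∀ a ∈ U, W.le l a) → W.le l c) → c ∈ U

theorem mem_upper_incl {w a : W.carrier} :
    a ∈ upper (incl (subset_cutSet (V := V)) w) ↔ W.le w a := by
  simp [upper, cutAbove]

theorem mem_upper_of_isCut {x : cutSet V W} (h : IsCut W x.1) {a : W.carrier} :
    a ∈ upper x ↔ a.1 ∈ x.1 := by
  simp [upper, cutAbove, h.notMem]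

theorem eq_incl_or_isCut (x : cutSet V W) :
    (∃ w, x = incl (subset_cutSet (V := V)) w) ∨ IsCut W x.1 := by
  rcases mem_cutSet.1 x.2 with h | h
  · exact Or.inl ⟨⟨x.1, h⟩, rfl⟩
  · exact Or.inr h.2

theorem isClosedCut_upper (x : cutSet V W) :
    IsClosedCut (upper x) := by
  intro c hc
  rcases eq_incl_or_isCut x with ⟨w, rfl⟩ | h
  · rw [mem_upper_incl]
    exact hc w fun a ha => mem_upper_incl.1 ha
  · rw [mem_upper_of_isCut h]
    refine h.2.2.1 c.1 c.2 fun l hl hla => ?_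
    refine (rel_coe W.le ⟨l, hl⟩ c).2 (hc _ fun a ha => ?_)
    exact (rel_coe W.le ⟨l, hl⟩ a).1 (hla a.1 a.2 ((mem_upper_of_isCut h).1 ha))

theorem IsClosedCut.upward {U : Set W.carrier} (hW : W.IsDistanceMonoid V) (hU : IsClosedCut U)
    {a b : W.carrier} (ha : a ∈ U) (hab : W.le a b) : b ∈ U :=
  hU b fun _ hl => hW.le_trans _ _ _ (hl a ha) hab

/-- The upper set of an old element has a least member and that of a new one has none, so the two
kinds cannot coincide. -/
theorem upper_injective (hW : W.IsDistanceMonoid V) :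
    Function.Injective (upper (V := V) (W := W)) := by
  have mixed : ∀ (w : W.carrier) (y : cutSet V W), IsCut W y.1 →
      upper (incl (subset_cutSet (V := V)) w) ≠ upper y := by
    intro w y hy h
    have hw : w ∈ upper y := h ▸ mem_upper_incl.2 (hW.le_refl w)
    obtain ⟨a, ha, hay, hwa⟩ := hy.2.2.2 w.1 w.2 ((mem_upper_of_isCut hy).1 hw)
    have : (⟨a, ha⟩ : W.carrier) ∈ upper y := (mem_upper_of_isCut hy).2 hay
    rw [← h, mem_upper_incl] at this
    exact hwa ((rel_coe W.le w ⟨a, ha⟩).2 this)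
  intro x y h
  rcases eq_incl_or_isCut x with ⟨w, rfl⟩ | hx <;> rcases eq_incl_or_isCut y with ⟨w', rfl⟩ | hy
  · have h1 : w' ∈ upper (incl (subset_cutSet (V := V)) w) := h ▸ mem_upper_incl.2 (hW.le_refl _)
    have h2 : w ∈ upper (incl (subset_cutSet (V := V)) w') := h ▸ mem_upper_incl.2 (hW.le_refl _)
    rw [hW.le_antisymm _ _ (mem_upper_incl.1 h1) (mem_upper_incl.1 h2)]
  · exact absurd h (mixed w y hy)
  · exact absurd h.symm (mixed w' x hx)
  · apply Subtype.ext
    have aux : ∀ a : W.carrier, a.1 ∈ x.1 ↔ a.1 ∈ y.1 := fun a => by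
      rw [← mem_upper_of_isCut hx, ← mem_upper_of_isCut hy, h]
    ext z
    constructor
    · intro hz
      rcases ZFSet.mem_insert_iff.1 (hx.1 hz) with rfl | hzW
      · exact hy.2.1
      · exact (aux ⟨z, hzW⟩).1 hz
    · intro hz
      rcases ZFSet.mem_insert_iff.1 (hy.1 hz) with rfl | hzW
      · exact hx.2.1
      · exact (aux ⟨z, hzW⟩).2 hz

/-- A closed cut with a least member is represented by that member, any other one by itself with the
marker added. -/
theorem exists_upper_eq [hV : Fact (IsModelOfSetTheory V)] (hWV : W.In V)
    (hW : W.IsDistanceMonoid V) {U : Set W.carrier}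
    (hUV : SubIn V U) (hU : IsClosedCut U) : ∃ x : cutSet V W, upper x = U := by
  by_cases hm : ∃ m ∈ U, ∀ a ∈ U, W.le m a
  · obtain ⟨m, hmU, hm⟩ := hm
    refine ⟨incl subset_cutSet m, ?_⟩
    ext a
    rw [mem_upper_incl]
    exact ⟨fun h => hU.upward hW hmU h, hm a⟩
  · push Not at hm
    obtain ⟨s, hs, hsU⟩ := hUV
    have hmem : ∀ a : W.carrier, a.1 ∈ insert W.carrier s ↔ a ∈ U := by
      intro a
      rw [ZFSet.mem_insert_iff, hsU]
      constructor
      · rintro (h | ⟨b, hb, h⟩)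
        · have ha := a.2
          rw [h] at ha
          exact absurd ha (ZFSet.mem_irrefl _)
        · rwa [Subtype.ext h]
      · exact fun h => Or.inr ⟨a, h, rfl⟩
    have hcut : IsCut W (insert W.carrier s) := by
      refine ⟨?_, ZFSet.mem_insert _ _, ?_, ?_⟩
      · intro z hz
        rcases ZFSet.mem_insert_iff.1 hz with rfl | hz
        · exact ZFSet.mem_insert _ _
        · obtain ⟨a, -, rfl⟩ := (hsU z).1 hz
          exact ZFSet.mem_insert_of_mem _ a.2
      · intro c hc h
        refine (hmem ⟨c, hc⟩).2 (hU _ fun l hl => ?_)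
        rw [← rel_coe W.le]
        refine h l.1 l.2 fun a ha haU => ?_
        exact (rel_coe W.le l ⟨a, ha⟩).2 (hl _ ((hmem ⟨a, ha⟩).1 haU))
      · intro m hmW hmU
        obtain ⟨a, ha, hma⟩ := hm ⟨m, hmW⟩ ((hmem ⟨m, hmW⟩).1 hmU)
        exact ⟨a.1, a.2, (hmem a).2 ha, fun h => hma ((rel_coe W.le ⟨m, hmW⟩ a).1 h)⟩
    refine ⟨⟨insert W.carrier s, mem_cutSet.2 (Or.inr ⟨insert_mem_model hWV.1 hs, hcut⟩)⟩, ?_⟩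
    ext a
    rw [mem_upper_of_isCut hcut, hmem]

section Definability

variable [hV : Fact (IsModelOfSetTheory V)] [Fact (W.carrier ∈ V)] [Fact (RelIn V W.le)]

instance _root_.FixAbs.DefRel.cutAbove {F G : Env V → ZFSet.{u}} [hF : DefFun F]
    [hG : DefFun G] : DefRel (fun v => cutAbove W (F v) (G v)) :=
  DefRel.comp₂ (R := fun x a => DistStr.cutAbove W x a)
    (by unfold DistStr.cutAbove; infer_instance) hF hG

instance _root_.FixAbs.DefRel.isCut {F : Env V → ZFSet.{u}} [hF : DefFun F] :
    DefRel (fun v => IsCut W (F v)) :=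
  DefRel.comp₁ (R := fun x => DistStr.IsCut W x)
    (by unfold DistStr.IsCut; infer_instance) hF

theorem cutSet_mem_model : cutSet V W ∈ V := by
  have hc : W.carrier ∈ V := Fact.out
  have h := union_mem_model hc (sep_mem_model (powerset_mem_model (insert_mem_model hc hc))
    (P := fun x => IsCut W x) inferInstance)
  convert h using 1
  ext x
  rw [mem_cutSet, ZFSet.mem_union, ZFSet.mem_sep, ZFSet.mem_sep, ZFSet.mem_powerset]
  exact or_congr Iff.rfl ⟨fun h => ⟨⟨h.2.1, h.1⟩, h.2⟩, fun h => ⟨h.1.2, h.2⟩⟩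

end Definability

/-- The closed cut of the sum of two elements of the completion. -/
def sumCut (x y : cutSet V W) : Set W.carrier :=
  {c | ∀ l, (∀ a ∈ upper x, ∀ b ∈ upper y, W.le l (W.add a b)) → W.le l c}

theorem mem_sumCut_iff {x y : cutSet V W} {c : W.carrier} : c ∈ sumCut x y ↔
    ∀ l, l ∈ W.carrier → (∀ a, a ∈ W.carrier → ∀ b, b ∈ W.carrier → cutAbove W x.1 a →
      cutAbove W y.1 b → rel W.le l (app₂ W.add a b)) → rel W.le l c.1 := by
  constructor
  · intro h l hl hab
    refine (rel_coe W.le ⟨l, hl⟩ c).2 (h _ fun a ha b hb => ?_)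
    have := hab a.1 a.2 b.1 b.2 ha hb
    rwa [app₂_coe, rel_coe W.le ⟨l, hl⟩] at this
  · intro h l hl
    refine (rel_coe W.le l c).1 (h l.1 l.2 fun a ha b hb hxa hyb => ?_)
    rw [app₂_coe W.add ⟨a, ha⟩ ⟨b, hb⟩, rel_coe]
    exact hl _ hxa _ hyb

theorem exists_add [hV : Fact (IsModelOfSetTheory V)] (hWV : W.In V)
    (hW : W.IsDistanceMonoid V) (x y : cutSet V W) :
    ∃ z : cutSet V W, upper z = sumCut x y := by
  have : Fact (W.carrier ∈ V) := ⟨hWV.1⟩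
  have : Fact (RelIn V W.le) := ⟨hWV.2.2⟩
  have : Fact (Fun₂In V W.add) := ⟨hWV.2.1⟩
  have : Fact (x.1 ∈ V) := ⟨mem_of_mem_mem cutSet_mem_model x.2⟩
  have : Fact (y.1 ∈ V) := ⟨mem_of_mem_mem cutSet_mem_model y.2⟩
  refine exists_upper_eq hWV hW ?_ ?_
  · exact subIn_of_def hWV.1 (P := fun c => ∀ l, l ∈ W.carrier → (∀ a, a ∈ W.carrier →
      ∀ b, b ∈ W.carrier → cutAbove W x.1 a → cutAbove W y.1 b →
      rel W.le l (app₂ W.add a b)) → rel W.le l c) inferInstance fun c => mem_sumCut_iff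
  · intro c hc l hl
    exact hc l fun a ha => ha l hl

/-- The completion of `W` in the model. -/
noncomputable def completion [hV : Fact (IsModelOfSetTheory V)] (hWV : W.In V)
    (hW : W.IsDistanceMonoid V) : DistStr.{u} where
  carrier := cutSet V W
  add x y := (exists_add hWV hW x y).choose
  zero := incl subset_cutSet W.zero
  le x y := upper y ⊆ upper x

variable [hV : Fact (IsModelOfSetTheory V)] {hWV : W.In V} {hW : W.IsDistanceMonoid V}

theorem upper_add (x y : (completion hWV hW).carrier) :
    upper ((completion hWV hW).add x y) = sumCut x y := (exists_add hWV hW x y).choose_spec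

theorem completion_in : (completion hWV hW).In V := by
  have : Fact (W.carrier ∈ V) := ⟨hWV.1⟩
  have : Fact (RelIn V W.le) := ⟨hWV.2.2⟩
  have : Fact (Fun₂In V W.add) := ⟨hWV.2.1⟩
  have hC : cutSet V W ∈ V := cutSet_mem_model
  refine ⟨hC, ?_, ?_⟩
  · refine fun₂In_of_graph hC hC hC (P := fun x y z => ∀ c, c ∈ W.carrier → (cutAbove W z c ↔
      ∀ l, l ∈ W.carrier → (∀ a, a ∈ W.carrier → ∀ b, b ∈ W.carrier → cutAbove W x a →
      cutAbove W y b → rel W.le l (app₂ W.add a b)) → rel W.le l c)) inferInstance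
      fun (x y z : (completion hWV hW).carrier) => ?_
    constructor
    · rintro rfl c hc
      refine Iff.trans ?_ (mem_sumCut_iff (x := x) (y := y) (c := ⟨c, hc⟩))
      rw [← upper_add (hWV := hWV) (hW := hW)]
      exact Iff.rfl
    · intro h
      refine upper_injective hW ?_
      rw [upper_add]
      ext c
      exact (mem_sumCut_iff (x := x) (y := y)).trans (h c.1 c.2).symm
  · refine relIn_of_def hC (P := fun x y => ∀ c, c ∈ W.carrier → cutAbove W y c → cutAbove W x c)
      inferInstance fun x y => ?_
    exact ⟨fun h c hc hyc => h (a := ⟨c, hc⟩) hyc, fun h c hyc => h c.1 c.2 hyc⟩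

theorem completion_incl_le {l : W.carrier} {x : (completion hWV hW).carrier} :
    (completion hWV hW).le (incl subset_cutSet l) x ↔ ∀ a ∈ upper x, W.le l a :=
  ⟨fun h _ ha => mem_upper_incl.1 (h ha), fun h _ ha => mem_upper_incl.2 (h _ ha)⟩

theorem completion_le_incl {x : (completion hWV hW).carrier} {c : W.carrier} :
    (completion hWV hW).le x (incl subset_cutSet c) ↔ c ∈ upper x :=
  ⟨fun h => h (mem_upper_incl.2 (hW.le_refl c)), fun h _ ha =>
    (isClosedCut_upper x).upward hW h (mem_upper_incl.1 ha)⟩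

/-- Upper sets are closed, so lower bounds in `W` determine an element. They are easier to handle
than upper sets, since the upper set of a sum is a closure. -/
theorem completion_le_of_forall {x y : (completion hWV hW).carrier}
    (h : ∀ l, (∀ a ∈ upper x, W.le l a) → ∀ a ∈ upper y, W.le l a) :
    (completion hWV hW).le x y := fun c hc =>
  isClosedCut_upper x c fun l hl => h l hl c hc

theorem completion_incl_le_add {l : W.carrier} {x y : (completion hWV hW).carrier} :
    (∀ c ∈ upper ((completion hWV hW).add x y), W.le l c) ↔
      ∀ a ∈ upper x, ∀ b ∈ upper y, W.le l (W.add a b) := by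
  rw [upper_add]
  constructor
  · exact fun h a ha b hb => h _ fun l' hl' => hl' a ha b hb
  · exact fun h c hc => hc l h

/-- Lower bounds of a translate of a set are lower bounds of the translate of its closure. -/
theorem le_add_of_mem_closure (hWV : W.In V) (hW : W.IsDistanceMonoid V) {S : Set W.carrier}
    {c e l : W.carrier} (hc : ∀ k, (∀ a ∈ S, W.le k a) → W.le k c)
    (hl : ∀ a ∈ S, W.le l (W.add e a)) : W.le l (W.add e c) := by
  by_cases h : ∃ a ∈ S, W.le a c
  · obtain ⟨a, ha, hac⟩ := h
    exact hW.le_trans _ _ _ (hl a ha) (hW.add_le_add_left _ _ _ hac)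
  -- Now `c` is strictly below every member of `S`, so by `hc` it is the infimum of `S` and
  -- distributivity applies.
  · push Not at h
    refine (hW.add_isInf hWV e (A := S) (m := c) ⟨fun a ha => hW.le_of_not_le (h a ha), hc⟩).2 l ?_
    rintro _ ⟨a, ha, rfl⟩
    exact hl a ha

theorem completion_add_comm (x y : (completion hWV hW).carrier) :
    (completion hWV hW).add x y = (completion hWV hW).add y x := by
  refine upper_injective hW ?_
  rw [upper_add, upper_add]
  ext c
  refine forall_congr' fun l => imp_congr_left ⟨fun h a ha b hb => ?_, fun h a ha b hb => ?_⟩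
  · rw [hW.add_comm]
    exact h b hb a ha
  · rw [hW.add_comm]
    exact h b hb a ha

theorem completion_le_antisymm {x y : (completion hWV hW).carrier}
    (h : (completion hWV hW).le x y) (h' : (completion hWV hW).le y x) : x = y :=
  upper_injective hW (Set.Subset.antisymm h' h)

/-- The upper set of `x + y` is the closure of the set of sums `a + b`; `le_add_of_mem_closure`
shows that adding `e` does not see the closure. -/
theorem completion_add_add {l : W.carrier} {x y z : (completion hWV hW).carrier} :
    (∀ c ∈ upper ((completion hWV hW).add ((completion hWV hW).add x y) z), W.le l c) ↔
      ∀ a ∈ upper x, ∀ b ∈ upper y, ∀ e ∈ upper z, W.le l (W.add (W.add a b) e) := by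
  rw [completion_incl_le_add]
  constructor
  · intro h a ha b hb e he
    refine h _ ?_ e he
    rw [upper_add]
    exact fun l' hl' => hl' a ha b hb
  · intro h c hc e he
    rw [hW.add_comm]
    refine le_add_of_mem_closure hWV hW (S := {s | ∃ a ∈ upper x, ∃ b ∈ upper y, s = W.add a b})
      (fun k hk => ?_) ?_
    · rw [upper_add] at hc
      exact hc k fun a ha b hb => hk _ ⟨a, ha, b, hb, rfl⟩
    · rintro _ ⟨a, ha, b, hb, rfl⟩
      rw [hW.add_comm]
      exact h a ha b hb e he

theorem completion_add_assoc_le (x y z : (completion hWV hW).carrier) :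
    (completion hWV hW).le ((completion hWV hW).add ((completion hWV hW).add x y) z)
      ((completion hWV hW).add x ((completion hWV hW).add y z)) := by
  refine completion_le_of_forall fun l hl => ?_
  rw [completion_add_comm x, completion_add_add]
  intro b hb e he a ha
  have := completion_add_add.1 hl a ha b hb e he
  rwa [hW.add_assoc, hW.add_comm] at this

theorem completion_add_inf (A : Set (completion hWV hW).carrier)
    (b m : (completion hWV hW).carrier) (hm : (completion hWV hW).IsInf A m) (l : W.carrier)
    (hl : ∀ a ∈ A, ∀ e ∈ upper b, ∀ c ∈ upper a, W.le l (W.add e c)) :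
    ∀ e ∈ upper b, ∀ c ∈ upper m, W.le l (W.add e c) := by
  intro e he c hc
  refine le_add_of_mem_closure hWV hW (S := {s | ∃ a ∈ A, s ∈ upper a}) (fun k hk => ?_) ?_
  · refine mem_upper_incl.1 (hm.2 (incl subset_cutSet k) (fun a ha => ?_) hc)
    exact completion_incl_le.2 fun s hs => hk s ⟨a, ha, hs⟩
  · rintro s ⟨a, ha, hs⟩
    exact hl a ha e he s hs

theorem completion_isDistanceMonoid : (completion hWV hW).IsDistanceMonoid V where
  add_assoc := by
    intro x y z
    refine completion_le_antisymm (completion_add_assoc_le x y z) ?_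
    -- Commutativity reverses the order of the summands, which turns the other inequality into the
    -- one already proved.
    rw [completion_add_comm x, completion_add_comm y, completion_add_comm _ z,
      completion_add_comm x]
    exact completion_add_assoc_le z y x
  add_comm := completion_add_comm
  zero_add := by
    intro x
    refine upper_injective hW ?_
    rw [upper_add]
    ext c
    constructor
    · intro h
      refine isClosedCut_upper x c fun l hl => h l fun a _ b hb => ?_
      exact hW.le_trans _ _ _ (hl b hb) (hW.le_add_left _ _)
    · intro h l hl
      have := hl W.zero (mem_upper_incl.2 (hW.le_refl _)) c h
      rwa [hW.zero_add] at this
  le_refl := fun _ => Set.Subset.rfl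
  le_trans := fun _ _ _ h h' => Set.Subset.trans h' h
  le_antisymm := fun _ _ => completion_le_antisymm
  le_total := by
    intro x y
    by_cases h : upper y ⊆ upper x
    · exact Or.inl h
    · right
      obtain ⟨a, ha, hax⟩ := Set.not_subset.1 h
      intro b hb
      rcases hW.le_total a b with hab | hba
      · exact (isClosedCut_upper y).upward hW ha hab
      · exact absurd ((isClosedCut_upper x).upward hW hb hba) hax
  zero_le := fun _ _ _ => mem_upper_incl.2 (hW.zero_le _)
  add_le_add_left := by
    intro x y z h
    refine completion_le_of_forall fun l hl => ?_
    rw [completion_incl_le_add] at hl ⊢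
    exact fun a ha b hb => hl a ha b (h hb)
  add_inf := by
    intro A _ b m hm
    refine ⟨?_, fun z hz => ?_⟩
    · rintro _ ⟨a, ha, rfl⟩
      refine completion_le_of_forall fun l hl => ?_
      rw [completion_incl_le_add] at hl ⊢
      exact fun e he c hc => hl e he c (hm.1 a ha hc)
    · refine completion_le_of_forall fun l hl => ?_
      rw [completion_incl_le_add]
      refine completion_add_inf A b m hm l fun a ha => ?_
      rw [← completion_incl_le_add]
      exact fun c hc => hl c (hz _ ⟨a, ha, rfl⟩ hc)

/-- The infimum is the closure of the union of the upper sets and the supremum is their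
intersection; both are definable from `A`. -/
theorem completion_isComplete : (completion hWV hW).IsComplete V := by
  intro A hA
  have : Fact (W.carrier ∈ V) := ⟨hWV.1⟩
  have : Fact (RelIn V W.le) := ⟨hWV.2.2⟩
  have hC : Fact (cutSet V W ∈ V) := ⟨cutSet_mem_model⟩
  have : Fact (SubIn V A) := ⟨hA⟩
  have aux : ∀ {l : ZFSet.{u}} (hl : l ∈ W.carrier), (∀ x, x ∈ cutSet V W → inSub A x →
      ∀ b, b ∈ W.carrier → cutAbove W x b → rel W.le l b) ↔
      ∀ x ∈ A, ∀ b ∈ upper x, W.le ⟨l, hl⟩ b := by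
    intro l hl
    constructor
    · intro h x hx b hb
      exact (rel_coe W.le ⟨l, hl⟩ b).1 (h x.1 x.2 ((inSub_coe A x).2 hx) b.1 b.2 hb)
    · rintro h x hx ⟨hx', hxA⟩ b hb hxb
      exact (rel_coe W.le ⟨l, hl⟩ ⟨b, hb⟩).2 (h ⟨x, hx⟩ hxA ⟨b, hb⟩ hxb)
  constructor
  · obtain ⟨m, hm⟩ := exists_upper_eq hWV hW
      (U := {c | ∀ l, (∀ x ∈ A, ∀ b ∈ upper x, W.le l b) → W.le l c}) (by
        refine subIn_of_def hWV.1 (P := fun c => ∀ l, l ∈ W.carrier → (∀ x, x ∈ cutSet V W →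
          inSub A x → ∀ b, b ∈ W.carrier → cutAbove W x b → rel W.le l b) → rel W.le l c)
          inferInstance fun c => ?_
        constructor
        · intro h l hl hx
          exact (rel_coe W.le ⟨l, hl⟩ c).2 (h _ ((aux hl).1 hx))
        · intro h l hl
          exact (rel_coe W.le l c).1 (h l.1 l.2 ((aux l.2).2 hl)))
      (fun c hc l hl => hc l fun a ha => ha l hl)
    refine ⟨m, fun x hx c hc => ?_, fun z hz c hc => ?_⟩
    · rw [hm]
      exact fun l hl => hl x hx c hc
    · rw [hm] at hc
      exact isClosedCut_upper z c fun l hl => hc l fun x hx b hb => hl b (hz x hx hb)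
  · obtain ⟨m, hm⟩ := exists_upper_eq hWV hW (U := {c | ∀ x ∈ A, c ∈ upper x}) (by
        refine subIn_of_def hWV.1 (P := fun c => ∀ x, x ∈ cutSet V W → inSub A x → cutAbove W x c)
          inferInstance fun c => ?_
        constructor
        · rintro h x hx ⟨hx', hxA⟩
          exact h ⟨x, hx⟩ hxA
        · intro h x hx
          exact h x.1 x.2 ((inSub_coe A x).2 hx))
      (fun c hc x hx => isClosedCut_upper x c fun l hl => hc l fun a ha => hl a (ha x hx))
    refine ⟨m, fun x hx c hc => ?_, fun z hz c hc => ?_⟩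
    · rw [hm] at hc
      exact hc x hx
    · rw [hm]
      exact fun x hx => hz x hx hc

theorem completion_isCompletion : W.IsCompletion V (completion hWV hW) where
  sub := subset_cutSet
  add_eq := by
    intro a b
    refine upper_injective hW ?_
    rw [upper_add]
    ext c
    refine Iff.trans ?_ mem_upper_incl.symm
    constructor
    · exact fun h => h _ fun a' ha b' hb =>
        hW.add_le_add (mem_upper_incl.1 ha) (mem_upper_incl.1 hb)
    · intro h l hl
      exact hW.le_trans _ _ _
        (hl a (mem_upper_incl.2 (hW.le_refl a)) b (mem_upper_incl.2 (hW.le_refl b))) h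
  zero_eq := rfl
  le_iff := fun _ _ => completion_le_incl.trans mem_upper_incl
  isDistanceMonoid := completion_isDistanceMonoid
  isComplete := completion_isComplete
  meet_dense := by
    intro x
    refine ⟨fun y ⟨_, _, h⟩ => h, fun z hz c hc => ?_⟩
    exact completion_le_incl.1 (hz _ ⟨c, rfl, completion_le_incl.2 hc⟩)
  join_dense := by
    intro x
    refine ⟨fun y ⟨_, _, h⟩ => h, fun z hz => completion_le_of_forall fun l hl => ?_⟩
    exact completion_incl_le.1 (hz _ ⟨l, rfl, completion_incl_le.2 hl⟩)

end Completion

end DistStr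

end FixAbs

namespace FixAbs

open DistStr

variable {V : Set ZFSet.{u}} {κ : ZFSet.{u}}

/-! ### A transfinite recursion in a model -/

theorem exists_least_mem {P : ZFSet.{u} → Prop} {k : ZFSet.{u}} (hk : P k) :
    ∃ j, P j ∧ ∀ l ∈ j, ¬ P l := by
  obtain ⟨j, hj, hm⟩ := ZFSet.mem_wf.has_min {j | P j} ⟨k, hk⟩
  exact ⟨j, hj, fun l hl hP => hm l hP hl⟩

/-- `j` exceeds all values of `t` below `i`, and their images under `h`. -/
def Exceeds (h : κ → κ) (t i j : ZFSet.{u}) : Prop :=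
  ∀ a, a ∈ i → ∀ b, b ∈ κ → ZFSet.pair a b ∈ t → b ∈ j ∧ app h b ∈ j

/-- `t` is an initial piece of the sequence whose members are the least ordinals that exceed the
previous members and their images under `h`. -/
def IsAttempt (h : κ → κ) (t : ZFSet.{u}) : Prop :=
  t ⊆ ZFSet.prod κ κ ∧ ∀ i, i ∈ κ → ∀ j, j ∈ κ → ZFSet.pair i j ∈ t →
    ((∀ i', i' ∈ i → ∃ j', j' ∈ κ ∧ ZFSet.pair i' j' ∈ t) ∧
      Exceeds h t i j ∧ ∀ k, k ∈ j → ¬ Exceeds h t i k)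

theorem exceeds_congr {h : κ → κ} {t t' i j : ZFSet.{u}}
    (ht : ∀ i' ∈ i, ∀ j', ZFSet.pair i' j' ∈ t ↔ ZFSet.pair i' j' ∈ t') :
    Exceeds h t i j ↔ Exceeds h t' i j :=
  forall_congr' fun i' => forall_congr' fun hi => forall_congr' fun j' => forall_congr' fun _ => by
    rw [ht i' hi j']

theorem least_unique (hκ : κ.IsOrdinal) {P : ZFSet.{u} → Prop} {j j' : ZFSet.{u}} (hj : j ∈ κ)
    (hj' : j' ∈ κ) (h : P j ∧ ∀ k, k ∈ j → ¬ P k) (h' : P j' ∧ ∀ k, k ∈ j' → ¬ P k) :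
    j = j' := by
  rcases (hκ.mem hj).mem_trichotomous (hκ.mem hj') with hm | hm | hm
  · exact absurd h.1 (h'.2 j hm)
  · exact hm
  · exact absurd h'.1 (h.2 j' hm)

theorem IsAttempt.mem_prod {h : κ → κ} {t i j : ZFSet.{u}} (ht : IsAttempt h t)
    (hij : ZFSet.pair i j ∈ t) : i ∈ κ ∧ j ∈ κ := ZFSet.pair_mem_prod.1 (ht.1 hij)

theorem IsAttempt.unique (hκ : κ.IsOrdinal) {h : κ → κ} {t t' : ZFSet.{u}} (ht : IsAttempt h t)
    (ht' : IsAttempt h t') (i : ZFSet.{u}) : ∀ j j', ZFSet.pair i j ∈ t → ZFSet.pair i j' ∈ t' →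
      j = j' := by
  induction i using ZFSet.inductionOn with
  | _ i ih =>
    intro j j' hj hj'
    obtain ⟨hi, hjκ⟩ := ht.mem_prod hj
    obtain ⟨-, hjκ'⟩ := ht'.mem_prod hj'
    obtain ⟨h1, h2⟩ := ht.2 i hi j hjκ hj
    obtain ⟨h1', h2'⟩ := ht'.2 i hi j' hjκ' hj'
    have hag : ∀ i' ∈ i, ∀ k, ZFSet.pair i' k ∈ t ↔ ZFSet.pair i' k ∈ t' := by
      intro i' hi' k
      obtain ⟨m, -, hm⟩ := h1 i' hi'
      obtain ⟨m', -, hm'⟩ := h1' i' hi'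
      constructor
      · intro hk
        rwa [ih i' hi' k m' hk hm']
      · intro hk
        rwa [← ih i' hi' m k hm hk]
    refine least_unique hκ hjκ hjκ' h2 ?_
    simpa only [exceeds_congr hag] using h2'

section

variable [hV : Fact (IsModelOfSetTheory V)] [hκV : Fact (κ ∈ V)]

instance DefRel.exceeds {h : κ → κ} [Fact (FunIn V h)] {F G H : Env V → ZFSet.{u}}
    [hF : DefFun F] [hG : DefFun G] [hH : DefFun H] :
    DefRel (fun v => Exceeds h (F v) (G v) (H v)) :=
  DefRel.comp₃ (R := fun t i j => Exceeds h t i j) (by unfold Exceeds; infer_instance) hF hG hH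

instance DefRel.isAttempt {h : κ → κ} [Fact (FunIn V h)] {F : Env V → ZFSet.{u}}
    [hF : DefFun F] : DefRel (fun v => IsAttempt h (F v)) :=
  DefRel.comp₁ (R := fun t => IsAttempt h t) (by unfold IsAttempt; infer_instance) hF

/-- Every monotone sequence in `V` of length less than `κ` is bounded in `κ`. -/
def IsRegularIn (V : Set ZFSet.{u}) (κ : ZFSet.{u}) : Prop :=
  ∀ i ∈ κ, ∀ f : i → κ, FunIn V f → (∀ a b : i, a.1 ∈ b.1 → (f a).1 ⊆ (f b).1) →
    ∃ b ∈ κ, ∀ a, (f a).1 ⊆ b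

/-- The union of all attempts in `V` is again an attempt, because any two of them agree wherever
both are defined. -/
theorem exists_maximal_attempt (hκ : κ.IsOrdinal) {h : κ → κ} (hh : FunIn V h) :
    ∃ g ∈ V, IsAttempt h g ∧ ∀ t ∈ V, IsAttempt h t → t ⊆ g := by
  have : Fact (FunIn V h) := ⟨hh⟩
  have : Fact (ZFSet.sep (· ∈ V) (ZFSet.powerset (ZFSet.prod κ κ)) ∈ V) :=
    ⟨powerset_mem_model (prod_mem_model hκV.out hκV.out)⟩
  let g := ZFSet.sep (fun z => ∃ t, t ∈ ZFSet.sep (· ∈ V) (ZFSet.powerset (ZFSet.prod κ κ)) ∧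
    (IsAttempt h t ∧ z ∈ t)) (ZFSet.prod κ κ)
  have hgV : g ∈ V := sep_mem_model (prod_mem_model hκV.out hκV.out) inferInstance
  have hsub : ∀ t ∈ V, IsAttempt h t → t ⊆ g := by
    intro t ht hta z hz
    refine ZFSet.mem_sep.2 ⟨hta.1 hz, t, ZFSet.mem_sep.2 ⟨?_, ht⟩, hta, hz⟩
    exact ZFSet.mem_powerset.2 hta.1
  refine ⟨g, hgV, ⟨ZFSet.sep_subset, ?_⟩, hsub⟩
  intro i hi j hj hij
  obtain ⟨-, t, ht, hta, hijt⟩ := ZFSet.mem_sep.1 hij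
  have htg := hsub t (ZFSet.mem_sep.1 ht).2 hta
  obtain ⟨h1, h2⟩ := hta.2 i hi j hj hijt
  have hag : ∀ i' ∈ i, ∀ k, ZFSet.pair i' k ∈ g ↔ ZFSet.pair i' k ∈ t := by
    intro i' hi' k
    refine ⟨fun hk => ?_, fun hk => htg hk⟩
    obtain ⟨-, t', ht', hta', hkt'⟩ := ZFSet.mem_sep.1 hk
    obtain ⟨m, -, hm⟩ := h1 i' hi'
    rwa [hta'.unique hκ hta i' k m hkt' hm]
  refine ⟨fun i' hi' => ?_, ?_⟩
  · obtain ⟨m, hm, hm'⟩ := h1 i' hi'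
    exact ⟨m, hm, htg hm'⟩
  · simpa only [exceeds_congr hag] using h2

/-- The maximal attempt is total: if all stages below `i` have values, these are increasing and
hence bounded by regularity. Monotonicity of `h` bounds their images, so a least next value exists,
and adding it would contradict maximality if `i` had none. -/
theorem exists_climbing_seq (hκ : κ.IsOrdinal) (hsucc : ∀ i ∈ κ, insert i i ∈ κ)
    (hreg : IsRegularIn V κ) {h : κ → κ} (hh : FunIn V h)
    (hmono : ∀ a b : κ, a.1 ⊆ b.1 → (h a).1 ⊆ (h b).1) :
    ∃ G : κ → κ, FunIn V G ∧
      ∀ i j : κ, i.1 ∈ j.1 → (G i).1 ∈ (G j).1 ∧ (h (G i)).1 ∈ (G j).1 := by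
  have : Fact (FunIn V h) := ⟨hh⟩
  obtain ⟨g, hgV, hg, hmax⟩ := exists_maximal_attempt hκ hh
  have : Fact (g ∈ V) := ⟨hgV⟩
  have huniq := hg.unique hκ hg
  have hval : ∀ {i j i' j'}, ZFSet.pair i j ∈ g → ZFSet.pair i' j' ∈ g → i' ∈ i →
      j' ∈ j ∧ app h j' ∈ j := by
    intro i j i' j' hij hij' hi'
    obtain ⟨hi, hj⟩ := hg.mem_prod hij
    exact (hg.2 i hi j hj hij).2.1 i' hi' j' (hg.mem_prod hij').2 hij'
  have htotal : ∀ i : ZFSet.{u}, i ∈ κ → ∃ j, j ∈ κ ∧ ZFSet.pair i j ∈ g := by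
    intro i
    induction i using ZFSet.inductionOn with
    | _ i ih =>
      intro hi
      by_contra hno
      have hio := hκ.mem hi
      have ih' : ∀ a : i, ∃ j : κ, ZFSet.pair a.1 j.1 ∈ g := fun a => by
        obtain ⟨j, hj, h⟩ := ih a.1 a.2 (hκ.mem_trans a.2 hi)
        exact ⟨⟨j, hj⟩, h⟩
      choose f hf using ih'
      have hfV : FunIn V f := by
        refine funIn_of_graph (mem_of_mem_mem hκV.out hi) hκV.out
          (P := fun a b => ZFSet.pair a b ∈ g) inferInstance fun a b => ⟨?_, fun hab => ?_⟩
        · rintro rfl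
          exact hf a
        · exact Subtype.ext (huniq a.1 _ _ (hf a) hab)
      obtain ⟨b, hb, hfb⟩ := hreg i hi f hfV fun a a' haa' =>
        (hκ.mem (f a').2).subset_of_mem (hval (hf a') (hf a) haa').1
      obtain ⟨m, hm, hbm, hhm⟩ : ∃ m ∈ κ, b ⊆ m ∧ (h ⟨b, hb⟩).1 ⊆ m := by
        rcases (hκ.mem hb).subset_total (hκ.mem (h ⟨b, hb⟩).2) with hle | hle
        · exact ⟨_, (h ⟨b, hb⟩).2, hle, fun _ => id⟩
        · exact ⟨b, hb, fun _ => id, hle⟩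
      have hmo := hκ.mem hm
      have hlt : ∀ {j}, j ∈ κ → j ⊆ m → j ∈ insert m m := fun {j} hj hjm =>
        (hκ.mem hj).mem_of_subset_of_mem (ZFSet.isOrdinal_succ hmo) hjm (ZFSet.mem_insert _ _)
      have hex : insert m m ∈ κ ∧ Exceeds h g i (insert m m) := by
        refine ⟨hsucc m hm, fun i' hi' j' hj' hij' => ?_⟩
        have hj'b : j' ⊆ b := by
          rw [huniq i' j' _ hij' (hf ⟨i', hi'⟩)]
          exact hfb _
        refine ⟨hlt hj' fun z hz => hbm (hj'b hz), ?_⟩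
        rw [app_of_mem h hj']
        exact hlt (h _).2 fun z hz => hhm (hmono ⟨j', hj'⟩ ⟨b, hb⟩ hj'b hz)
      obtain ⟨j, ⟨hj, hje⟩, hjl⟩ :=
        exists_least_mem (P := fun j => j ∈ κ ∧ Exceeds h g i j) hex
      have hins : ∀ {a k}, ZFSet.pair a k ∈ insert (ZFSet.pair i j) g ↔
          (a = i ∧ k = j) ∨ ZFSet.pair a k ∈ g := by
        intro a k
        rw [ZFSet.mem_insert_iff, ZFSet.pair_inj]
      -- The stages of `g` are closed downwards and omit `i`, so a new pair at `i` does not affect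
      -- the conditions at old stages.
      have hne : ∀ {a c k}, c ∈ insert i κ → (c = i ∨ ZFSet.pair c k ∈ g) → a ∈ c → a ≠ i := by
        rintro a c k - (rfl | hc) hac rfl
        · exact ZFSet.mem_irrefl _ hac
        · obtain ⟨hcκ, hkκ⟩ := hg.mem_prod hc
          exact hno ((hg.2 c hcκ k hkκ hc).1 a hac)
      have hag : ∀ {c k}, c ∈ κ → (c = i ∨ ZFSet.pair c k ∈ g) → ∀ a ∈ c, ∀ l,
          ZFSet.pair a l ∈ insert (ZFSet.pair i j) g ↔ ZFSet.pair a l ∈ g := by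
        intro c k hc hck a hac l
        rw [hins]
        exact ⟨fun h => h.resolve_left fun h' =>
          hne (ZFSet.mem_insert_of_mem _ hc) hck hac h'.1, Or.inr⟩
      have hatt : IsAttempt h (insert (ZFSet.pair i j) g) := by
        refine ⟨?_, ?_⟩
        · intro z hz
          rcases ZFSet.mem_insert_iff.1 hz with rfl | hz
          · exact ZFSet.pair_mem_prod.2 ⟨hi, hj⟩
          · exact hg.1 hz
        · intro c hc k hk hck
          rcases hins.1 hck with ⟨rfl, rfl⟩ | hck
          · refine ⟨fun a ha => ?_, ?_, fun l hl => ?_⟩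
            · exact ⟨f ⟨a, ha⟩, (f _).2, hins.2 (Or.inr (hf ⟨a, ha⟩))⟩
            · rwa [exceeds_congr (hag (k := k) hc (Or.inl rfl))]
            · rw [exceeds_congr (hag (k := k) hc (Or.inl rfl))]
              exact fun h' => hjl l hl ⟨hκ.mem_trans hl hj, h'⟩
          · obtain ⟨h1, h2⟩ := hg.2 c hc k hk hck
            refine ⟨fun a ha => ?_, ?_⟩
            · obtain ⟨l, hl, hal⟩ := h1 a ha
              exact ⟨l, hl, hins.2 (Or.inr hal)⟩
            · simpa only [exceeds_congr (hag hc (Or.inr hck))] using h2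
      refine hno ⟨j, hj, hmax _ (insert_mem_model (pair_mem_model ?_ ?_) hgV) hatt
        (ZFSet.mem_insert _ _)⟩
      · exact mem_of_mem_mem hκV.out hi
      · exact mem_of_mem_mem hκV.out hj
  have htotal' : ∀ i : κ, ∃ j : κ, ZFSet.pair i.1 j.1 ∈ g := fun i => by
    obtain ⟨j, hj, h⟩ := htotal i.1 i.2
    exact ⟨⟨j, hj⟩, h⟩
  choose G hG using htotal'
  refine ⟨G, ?_, fun i j hij => ?_⟩
  · refine funIn_of_graph hκV.out hκV.out (P := fun a b => ZFSet.pair a b ∈ g) inferInstance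
      fun a b => ⟨?_, fun hab => ?_⟩
    · rintro rfl
      exact hG a
    · exact Subtype.ext (huniq a.1 _ _ (hG a) hab)
  · have := hval (hG j) (hG i) hij
    rwa [app_coe] at this

/-- A regular uncountable length has no thread of full length in the model. -/
theorem IsThread.dom_ne (hκ : κ.IsOrdinal) (hsucc : ∀ i ∈ κ, insert i i ∈ κ)
    (hω : ZFSet.omega ∈ κ) (hreg : IsRegularIn V κ) {x : ZFSet.{u}} (hxV : x ∈ V)
    (hx : IsThread κ x) : dom κ x ≠ κ := by
  intro hd
  have : Fact (x ∈ V) := ⟨hxV⟩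
  have hex : ∀ γ : κ, ∃ v : κ, ZFSet.pair γ.1 v.1 ∈ x := by
    intro γ
    obtain ⟨v, hv⟩ := hx.mem_dom.1 (hd.symm ▸ γ.2 : γ.1 ∈ dom κ x)
    exact ⟨⟨v, hx.mem_right hv⟩, hv⟩
  choose h hh using hex
  have hhV : FunIn V h := by
    refine funIn_of_graph hκV.out hκV.out (P := fun a b => ZFSet.pair a b ∈ x) inferInstance
      fun a b => ⟨?_, fun hab => ?_⟩
    · rintro rfl
      exact hh a
    · exact Subtype.ext (hx.func (hh a) hab)
  have hmono : ∀ a b : κ, a.1 ⊆ b.1 → (h a).1 ⊆ (h b).1 := by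
    intro a b hab
    have hbo := hκ.mem b.2
    have hvo := hκ.mem (h b).2
    rcases ((hκ.mem a.2).subset_iff_eq_or_mem hbo).1 hab with he | hm
    · rw [Subtype.ext he]
    · rcases hbo.mem_or_subset (hκ.mem (h a).2) with h1 | h1
      · rw [hx.const (hh a) (hh b) hm h1]
      · exact fun z hz => hvo.mem_trans (h1 hz) (hx.lt (hh b))
  obtain ⟨G, -, hG⟩ := exists_climbing_seq hκ hsucc hreg hhV hmono
  have hωκ : ∀ {n}, n ∈ ZFSet.omega → n ∈ κ := fun hn => hκ.mem_trans hn hω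
  -- `l` is the supremum of the `G n` for `n ∈ ω`, bounded by `G ω`. Every `h (G n)` lies in `l`, so
  -- no promise made below `l` covers `l`, contrary to the limit condition.
  let l : ZFSet.{u} := ZFSet.sep (fun γ => ∃ n : κ, n.1 ∈ ZFSet.omega ∧ γ ∈ (G n).1) κ
  have hl : ∀ {n : κ} {γ : ZFSet.{u}}, n.1 ∈ ZFSet.omega → γ ∈ (G n).1 → γ ∈ l := fun {n γ} hn hγ =>
    ZFSet.mem_sep.2 ⟨hκ.mem_trans hγ (G n).2, n, hn, hγ⟩
  have hnext : ∀ {n : κ}, n.1 ∈ ZFSet.omega → (h (G n)).1 ∈ l ∧ (G n).1 ∈ l := by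
    intro n hn
    have hs := ZFSet.omega_succ hn
    have := hG n ⟨_, hωκ hs⟩ (ZFSet.mem_insert _ _)
    exact ⟨hl (n := ⟨_, hωκ hs⟩) hs this.2, hl (n := ⟨_, hωκ hs⟩) hs this.1⟩
  have hlo : l.IsOrdinal := by
    rw [ZFSet.isOrdinal_iff_forall_mem_isOrdinal]
    refine ⟨fun γ hγ δ hδ => ?_, fun γ hγ => hκ.mem (ZFSet.mem_sep.1 hγ).1⟩
    obtain ⟨-, n, hn, hγn⟩ := ZFSet.mem_sep.1 hγ
    exact hl hn ((hκ.mem (G n).2).mem_trans hδ hγn)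
  have hlκ : l ∈ κ := by
    refine hlo.mem_of_subset_of_mem hκ (fun γ hγ => ?_) (G ⟨_, hω⟩).2
    obtain ⟨-, n, hn, hγn⟩ := ZFSet.mem_sep.1 hγ
    exact (hκ.mem (G ⟨_, hω⟩).2).mem_trans hγn (hG n ⟨_, hω⟩ hn).1
  have hl0 : l ≠ ∅ := fun h0 => ZFSet.notMem_empty _
    (h0 ▸ (hnext (n := ⟨∅, hωκ ZFSet.omega_zero⟩) ZFSet.omega_zero).2)
  obtain ⟨γ, hγ, v, hv, hlv⟩ := hx.lim l hlκ hl0 fun δ hδ =>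
    ⟨_, hh ⟨δ, (ZFSet.mem_sep.1 hδ).1⟩⟩
  obtain ⟨hγκ, n, hn, hγn⟩ := ZFSet.mem_sep.1 hγ
  have h1 := hmono ⟨γ, hγκ⟩ (G n) ((hκ.mem (G n).2).subset_of_mem hγn)
  rw [← hx.func hv (hh ⟨γ, hγκ⟩)] at h1
  exact ZFSet.mem_irrefl _ (h1 (hlv (hnext hn).1))

end

/-! ### The coinitiality of a continuous distance monoid -/

section Coinitiality

variable {W : DistStr.{u}}

theorem DistStr.IsContinuousAtZero.exists_half (hW : W.IsDistanceMonoid V)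
    (hc : W.IsContinuousAtZero) {ε : W.carrier} (hε : ε ≠ W.zero) :
    ∃ c, c ≠ W.zero ∧ ¬ W.le ε (W.add c c) := by
  by_contra! h
  refine hε (hW.eq_zero_of_le (hc.2 ε ?_))
  rintro _ ⟨a, b, ha, hb, rfl⟩
  rcases hW.le_total a b with hab | hab
  · exact hW.le_trans _ _ _ (h a ha) (hW.add_le_add_left _ _ _ hab)
  · exact hW.le_trans _ _ _ (h b hb) (hW.add_le_add hab (hW.le_refl b))

/-- Halve twice. The strict inequality is recorded because the scale must be strictly decreasing. -/
theorem DistStr.IsContinuousAtZero.exists_quarter (hW : W.IsDistanceMonoid V)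
    (hc : W.IsContinuousAtZero) {ε : W.carrier} (hε : ε ≠ W.zero) :
    ∃ c, c ≠ W.zero ∧ W.le (W.add (W.add c c) (W.add c c)) ε ∧ ¬ W.le ε c := by
  obtain ⟨a, ha, haε⟩ := hc.exists_half hW hε
  obtain ⟨c, hc0, hca⟩ := hc.exists_half hW ha
  have h1 := hW.le_of_not_le hca
  refine ⟨c, hc0, hW.le_trans _ _ _ (hW.add_le_add h1 h1) (hW.le_of_not_le haε), fun h => haε ?_⟩
  refine hW.le_trans _ _ _ h (hW.le_trans _ _ _ (hW.le_add_right c c) ?_)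
  exact hW.le_trans _ _ _ h1 (hW.le_add_right a a)

variable [hV : Fact (IsModelOfSetTheory V)]

namespace DistStr.IsCoinitiality

/-- An unbounded monotone map from `i ∈ κ`, composed with the initial sequence, would be an initial
sequence of length `i`, against the minimality of `κ`. -/
theorem isRegularIn (hWV : W.In V) (hW : W.IsDistanceMonoid V) (hκ : W.IsCoinitiality V κ) :
    IsRegularIn V κ := by
  obtain ⟨⟨hκo, s, hsV, hs0, hsa, hsc⟩, hmin⟩ := hκ
  intro i hi f hfV hf
  by_contra! h
  have hio := hκo.mem hi
  have hiκ : κ ⊆ i := by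
    refine hmin i hio ⟨fun a => s (f a), ?_, fun a => hs0 _, fun a b hab => ?_, fun w hw => ?_⟩
    · have : Fact (FunIn V f) := ⟨hfV⟩
      have : Fact (FunIn V s) := ⟨hsV⟩
      exact funIn_of_def hfV.dom_mem hWV.1 (F := fun a => app s (app f a)) inferInstance
        fun a => by rw [app_coe, app_coe]
    · refine hsa _ _ ?_
      rcases ((hio.mem a.2).subset_iff_eq_or_mem (hio.mem b.2)).1 hab with he | hm
      · rw [Subtype.ext he]
      · exact hf a b hm
    · obtain ⟨j, hj⟩ := hsc w hw
      obtain ⟨a, ha⟩ := h j.1 j.2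
      have hja := ((hκo.mem (f a).2).not_subset_iff_mem (hκo.mem j.2)).1 ha
      exact ⟨a, hW.le_trans _ _ _ (hsa j (f a) ((hκo.mem (f a).2).subset_of_mem hja)) hj⟩
  exact ZFSet.mem_irrefl _ (hiκ hi)

/-- If `κ` had a last element `i`, then `s i` would be the least non-zero distance, and a sequence
of length `{∅} = 1` would be initial. -/
theorem succ_mem (hWV : W.In V) (hW : W.IsDistanceMonoid V) (hκ : W.IsCoinitiality V κ)
    (hω : ZFSet.omega ∈ κ) : ∀ i ∈ κ, insert i i ∈ κ := by
  obtain ⟨⟨hκo, s, hsV, hs0, hsa, hsc⟩, hmin⟩ := hκ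
  intro i hi
  have hio := hκo.mem hi
  by_contra hno
  have hκi : κ ⊆ insert i i := ((ZFSet.isOrdinal_succ hio).notMem_iff_subset hκo).1 hno
  have h1 : ({∅} : ZFSet.{u}).IsOrdinal := by
    have := ZFSet.isOrdinal_succ ZFSet.isOrdinal_empty.{u}
    rwa [ZFSet.insert_eq, show ({∅} : ZFSet.{u}) ∪ ∅ = {∅} by ext; simp] at this
  have h2 := hmin {∅} h1 ⟨fun _ => s ⟨i, hi⟩, ?_, fun _ => hs0 _, fun _ _ _ => hW.le_refl _,
    fun w hw => ?_⟩
  · have := ZFSet.mem_singleton.1 (h2 hω)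
    exact ZFSet.notMem_empty ∅ (this ▸ ZFSet.omega_zero)
  · have : Fact ((s ⟨i, hi⟩).1 ∈ V) := ⟨mem_of_mem_mem hWV.1 (s ⟨i, hi⟩).2⟩
    exact funIn_of_def (singleton_mem_model empty_mem_model) hWV.1
      (F := fun _ => (s ⟨i, hi⟩).1) inferInstance fun _ => rfl
  · obtain ⟨j, hj⟩ := hsc w hw
    refine ⟨⟨∅, ZFSet.mem_singleton.2 rfl⟩, hW.le_trans _ _ _ (hsa j ⟨i, hi⟩ ?_) hj⟩
    rcases ZFSet.mem_insert_iff.1 (hκi j.2) with he | hm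
    · rw [he]
    · exact hio.subset_of_mem hm

/-- A continuous distance monoid of uncountable coinitiality has a scale. -/
theorem exists_isScale (hWV : W.In V) (hW : W.IsContinuous V) (hκ : W.IsCoinitiality V κ)
    (hω : ZFSet.omega ∈ κ) : ∃ α : κ → W.carrier, FunIn V α ∧ W.IsScale α := by
  have hreg := hκ.isRegularIn hWV hW.1
  have hsucc := hκ.succ_mem hWV hW.1 hω
  obtain ⟨⟨hκo, s, hsV, hs0, hsa, hsc⟩, -⟩ := hκ
  obtain ⟨hW, -, hc⟩ := hW
  have hκV : Fact (κ ∈ V) := ⟨hsV.dom_mem⟩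
  have : Fact (FunIn V s) := ⟨hsV⟩
  have : Fact (RelIn V W.le) := ⟨hWV.2.2⟩
  have : Fact (Fun₂In V W.add) := ⟨hWV.2.1⟩
  -- `good j k` says that one may pass from `s j` to `s k` in a nice, strictly decreasing sequence.
  -- With `h j` the least good successor of `j`, a sequence `G` climbing faster than `h` makes `s ∘
  -- G` a scale.
  let good : κ → κ → Prop := fun j k =>
    W.le (W.add (W.add (s k) (s k)) (W.add (s k) (s k))) (s j) ∧ ¬ W.le (s j) (s k)
  have good_right : ∀ {j k k' : κ}, good j k → k.1 ⊆ k'.1 → good j k' := by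
    intro j k k' h hkk'
    have := hsa k k' hkk'
    exact ⟨hW.le_trans _ _ _
      (hW.add_le_add (hW.add_le_add this this) (hW.add_le_add this this)) h.1,
      fun h' => h.2 (hW.le_trans _ _ _ h' this)⟩
  have good_left : ∀ {j j' k : κ}, good j k → j'.1 ⊆ j.1 → good j' k := by
    intro j j' k h hjj'
    have := hsa j' j hjj'
    exact ⟨hW.le_trans _ _ _ h.1 this, fun h' => h.2 (hW.le_trans _ _ _ this h')⟩
  have hex : ∀ j : κ, ∃ k : κ, good j k ∧ ∀ l : κ, l.1 ∈ k.1 → ¬ good j l := by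
    intro j
    obtain ⟨c, hc0, hc4, hcj⟩ := hc.exists_quarter hW (hs0 j)
    obtain ⟨k, hk⟩ := hsc c hc0
    have hgood : good j k := ⟨hW.le_trans _ _ _ (hW.add_le_add (hW.add_le_add hk hk)
      (hW.add_le_add hk hk)) hc4, fun h => hcj (hW.le_trans _ _ _ h hk)⟩
    obtain ⟨m, ⟨hm, hgm⟩, hl⟩ :=
      exists_least_mem (P := fun m => ∃ hm : m ∈ κ, good j ⟨m, hm⟩) ⟨k.2, hgood⟩
    exact ⟨⟨m, hm⟩, hgm, fun l hlm hgl => hl l.1 hlm ⟨l.2, hgl⟩⟩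
  choose h hh hhl using hex
  have hle : ∀ {j k : κ}, good j k → (h j).1 ⊆ k.1 := by
    intro j k hjk
    rw [← (hκo.mem k.2).notMem_iff_subset (hκo.mem (h j).2)]
    exact fun hm => hhl j k hm hjk
  have hhV : FunIn V h := by
    let P : ZFSet.{u} → ZFSet.{u} → Prop := fun j k =>
      rel W.le (app₂ W.add (app₂ W.add (app s k) (app s k)) (app₂ W.add (app s k) (app s k)))
        (app s j) ∧ ¬ rel W.le (app s j) (app s k)
    have hP : ∀ j k : κ, P j.1 k.1 ↔ good j k := fun j k => by
      simp only [P, good, app_coe, app₂_coe, rel_coe]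
    refine funIn_of_graph hκV.out hκV.out (P := fun j k => P j k ∧ ∀ l, l ∈ k → ¬ P j l)
      (by unfold P; infer_instance) fun j k => ?_
    constructor
    · rintro rfl
      refine ⟨(hP _ _).2 (hh j), fun l hl hPl => ?_⟩
      have hlκ := hκo.mem_trans hl (h j).2
      exact hhl j ⟨l, hlκ⟩ hl ((hP j ⟨l, hlκ⟩).1 hPl)
    · rintro ⟨h1, h2⟩
      apply Subtype.ext
      refine (((hκo.mem (h j).2).subset_iff_eq_or_mem (hκo.mem k.2)).1
        (hle ((hP _ _).1 h1))).resolve_right fun hm => h2 _ hm ((hP j (h j)).2 (hh j))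
  obtain ⟨G, hGV, hG⟩ := exists_climbing_seq hκo hsucc hreg hhV fun a b hab =>
    hle (good_left (hh b) hab)
  have hgoodG : ∀ i j : κ, i.1 ∈ j.1 → good (G i) (G j) := fun i j hij =>
    good_right (hh (G i)) ((hκo.mem (G j).2).subset_of_mem (hG i j hij).2)
  -- A strictly increasing map of ordinals lies above the identity, so `s ∘ G` is still coinitial.
  have hsub : ∀ (i : ZFSet.{u}) (hi : i ∈ κ), i ⊆ (G ⟨i, hi⟩).1 := by
    intro i
    induction i using ZFSet.inductionOn with
    | _ i ih =>
      intro hi z hz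
      have hzκ := hκo.mem_trans hz hi
      exact (hκo.mem hzκ).mem_of_subset_of_mem (hκo.mem (G ⟨i, hi⟩).2) (ih z hz hzκ)
        (hG ⟨z, hzκ⟩ ⟨i, hi⟩ hz).1
  refine ⟨fun i => s (G i), ?_, hκo, ?_, hsucc, fun i => hs0 _, fun i j hij => (hgoodG i j hij).2,
    fun i j hij => (hgoodG i j (hij ▸ ZFSet.mem_insert _ _)).1, fun a ha => ?_⟩
  · have : Fact (FunIn V G) := ⟨hGV⟩
    exact funIn_of_def hκV.out hWV.1 (F := fun a => app s (app G a)) inferInstance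
      fun a => by rw [app_coe, app_coe]
  · exact hκo.mem_trans ZFSet.omega_zero hω
  · obtain ⟨i, hi⟩ := hsc a ha
    exact ⟨i, hW.le_trans _ _ _ (hsa i (G i) (hsub i.1 i.2)) hi⟩

end DistStr.IsCoinitiality

end Coinitiality

/-! ### A thread of full length from a cofinal sequence of type `ω` -/

theorem omega_induction {P : ZFSet.{u} → Prop} (h0 : P ∅) (hs : ∀ n, P n → P (insert n n)) :
    ∀ n ∈ ZFSet.omega, P n := by
  have h : ∀ k : ℕ, P (ZFSet.mk (PSet.ofNat k)) := fun k => by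
    induction k with
    | zero => exact h0
    | succ k ih => exact hs _ ih
  intro n
  refine Quotient.inductionOn n ?_
  rintro x ⟨⟨k⟩, hk⟩
  change P (ZFSet.mk x)
  rw [ZFSet.eq.2 hk]
  exact h k

/-- Promise at `γ` the value `g n` for the first `n` with `γ ∈ g n`. The sequence `g` need not be
monotone. -/
theorem exists_full_thread [hV : Fact (IsModelOfSetTheory V)] [hκV : Fact (κ ∈ V)]
    (hκ : κ.IsOrdinal) (hsucc : ∀ i ∈ κ, insert i i ∈ κ) (hω : ZFSet.omega ∈ κ)
    {g : ↥(ZFSet.omega.{u}) → κ} (hgV : FunIn V g)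
    (hg : ∀ i : κ, ∃ j : ↥(ZFSet.omega.{u}), i.1 ⊆ (g j).1) :
    ∃ x ∈ V, IsThread κ x ∧ dom κ x = κ := by
  have hωo := hκ.mem hω
  have : Fact (FunIn V g) := ⟨hgV⟩
  have : Fact (ZFSet.omega ∈ V) := ⟨mem_of_mem_mem hκV.out hω⟩
  let first : ZFSet.{u} → ZFSet.{u} → Prop := fun γ n =>
    n ∈ ZFSet.omega ∧ γ ∈ app g n ∧ ∀ m, m ∈ n → γ ∉ app g m
  have hgκ : ∀ {n}, n ∈ ZFSet.omega → app g n ∈ κ := fun hn => by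
    rw [app_of_mem g hn]
    exact (g _).2
  have hfirst : ∀ γ ∈ κ, ∃ n, first γ n := by
    intro γ hγ
    obtain ⟨j, hj⟩ := hg ⟨_, hsucc γ hγ⟩
    obtain ⟨n, ⟨hn, hγn⟩, hl⟩ := exists_least_mem
      (P := fun n => n ∈ ZFSet.omega ∧ γ ∈ app g n) (k := j.1)
      ⟨j.2, by rw [app_coe]; exact hj (ZFSet.mem_insert _ _)⟩
    exact ⟨n, hn, hγn, fun m hm h => hl m hm ⟨hωo.mem_trans hm hn, h⟩⟩
  have hfu : ∀ {γ n n'}, first γ n → first γ n' → n = n' := by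
    intro γ n n' h h'
    rcases (hωo.mem h.1).mem_trichotomous (hωo.mem h'.1) with hm | hm | hm
    · exact absurd h.2.1 (h'.2.2 n hm)
    · exact hm
    · exact absurd h'.2.1 (h.2.2 n' hm)
  let x : ZFSet.{u} := ZFSet.sep (fun z => ∃ γ, γ ∈ κ ∧ ∃ n, n ∈ ZFSet.omega ∧
    (z = ZFSet.pair γ (app g n) ∧ first γ n)) (ZFSet.prod κ κ)
  have hxV : x ∈ V := sep_mem_model (prod_mem_model hκV.out hκV.out)
    (by unfold first; infer_instance)
  have hx : ∀ {γ v}, ZFSet.pair γ v ∈ x ↔ γ ∈ κ ∧ ∃ n, first γ n ∧ v = app g n := by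
    intro γ v
    rw [ZFSet.mem_sep, ZFSet.pair_mem_prod]
    constructor
    · rintro ⟨-, γ', hγ', n, -, he, hf⟩
      obtain ⟨rfl, rfl⟩ := ZFSet.pair_inj.1 he
      exact ⟨hγ', n, hf, rfl⟩
    · rintro ⟨hγ, n, hf, rfl⟩
      exact ⟨⟨hγ, hgκ hf.1⟩, γ, hγ, n, hf.1, rfl, hf⟩
  have hdefd : ∀ γ ∈ κ, ∃ v, ZFSet.pair γ v ∈ x := fun γ hγ => by
    obtain ⟨n, hn⟩ := hfirst γ hγ
    exact ⟨_, hx.2 ⟨hγ, n, hn, rfl⟩⟩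
  have hthread : IsThread κ x := by
    refine ⟨ZFSet.sep_subset, ?_, ?_, ?_, ?_, ?_⟩
    · intro γ v v' h h'
      obtain ⟨-, n, hn, rfl⟩ := hx.1 h
      obtain ⟨-, n', hn', rfl⟩ := hx.1 h'
      rw [hfu hn hn']
    · intro γ v δ h hδ
      exact hdefd δ (hκ.mem_trans hδ (hx.1 h).1)
    · intro γ v h
      obtain ⟨-, n, hn, rfl⟩ := hx.1 h
      exact hn.2.1
    · intro γ v δ v' h h' hγδ hδv
      obtain ⟨-, n, hn, rfl⟩ := hx.1 h
      obtain ⟨-, n', hn', rfl⟩ := hx.1 h'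
      have : first δ n := ⟨hn.1, hδv, fun m hm hδm => hn.2.2 m hm
        ((hκ.mem (hgκ (hωo.mem_trans hm hn.1))).mem_trans hγδ hδm)⟩
      rw [hfu hn' this]
    · intro l hl h0 _
      by_contra! hno
      have hlo := hκ.mem hl
      -- If no promise covers `l`, all promises made below `l` stay below `l`. Moving from a stage
      -- to its promise escapes one more `g k` each time, so some `γ ∈ l` escapes `g m`, although `l
      -- ∈ g m`.
      have hlt : ∀ {γ n}, γ ∈ l → first γ n → app g n ∈ l := by
        intro γ n hγ hn
        have := hno γ hγ _ (hx.2 ⟨hκ.mem_trans hγ hl, n, hn, rfl⟩)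
        exact (hlo.not_subset_iff_mem (hκ.mem (hgκ hn.1))).1 this
      obtain ⟨m, hm⟩ := hfirst l hl
      obtain ⟨γ₀, hγ₀⟩ : ∃ γ, γ ∈ l := by
        by_contra! h
        exact h0 ((ZFSet.eq_empty l).2 h)
      have key : ∀ n ∈ ZFSet.omega.{u}, n ∈ ZFSet.omega → ∃ γ ∈ l, ∀ k ∈ n, γ ∉ app g k := by
        refine omega_induction (fun _ => ⟨γ₀, hγ₀, fun k hk => absurd hk (ZFSet.notMem_empty k)⟩) ?_
        intro n ih hn
        have hn := hωo.mem_trans (ZFSet.mem_insert n n) hn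
        obtain ⟨γ, hγ, hγn⟩ := ih hn
        obtain ⟨q, hq⟩ := hfirst γ (hκ.mem_trans hγ hl)
        have hnq : n ⊆ q := ((hωo.mem hq.1).notMem_iff_subset (hωo.mem hn)).1
          fun h => hγn q h hq.2.1
        refine ⟨app g q, hlt hγ hq, fun k hk hmem => ?_⟩
        have hgk : ∀ k ∈ q, app g q ∉ app g k := fun k hk hmem =>
          hq.2.2 k hk ((hκ.mem (hgκ (hωo.mem_trans hk hq.1))).mem_trans hq.2.1 hmem)
        rcases ZFSet.mem_insert_iff.1 hk with rfl | hk
        · rcases ((hωo.mem hn).subset_iff_eq_or_mem (hωo.mem hq.1)).1 hnq with rfl | h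
          · exact ZFSet.mem_irrefl _ hmem
          · exact hgk k h hmem
        · exact hgk k (hnq hk) hmem
      obtain ⟨γ, hγ, hγm⟩ := key _ (ZFSet.omega_succ hm.1) (ZFSet.omega_succ hm.1)
      exact hγm m (ZFSet.mem_insert _ _) ((hκ.mem (hgκ hm.1)).mem_trans hγ hm.2.1)
  refine ⟨x, hxV, hthread, ?_⟩
  ext γ
  exact ⟨fun h => IsThread.dom_subset h, fun h => hthread.mem_dom.2 (hdefd γ h)⟩

end FixAbs

namespace FixAbs

open DistStr

/-! ### The tree of threads -/

section Tree

/-- By `∈`-induction the isomorphism is the identity. This makes levels unique although the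
bijections witnessing them are arbitrary. -/
theorem eq_of_mem_equiv {i j : ZFSet.{u}} (hi : i.IsOrdinal) (hj : j.IsOrdinal) (e : i ≃ j)
    (he : ∀ b c : i, b.1 ∈ c.1 ↔ (e b).1 ∈ (e c).1) : i = j := by
  have key : ∀ b (hb : b ∈ i), (e ⟨b, hb⟩).1 = b := by
    intro b
    induction b using ZFSet.inductionOn with
    | _ b ih =>
      intro hb
      ext z
      constructor
      · intro hz
        obtain ⟨⟨w, hw⟩, hwz⟩ := e.surjective ⟨z, hj.mem_trans hz (e ⟨b, hb⟩).2⟩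
        have hwz' : (e ⟨w, hw⟩).1 = z := congrArg Subtype.val hwz
        have hwb : w ∈ b := (he ⟨w, hw⟩ ⟨b, hb⟩).2 (hwz' ▸ hz)
        rwa [← hwz', ih w hwb hw]
      · intro hz
        have hzi := hi.mem_trans hz hb
        rw [← ih z hz hzi]
        exact (he ⟨z, hzi⟩ ⟨b, hb⟩).1 hz
  ext z
  constructor
  · intro hz
    rw [← key z hz]
    exact (e _).2
  · intro hz
    obtain ⟨w, hw⟩ := e.surjective ⟨z, hz⟩
    have := key w.1 w.2
    rw [hw] at this
    exact (show z = w.1 from this) ▸ w.2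

theorem Tree.HasLevel.unique {T : ZFSet.{u}} {le : T → T → Prop} {a : T} {i j : ZFSet.{u}}
    (h : Tree.HasLevel le a i) (h' : Tree.HasLevel le a j) : i = j := by
  obtain ⟨hi, e, he⟩ := h
  obtain ⟨hj, e', he'⟩ := h'
  refine eq_of_mem_equiv hi hj (e.symm.trans e') fun b c => ?_
  have := (he (e.symm b) (e.symm c)).symm.trans (he' (e.symm b) (e.symm c))
  simpa using this

/-- The order of a tree of threads. -/
def nodeLe {T : ZFSet.{u}} (x y : T) : Prop := x.1 ⊆ y.1

variable {V V' : Set ZFSet.{u}} {κ : ZFSet.{u}}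

theorem dom_mem_of_lt (hκo : κ.IsOrdinal) {x y : threadSet V κ} (h : Tree.Lt nodeLe x y) :
    dom κ x.1 ∈ dom κ y.1 := by
  have hx := isThread_of_mem x
  have hy := isThread_of_mem y
  refine (((hx.isOrdinal_dom hκo).subset_iff_eq_or_mem (hy.isOrdinal_dom hκo)).1
    (hx.dom_mono hy h.1)).resolve_left fun he => h.2 (Subtype.ext ?_)
  exact hx.eq_of_subset_of_dom hy h.1 he

theorem lt_step (hκo : κ.IsOrdinal) (hsucc : ∀ i ∈ κ, insert i i ∈ κ) {x y : threadSet V κ}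
    (hd : dom κ x.1 ≠ κ) (hy : y.1 = step κ x.1) : Tree.Lt nodeLe x y := by
  refine ⟨?_, fun h => ?_⟩
  · change x.1 ⊆ y.1
    rw [hy]
    exact subset_step
  · have := (step_isThread hκo hsucc (isThread_of_mem x) hd).2
    rw [← hy, ← h] at this
    exact ZFSet.mem_irrefl (dom κ x.1) (this.symm.subset (ZFSet.mem_insert _ _))

theorem relIn_nodeLe [hV : Fact (IsModelOfSetTheory V)] {T : ZFSet.{u}} (hT : T ∈ V) :
    RelIn V (nodeLe (T := T)) :=
  relIn_of_def hT (P := fun a b => a ⊆ b) inferInstance fun _ _ => Iff.rfl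

variable [hV : Fact (IsModelOfSetTheory V)] [hκ : Fact (κ ∈ V)]

/-- The strict predecessors of `x` are its proper restrictions, each determined by its domain, and
every `i` in the domain of `x` occurs. -/
theorem hasLevel_dom (hκo : κ.IsOrdinal) (x : threadSet V κ) :
    Tree.HasLevel nodeLe x (dom κ x.1) := by
  have hx := isThread_of_mem x
  have hxo := hx.isOrdinal_dom hκo
  refine ⟨hxo, Equiv.ofBijective (fun b => ⟨dom κ b.1.1, dom_mem_of_lt hκo b.2⟩)
    ⟨fun b c hbc => ?_, fun i => ?_⟩, fun b c => ?_⟩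
  · have hbc' : dom κ b.1.1 = dom κ c.1.1 := congrArg Subtype.val hbc
    apply Subtype.ext
    apply Subtype.ext
    rw [(isThread_of_mem b.1).eq_restrict_of_subset hx b.2.1, hbc',
      ← (isThread_of_mem c.1).eq_restrict_of_subset hx c.2.1]
  · have hi : i.1 ∈ κ := IsThread.dom_subset i.2
    have hd := hx.dom_restrict_of_subset (hκo.mem hi) (hxo.subset_of_mem i.2)
    refine ⟨⟨⟨restrict κ x.1 i.1, restrict_mem_threadSet hκo hx hi⟩,
      IsThread.restrict_subset, fun he => ?_⟩, Subtype.ext hd⟩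
    have he' : restrict κ x.1 i.1 = x.1 := congrArg Subtype.val he
    rw [he'] at hd
    exact ZFSet.mem_irrefl i.1 (hd.subset i.2)
  · refine ⟨fun h => dom_mem_of_lt hκo h, fun h => ⟨?_, fun he => ?_⟩⟩
    · change b.1.1 ⊆ c.1.1
      rw [(isThread_of_mem b.1).eq_restrict_of_subset hx b.2.1,
        (isThread_of_mem c.1).eq_restrict_of_subset hx c.2.1]
      exact hx.restrict_subset_restrict
        (((isThread_of_mem c.1).isOrdinal_dom hκo).subset_of_mem h)
    · have h' : dom κ b.1.1 ∈ dom κ c.1.1 := h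
      rw [he] at h'
      exact ZFSet.mem_irrefl _ h'

theorem hasLevel_iff (hκo : κ.IsOrdinal) {x : threadSet V κ} {i : ZFSet.{u}} :
    Tree.HasLevel nodeLe x i ↔ i = dom κ x.1 :=
  ⟨fun h => h.unique (hasLevel_dom hκo x), fun h => h ▸ hasLevel_dom hκo x⟩

theorem isTree_nodeLe (hκo : κ.IsOrdinal) (hd : ∀ x : threadSet V κ, dom κ x.1 ∈ κ) :
    Tree.IsTree (nodeLe (T := threadSet V κ)) κ where
  refl := fun _ _ => id
  trans := fun _ _ _ h h' _ hz => h' (h hz)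
  antisymm := fun _ _ h h' => Subtype.ext (le_antisymm h h')
  root := by
    have he : (∅ : ZFSet.{u}) ∈ threadSet V κ := mem_threadSet.2 ⟨empty_mem_model, IsThread.empty⟩
    refine ⟨⟨∅, he⟩, fun b hb => hb.2 (Subtype.ext ?_), fun r hr => ?_⟩
    · exact (ZFSet.eq_empty _).2 fun z hz => ZFSet.notMem_empty z (hb.1 hz)
    · by_contra hne
      exact hr ⟨∅, he⟩ ⟨ZFSet.empty_subset _, fun h => hne h.symm⟩
  level := fun x => ⟨_, hd x, hasLevel_dom hκo x⟩

theorem isPruned_nodeLe (hκo : κ.IsOrdinal) : Tree.IsPruned (nodeLe (T := threadSet V κ)) κ := by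
  intro a i hi β hβ hiβ
  have ha := isThread_of_mem a
  obtain rfl := (hasLevel_iff hκo).1 hi
  have hs := (hκo.mem hβ).subset_of_mem hiβ
  have hd := ha.dom_extend hκo hβ hs
  have ht := ha.extend hκo hβ hs
  have hdκ : dom κ (extend κ a.1 β) ∈ κ := by rwa [hd]
  exact ⟨⟨extend κ a.1 β, mem_threadSet.2 ⟨ht.mem_model hκo hdκ, ht⟩⟩,
    (hasLevel_iff hκo).2 hd.symm, IsThread.subset_extend⟩

/-- The restriction of `x` to the stage of agreement is a common lower bound, and every common lower
bound has its domain inside that stage. -/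
theorem isJoin_join (hκo : κ.IsOrdinal) {x y : threadSet V κ} (hxy : x ≠ y) :
    Tree.IsJoin nodeLe x y (join κ x.1 y.1) := by
  have hx := isThread_of_mem x
  have hy := isThread_of_mem y
  intro z
  constructor
  · intro hz
    have hj := hx.join_mem hκo hy fun h => hxy (Subtype.ext h)
    have hjd : join κ x.1 y.1 ⊆ dom κ x.1 := fun γ hγ => by
      obtain ⟨v, hv, -⟩ := IsThread.exists_of_mem_join hγ
      exact hx.mem_dom.2 ⟨v, hv⟩
    refine ⟨⟨restrict κ x.1 (join κ x.1 y.1), restrict_mem_threadSet hκo hx hj⟩, _,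
      IsThread.restrict_subset, ?_, hasLevel_dom hκo _, ?_⟩
    · refine IsThread.subset_of_pair (κ := κ)
        (fun _ h => hx.sub (IsThread.restrict_subset h)) fun γ v h => ?_
      rw [hx.pair_mem_restrict] at h
      exact (hx.agree_join hy γ h.1 v).1 h.2
    · rwa [hx.dom_restrict_of_subset (hκo.mem hj) hjd]
  · rintro ⟨c, i, hcx, hcy, hi, hz⟩
    obtain rfl := (hasLevel_iff hκo).1 hi
    have hc := isThread_of_mem c
    exact join_mono hcx hcy (hc.subset_join (hc.isOrdinal_dom hκo) (fun _ => id)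
      (Agree.refl _ _) hz)

/-- A path of the tree is the sequence of restrictions of a thread of full length. -/
theorem exists_thread_of_path [hV' : Fact (IsModelOfSetTheory V')] (hκo : κ.IsOrdinal)
    (hsucc : ∀ i ∈ κ, insert i i ∈ κ) {p : κ → threadSet V κ} (hp : Tree.IsPath nodeLe V' p) :
    ∃ x ∈ threadSet V' κ, dom κ x = κ ∧ ∀ i, (p i).1 = restrict κ x i.1 := by
  obtain ⟨hpV, hlev, hlt⟩ := hp
  have : Fact (FunIn V' p) := ⟨hpV⟩
  have : Fact (κ ∈ V') := ⟨hpV.dom_mem⟩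
  have hdom : ∀ i, dom κ (p i).1 = i.1 := fun i => ((hasLevel_iff hκo).1 (hlev i)).symm
  -- The thread is the union of the path, which agrees with `p i` below `i`.
  let x : ZFSet.{u} := ZFSet.sep (fun z => ∃ i, i ∈ κ ∧ z ∈ app p i) (ZFSet.prod κ κ)
  have hxV : x ∈ V' := sep_mem_model Fact.out inferInstance
  have hx : ∀ z, z ∈ x ↔ ∃ i, z ∈ (p i).1 := by
    intro z
    rw [ZFSet.mem_sep]
    constructor
    · rintro ⟨-, i, hi, hz⟩
      rw [app_of_mem p hi] at hz
      exact ⟨_, hz⟩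
    · rintro ⟨i, hz⟩
      exact ⟨(isThread_of_mem (p i)).sub hz, i.1, i.2, by rwa [app_coe]⟩
  have hsub : ∀ i, (p i).1 ⊆ x := fun i z hz => (hx z).2 ⟨i, hz⟩
  have hag : ∀ i : κ, Agree x (p i).1 i.1 := by
    intro i δ hδ v
    refine ⟨fun h => ?_, fun h => hsub i h⟩
    obtain ⟨j, hj⟩ := (hx _).1 h
    rcases (hκo.mem i.2).mem_trichotomous (hκo.mem j.2) with hij | hij | hij
    · rw [← hdom i] at hδ
      obtain ⟨w, hw⟩ := (isThread_of_mem (p i)).mem_dom.1 hδ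
      rwa [(isThread_of_mem (p j)).func hj ((hlt i j hij).1 hw)]
    · rwa [Subtype.ext hij]
    · exact (hlt j i hij).1 hj
  have hxT : IsThread κ x := IsThread.of_local hsucc ZFSet.sep_subset fun i hi =>
    ⟨_, isThread_of_mem (p ⟨i, hi⟩), hag ⟨i, hi⟩⟩
  refine ⟨x, mem_threadSet.2 ⟨hxV, hxT⟩, ?_, fun i => ?_⟩
  · ext γ
    refine ⟨fun h => IsThread.dom_subset h, fun hγ => ?_⟩
    refine (isThread_of_mem (p ⟨_, hsucc γ hγ⟩)).dom_mono hxT (hsub _) ?_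
    rw [hdom]
    exact ZFSet.mem_insert _ _
  · have := (isThread_of_mem (p i)).eq_restrict_of_subset hxT (hsub i)
    rwa [hdom] at this

theorem funIn_restrictPt [hV' : Fact (IsModelOfSetTheory V')] (hVV' : V ⊆ V') {X : DistStr.{u}}
    {α : κ → X.carrier} (hα : X.IsScale α) {x : ZFSet.{u}} (hxV : x ∈ V') (hx : IsThread κ x) :
    FunIn V' (fun i : κ => (restrictPt hα hx i : threadSet V κ)) := by
  have : Fact (x ∈ V') := ⟨hxV⟩
  have : Fact (κ ∈ V') := ⟨hVV' hκ.out⟩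
  exact funIn_of_def (hVV' hκ.out) (hVV' Fact.out) (F := fun i => restrict κ x i) inferInstance
    fun _ => rfl

theorem isPath_restrictPt [hV' : Fact (IsModelOfSetTheory V')] (hVV' : V ⊆ V') {X : DistStr.{u}}
    {α : κ → X.carrier} (hα : X.IsScale α) {x : ZFSet.{u}} (hxV : x ∈ V') (hx : IsThread κ x)
    (hd : dom κ x = κ) :
    Tree.IsPath nodeLe V' (fun i : κ => (restrictPt hα hx i : threadSet V κ)) := by
  have hdom : ∀ i : κ, dom κ (restrict κ x i.1) = i.1 := fun i =>
    hx.dom_restrict_of_subset (hα.ordinal_of_mem i.2)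
      (by rw [hd]; exact hα.isOrdinal.subset_of_mem i.2)
  refine ⟨funIn_restrictPt hVV' hα hxV hx,
    fun i => (hasLevel_iff hα.isOrdinal).2 (hdom i).symm,
    fun i j hij => ⟨hx.restrict_subset_restrict
      ((hα.ordinal_of_mem j.2).subset_of_mem hij), fun he => ?_⟩⟩
  have he' : restrict κ x i.1 = restrict κ x j.1 := congrArg Subtype.val he
  have := hdom i
  rw [he', hdom j] at this
  rw [this] at hij
  exact ZFSet.mem_irrefl _ hij

end Tree

end FixAbs

namespace FixAbs

open DistStr DynStr

/-! ### Approximating sequences -/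

section Approx

variable {V : Set ZFSet.{u}} {κ : ZFSet.{u}} {Y : DistStr.{u}} {β : κ → Y.carrier} {Q : DynStr Y}

/-- The members of `q` from the index `i` on are at most `β i` apart. -/
def IsRegularSeq (β : κ → Y.carrier) (q : κ → Q.points) : Prop :=
  ∀ i j : κ, i.1 ⊆ j.1 → Y.le (Q.dist (q i) (q j)) (β i) ∧ Y.le (Q.dist (q j) (q i)) (β i)

/-- The point `y` and the `i`-th member of `q` are at most `β i` apart. -/
def Approximates (β : κ → Y.carrier) (q : κ → Q.points) (y : Q.points) : Prop :=
  ∀ i : κ, Y.le (Q.dist y (q i)) (β i) ∧ Y.le (Q.dist (q i) y) (β i)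

theorem Approximates.isLimit (hβ : Y.IsScale β) (hY : Y.IsDistanceMonoid V) {q : κ → Q.points}
    {y : Q.points} (h : Approximates β q y) : Q.IsLimit q y := by
  intro ε hε
  obtain ⟨i, hi⟩ := hβ.coinitial ε hε
  refine ⟨i, fun j hj => ?_⟩
  have := hY.le_trans _ _ _ (hβ.anti hY hj) hi
  exact ⟨hY.le_trans _ _ _ (h j).1 this, hY.le_trans _ _ _ (h j).2 this⟩

theorem Approximates.unique (hβ : Y.IsScale β) (hY : Y.IsDistanceMonoid V) (hQ : Q.IsMetric)
    {q : κ → Q.points} {y y' : Q.points} (h : Approximates β q y) (h' : Approximates β q y') :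
    y = y' := (h.isLimit hβ hY).unique hβ hY hQ (h'.isLimit hβ hY)

/-- Convergence only provides late members of `q` close to `y`, separately for each direction. The
modulus of `q` and the epsilon principle upgrade this to a bound at every index, a condition that is
definable and determines `y`. -/
theorem IsRegularSeq.approximates [Fact (IsModelOfSetTheory V)] (hβ : Y.IsScale β)
    (hY : Y.IsDistanceMonoid V) (hYV : Y.In V) (hQ : Q.IsMetric) {q : κ → Q.points}
    (hq : IsRegularSeq β q) {y : Q.points}
    (h : ∀ i m : κ, ∃ k : κ, i.1 ⊆ k.1 ∧ Y.le (Q.dist y (q k)) (β m))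
    (h' : ∀ i m : κ, ∃ k : κ, i.1 ⊆ k.1 ∧ Y.le (Q.dist (q k) y) (β m)) :
    Approximates β q y := by
  intro i
  constructor
  · refine hβ.le_of_forall_le_add hY hYV fun m => ?_
    obtain ⟨k, hik, hk⟩ := h i m
    rw [hY.add_comm]
    exact hY.le_trans _ _ _ (hQ.2 _ (q k) _) (hY.add_le_add hk (hq i k hik).2)
  · refine hβ.le_of_forall_le_add hY hYV fun m => ?_
    obtain ⟨k, hik, hk⟩ := h' i m
    exact hY.le_trans _ _ _ (hQ.2 _ (q k) _) (hY.add_le_add (hq i k hik).1 hk)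

/-- The sequence `q`, indexed by the values of `β` instead of their indices. -/
noncomputable def reindex {A B : ZFSet.{u}} (β : κ → A) (q : κ → B) (a : Set.range β) : B :=
  q a.2.choose

theorem reindex_apply {A B : ZFSet.{u}} {β : κ → A} (hβ : Function.Injective β) (q : κ → B)
    (i : κ) (h : β i ∈ Set.range β) : reindex β q ⟨β i, h⟩ = q i :=
  congrArg q (hβ h.choose_spec)

theorem exists_reindex_eq {A B : ZFSet.{u}} {β : κ → A} (q : κ → B) (a : Set.range β) :
    ∃ i, a.1 = β i ∧ reindex β q a = q i :=
  ⟨_, a.2.choose_spec.symm, rfl⟩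

theorem pfunIn_reindex [Fact (IsModelOfSetTheory V)] {A B : ZFSet.{u}} {β : κ → A} {q : κ → B}
    (hA : A ∈ V) (hB : B ∈ V) (hβ : Function.Injective β) (hβV : FunIn V β) (hqV : FunIn V q) :
    PFunIn V (reindex β q) := by
  have : Fact (FunIn V β) := ⟨hβV⟩
  have : Fact (FunIn V q) := ⟨hqV⟩
  have : Fact (κ ∈ V) := ⟨hβV.dom_mem⟩
  refine pfunIn_of_graph hA hB
    (P := fun a b => ∃ i, i ∈ κ ∧ (a = app β i ∧ b = app q i)) inferInstance fun a b => ?_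
  constructor
  · rintro ⟨ha, rfl⟩
    obtain ⟨i, hi, hq⟩ := exists_reindex_eq q ⟨a, ha⟩
    exact ⟨i.1, i.2, by rw [app_coe, ← hi], by rw [hq, app_coe]⟩
  · rintro ⟨i, hi, ha, hb⟩
    rw [app_of_mem _ hi] at ha hb
    obtain rfl := Subtype.ext ha
    obtain rfl := Subtype.ext hb
    exact ⟨⟨_, rfl⟩, reindex_apply hβ _ _ _⟩

/-- Two members are as close as the value of `β` at the earlier index, which is one of the two
summands allowed. -/
theorem IsRegularSeq.isCauchySeq [Fact (IsModelOfSetTheory V)] (hβ : Y.IsScale β)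
    (hY : Y.IsDistanceMonoid V) (hQV : Q.In V) {q : κ → Q.points} (hβV : FunIn V β)
    (hqV : FunIn V q) (hq : IsRegularSeq β q) : Q.IsCauchySeq V (reindex β q) := by
  have hinj := hβ.injective hY
  refine ⟨pfunIn_reindex hQV.1.1 hQV.2.1 hinj hβV hqV, ?_,
    ⟨fun a _ => hY.zero_le a, fun l hl => ?_⟩, ?_⟩
  · rintro ⟨i, hi⟩
    exact hβ.ne_zero i hi
  · rw [hβ.eq_zero hY (a := l) fun i => ?_]
    · exact hY.le_refl _
    · exact hY.le_trans _ _ _ (hl _ ⟨_, ⟨hβ.succ i, rfl⟩, _, ⟨hβ.succ i, rfl⟩, rfl⟩)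
        (hβ.two_le hY i)
  · intro a b
    obtain ⟨i, hi, hqi⟩ := exists_reindex_eq q a
    obtain ⟨j, hj, hqj⟩ := exists_reindex_eq q b
    rw [hqi, hqj, hi, hj]
    rcases (hβ.ordinal_of_mem i.2).subset_total (hβ.ordinal_of_mem j.2) with h | h
    · exact hY.le_trans _ _ _ (hq i j h).1 (hY.le_add_right _ _)
    · exact hY.le_trans _ _ _ (hq j i h).2 (hY.le_add_left _ _)

theorem Approximates.convergesTo (hβ : Y.IsScale β) (hY : Y.IsDistanceMonoid V)
    {q : κ → Q.points} {y : Q.points} (h : Approximates β q y) :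
    Q.ConvergesTo (reindex β q) y := by
  have hinj := hβ.injective hY
  have key : ∀ (a : Y.carrier), a ≠ Y.zero → ∀ i : κ, ∃ k : κ, i.1 ⊆ k.1 ∧ Y.le (β k) a := by
    intro a ha i
    obtain ⟨j, hj⟩ := hβ.coinitial a ha
    obtain ⟨k, hik, hjk⟩ := hβ.sup_index i j
    exact ⟨k, hik, hY.le_trans _ _ _ (hβ.anti hY hjk) hj⟩
  intro a ha
  refine ⟨⟨fun d _ => hY.zero_le d, fun l hl => ?_⟩, fun d _ => hY.zero_le d, fun l hl => ?_⟩
  · rw [hβ.eq_zero hY (a := l) fun i => ?_]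
    · exact hY.le_refl _
    · obtain ⟨k, hik, hk⟩ := key a ha i
      refine hY.le_trans _ _ _ (hl _ ⟨⟨β k, Set.mem_range_self k⟩, hk, rfl⟩) ?_
      rw [reindex_apply hinj]
      exact hY.le_trans _ _ _ (h k).1 (hβ.anti hY hik)
  · rw [hβ.eq_zero hY (a := l) fun i => ?_]
    · exact hY.le_refl _
    · obtain ⟨k, hik, hk⟩ := key a ha i
      refine hY.le_trans _ _ _ (hl _ ⟨⟨β k, Set.mem_range_self k⟩, hk, rfl⟩) ?_
      rw [reindex_apply hinj]
      exact hY.le_trans _ _ _ (h k).2 (hβ.anti hY hik)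

theorem IsRegularSeq.exists_approximates [Fact (IsModelOfSetTheory V)] (hβ : Y.IsScale β)
    (hQ : Q.IsDynSys V) {q : κ → Q.points} (hβV : FunIn V β)
    (hqV : FunIn V q) (hq : IsRegularSeq β q) : ∃ y, Approximates β q y := by
  have hY := hQ.isDistanceMonoid
  obtain ⟨y, hy⟩ := hQ.isCauchyComplete _ _ (hq.isCauchySeq hβ hY hQ.mem hβV hqV)
  refine ⟨y, hq.approximates hβ hY hQ.mem.1 hQ.isMetric (fun i m => ?_) fun i m => ?_⟩
  · by_contra! hno
    refine hβ.ne_zero m (hY.eq_zero_of_le ((hy _ (hβ.ne_zero i)).1.2 _ ?_))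
    rintro _ ⟨b, hb, rfl⟩
    obtain ⟨k, hk, hqk⟩ := exists_reindex_eq q b
    rw [hk] at hb
    rw [hqk]
    exact hY.le_of_not_le (hno k ((hβ.le_iff hY).1 hb))
  · by_contra! hno
    refine hβ.ne_zero m (hY.eq_zero_of_le ((hy _ (hβ.ne_zero i)).2.2 _ ?_))
    rintro _ ⟨b, hb, rfl⟩
    obtain ⟨k, hk, hqk⟩ := exists_reindex_eq q b
    rw [hk] at hb
    rw [hqk]
    exact hY.le_of_not_le (hno k ((hβ.le_iff hY).1 hb))

theorem FunIn.comp [Fact (IsModelOfSetTheory V)] {A B C : ZFSet.{u}} {g : B → C} {f : A → B}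
    (hC : C ∈ V) (hg : FunIn V g) (hf : FunIn V f) : FunIn V (fun a => g (f a)) := by
  have : Fact (FunIn V g) := ⟨hg⟩
  have : Fact (FunIn V f) := ⟨hf⟩
  exact funIn_of_def hf.dom_mem hC (F := fun a => app g (app f a)) inferInstance
    fun a => by rw [app_coe, app_coe]

end Approx

/-! ### The universal property of the space of threads -/

section Universal

theorem threadSet_mono {V V' : Set ZFSet.{u}} {κ : ZFSet.{u}} (hVV' : V ⊆ V') :
    threadSet V κ ⊆ threadSet V' κ := fun _ hx =>
  mem_threadSet.2 ⟨hVV' (mem_threadSet.1 hx).1, (mem_threadSet.1 hx).2⟩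

variable {V V' : Set ZFSet.{u}} [hV : Fact (IsModelOfSetTheory V)]
  {κ : ZFSet.{u}} [hκ : Fact (κ ∈ V)]
  {W X Y : DistStr.{u}} {α : κ → W.carrier} {hα : W.IsScale α}

theorem treeSpace_isHom_incl [hV' : Fact (IsModelOfSetTheory V')] [hκ' : Fact (κ ∈ V')]
    (hVV' : V ⊆ V') (hc : W.IsCompletion V' X) :
    IsHom (treeSpace V hα) (treeSpace V' (hc.isScale hα)) (incl hc.sub)
      (incl (threadSet_mono hVV')) where
  map_add := fun a b => (hc.add_eq a b).symm
  map_zero := hc.zero_eq.symm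
  map_le := fun a b h => (hc.le_iff a b).2 h
  map_dist := by
    intro x y
    by_cases h : x = y
    · subst h
      rw [treeSpace_dist_self]
      exact hc.zero_eq.symm.trans (treeSpace_dist_self _).symm
    · obtain ⟨j, hj, hd⟩ := treeSpace_dist_of_ne h
      obtain ⟨j', hj', hd'⟩ := treeSpace_dist_of_ne (hα := hc.isScale hα)
        (x := incl (threadSet_mono hVV') x) (y := incl (threadSet_mono hVV') y)
        fun he => h (Subtype.ext (show (x.1 : ZFSet.{u}) = y.1 from
          congrArg (fun z : (treeSpace V' (hc.isScale hα)).points => z.1) he))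
      obtain rfl : j = j' := Subtype.ext (hj.trans hj'.symm)
      exact (congrArg _ hd).trans hd'.symm
  map_map := fun _ => rfl

variable {Q : DynStr Y} {s_pt : (treeSpace V hα).points ⊆ Q.points}

/-- The restrictions of a thread, as points of an extension of the space of threads. -/
noncomputable def trace (s_pt : (treeSpace V hα).points ⊆ Q.points) {x : ZFSet.{u}}
    (hx : IsThread κ x) (i : κ) : Q.points := incl s_pt (restrictPt hα hx i)

theorem funIn_trace [hV' : Fact (IsModelOfSetTheory V')]
    (hVV' : V ⊆ V') {x : ZFSet.{u}} (hxV : x ∈ V') (hx : IsThread κ x) :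
    FunIn V' (trace s_pt hx) :=
  funIn_incl_comp s_pt (funIn_restrictPt hVV' hα hxV hx)

section

variable (hd : W.IsCompletion V' Y)
  (hhom : IsHom (treeSpace V hα) Q (incl hd.sub) (incl s_pt)) (hW : W.IsDistanceMonoid V)

include hhom hW

theorem dist_le_of_agree {x y : (treeSpace V hα).points} {i : κ} (h : Agree x.1 y.1 i.1) :
    Y.le (Q.dist (incl s_pt x) (incl s_pt y)) (incl hd.sub (α i)) := by
  rw [← hhom.map_dist, hd.le_iff]
  exact (treeSpace_dist_le_iff hW).2 h

theorem isRegularSeq_trace {x : ZFSet.{u}} (hx : IsThread κ x) :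
    IsRegularSeq (fun i => incl hd.sub (α i)) (trace s_pt hx) := by
  intro i j hij
  have h : Agree (restrict κ x i.1) (restrict κ x j.1) i.1 :=
    hx.agree_restrict.trans (hx.agree_restrict.mono hij).symm
  exact ⟨dist_le_of_agree hd hhom hW (x := restrictPt hα hx i) (y := restrictPt hα hx j) h,
    dist_le_of_agree hd hhom hW (x := restrictPt hα hx j) (y := restrictPt hα hx i) h.symm⟩

theorem approximates_incl (x : (treeSpace V hα).points) (hx : IsThread κ x.1) :
    Approximates (fun i => incl hd.sub (α i)) (trace s_pt hx) (incl s_pt x) := fun i =>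
  ⟨dist_le_of_agree hd hhom hW (y := restrictPt hα hx i) hx.agree_restrict.symm,
    dist_le_of_agree hd hhom hW (x := restrictPt hα hx i) hx.agree_restrict⟩

/-- The limit of a thread of full length is a fixed point. -/
theorem map_eq_of_approximates (hQ : Q.IsDynSys V') {x : ZFSet.{u}} (hx : IsThread κ x)
    (hdx : dom κ x = κ) {y : Q.points}
    (hy : Approximates (fun i => incl hd.sub (α i)) (trace s_pt hx) y) : Q.map y = y := by
  have hY := hd.isDistanceMonoid
  have hβ := hd.isScale hα
  -- One more stage does not change the restriction to `i` below `i`, so the map moves the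
  -- approximant by at most `α i`.
  have hag : ∀ i : κ, Agree (step κ (restrict κ x i.1)) (restrict κ x i.1) i.1 := by
    intro i δ hδ v
    have hr := hx.restrict (hα.ordinal_of_mem i.2)
    have hdr := hx.dom_restrict_of_subset (hα.ordinal_of_mem i.2)
      (by rw [hdx]; exact hα.isOrdinal.subset_of_mem i.2)
    have hne : dom κ (restrict κ x i.1) ≠ κ := fun h =>
      ZFSet.mem_irrefl κ (by have := i.2; rwa [← hdr, h] at this)
    refine ⟨fun h => ?_, fun h => subset_step h⟩
    obtain ⟨w, hw⟩ := hr.mem_dom.1 (hdr.symm ▸ hδ)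
    rwa [(step_isThread hα.isOrdinal hα.succ_mem hr hne).1.func h (subset_step hw)]
  have hmap : ∀ i, Q.map (trace s_pt hx i) =
      incl s_pt ((treeSpace V hα).map (restrictPt hα hx i)) := fun i => (hhom.map_map _).symm
  have h1 : ∀ i, Y.le (Q.dist (Q.map (trace s_pt hx i)) (trace s_pt hx i))
      (incl hd.sub (α i)) := fun i => by
    rw [hmap]
    exact dist_le_of_agree hd hhom hW (y := restrictPt hα hx i) (hag i)
  have h2 : ∀ i, Y.le (Q.dist (trace s_pt hx i) (Q.map (trace s_pt hx i)))
      (incl hd.sub (α i)) := fun i => by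
    rw [hmap]
    exact dist_le_of_agree hd hhom hW (x := restrictPt hα hx i) (hag i).symm
  have hQm := hQ.isMetric
  -- Going from `f y` to `y` through the image of an approximant and the approximant itself costs
  -- three errors; a fourth is added to fit the form of niceness.
  refine eq_of_dist_le hβ hY hQm fun i => ⟨?_, ?_⟩
  · refine hY.le_trans _ _ _ (hQm.2 _ (Q.map (trace s_pt hx (hβ.succ i))) _)
      (hY.le_trans _ _ _ (hY.add_le_add (hY.le_trans _ _ _ (hQ.isNonExpanding _ _)
        (hY.le_trans _ _ _ (hy (hβ.succ i)).1 (hY.le_add_right _ _)))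
        (hY.le_trans _ _ _ (hQm.2 _ (trace s_pt hx (hβ.succ i)) _)
          (hY.add_le_add (h1 _) (hy _).2))) (hβ.four_le i))
  · refine hY.le_trans _ _ _ (hQm.2 _ (Q.map (trace s_pt hx (hβ.succ i))) _)
      (hY.le_trans _ _ _ (hY.add_le_add
        (hY.le_trans _ _ _ (hQm.2 _ (trace s_pt hx (hβ.succ i)) _)
          (hY.add_le_add (hy _).1 (h2 _)))
        (hY.le_trans _ _ _ (hQ.isNonExpanding _ _)
        (hY.le_trans _ _ _ (hy (hβ.succ i)).2 (hY.le_add_right _ _)))) (hβ.four_le i))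

end

/-- Send a thread to the limit in `Q` of its restrictions, which are points of the original space.
Distances pass to limits, and the limit is unique, so threads of `V` are fixed and the map has a
definable graph. -/
theorem exists_extension [hV' : Fact (IsModelOfSetTheory V')] [hκ' : Fact (κ ∈ V')]
    (hVV' : V ⊆ V') (hWV : W.In V) (hW : W.IsDistanceMonoid V)
    (hαV : FunIn V α) (hc : W.IsCompletion V' X) (hXV : X.In V') (hd : W.IsCompletion V' Y)
    (hhom : IsHom (treeSpace V hα) Q (incl hd.sub) (incl s_pt)) (hQ : Q.IsDynSys V') :
    ∃ (h : X.carrier → Y.carrier) (k : threadSet V' κ → Q.points), FunIn V' h ∧ FunIn V' k ∧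
      IsHom (treeSpace V' (hc.isScale hα)) Q h k ∧ (∀ w, h (incl hc.sub w) = incl hd.sub w) ∧
      (∀ x, k (incl (threadSet_mono hVV') x) = incl s_pt x) ∧
      ∀ x, Approximates (fun i => incl hd.sub (α i)) (trace s_pt (isThread_of_mem x)) (k x) := by
  have hY := hd.isDistanceMonoid
  have hβ := hd.isScale hα
  have hYV := hQ.mem.1
  have hαV' : FunIn V' α := hαV.mono hVV'
  have hβV : FunIn V' (fun i => incl hd.sub (α i)) := funIn_incl_comp hd.sub hαV'
  obtain ⟨h, hhV, h_add, h_zero, h_le, h_incl⟩ := hc.exists_iso (hWV.mono hVV') hXV hd hYV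
  choose k hk using fun x : threadSet V' κ =>
    (isRegularSeq_trace (s_pt := s_pt) hd hhom hW (isThread_of_mem x)).exists_approximates hβ hQ
      hβV (funIn_trace hVV' (mem_threadSet.1 x.2).1 (isThread_of_mem x))
  have hkT : ∀ x, k (incl (threadSet_mono hVV') x) = incl s_pt x := fun x =>
    (hk _).unique hβ hY hQ.isMetric (approximates_incl hd hhom hW x (isThread_of_mem x))
  have hR := treeSpace_isHom_incl (hα := hα) hVV' hc
  refine ⟨h, k, hhV, ?_, ⟨h_add, h_zero, h_le, fun x y => ?_, fun x => ?_⟩, h_incl, hkT, hk⟩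
  · have : Fact (Fun₂In V' Q.dist) := ⟨hQ.mem.2.2.1⟩
    have : Fact (RelIn V' Y.le) := ⟨hYV.2.2⟩
    have : Fact (FunIn V' α) := ⟨hαV'⟩
    refine funIn_of_graph Fact.out hQ.mem.2.1 (P := fun x y => ∀ i, i ∈ κ →
      (rel Y.le (app₂ Q.dist y (restrict κ x i)) (app α i) ∧
        rel Y.le (app₂ Q.dist (restrict κ x i) y) (app α i))) inferInstance fun x y => ?_
    have hP : Approximates (fun i => incl hd.sub (α i)) (trace s_pt (isThread_of_mem x)) y ↔
        ∀ i, i ∈ κ → (rel Y.le (app₂ Q.dist y.1 (restrict κ x.1 i)) (app α i) ∧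
          rel Y.le (app₂ Q.dist (restrict κ x.1 i) y.1) (app α i)) := by
      refine Iff.trans (forall_congr' fun i => ?_)
        (SetLike.forall (p := κ) (q := fun i =>
          rel Y.le (app₂ Q.dist y.1 (restrict κ x.1 i.1)) (app α i.1) ∧
          rel Y.le (app₂ Q.dist (restrict κ x.1 i.1) y.1) (app α i.1)))
      rw [← rel_coe Y.le, ← rel_coe Y.le, ← app₂_coe, ← app₂_coe, incl_coe, app_coe α]
      exact Iff.rfl
    rw [← hP]
    exact ⟨fun he => he ▸ hk x, fun hy => (hk x).unique hβ hY hQ.isMetric hy⟩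
  · have hlim : ∀ x : threadSet V' κ, (treeSpace V' (hc.isScale hα)).IsLimit
        (fun i => incl (threadSet_mono hVV') (restrictPt (V := V) hα (isThread_of_mem x) i)) x :=
      fun x => treeSpace_isLimit_of_agree hc.isDistanceMonoid fun i =>
        (isThread_of_mem x).agree_restrict
    refine IsLimit.dist_eq (hc.isScale hα) hβ hc.isDistanceMonoid hY hYV
      (treeSpace_isMetric hc.isDistanceMonoid) hQ.isMetric h_add h_le (fun i => h_incl _)
      (hlim x) (hlim y) ((hk x).isLimit hβ hY) ((hk y).isLimit hβ hY) fun i => ?_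
    exact (congrArg h (hR.map_dist _ _).symm).trans ((h_incl _).trans (hhom.map_dist _ _))
  · have hx := isThread_of_mem x
    -- A full thread is fixed and its image is a fixed point. A short one already lies in `V`, where
    -- `hhom` applies.
    by_cases hdx : dom κ x.1 = κ
    · have : (treeSpace V' (hc.isScale hα)).map x = x :=
        Subtype.ext (show step κ x.1 = x.1 by rw [step, if_pos hdx])
      rw [this, map_eq_of_approximates hd hhom hW hQ hx hdx (hk x)]
    · have hxT : x.1 ∈ threadSet V κ := mem_threadSet.2
        ⟨hx.mem_model hα.isOrdinal (dom_mem hα.isOrdinal hx hdx), hx⟩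
      have e1 := hkT ((treeSpace V hα).map ⟨x.1, hxT⟩)
      have e2 := hkT ⟨x.1, hxT⟩
      exact e1.trans ((hhom.map_map _).trans (congrArg Q.map e2.symm))

end Universal

end FixAbs

namespace FixAbs

open DistStr DynStr

/-! ### Relativizations of the space of threads -/

section Relativization

variable {V V' : Set ZFSet.{u}} [hV : Fact (IsModelOfSetTheory V)]
  [hV' : Fact (IsModelOfSetTheory V')] {κ : ZFSet.{u}} [hκ : Fact (κ ∈ V)] [hκ' : Fact (κ ∈ V')]
  {W X : DistStr.{u}} {α : κ → W.carrier} {hα : W.IsScale α}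

/-- The space of threads of the larger model is a relativization of that of the smaller one. -/
theorem isRelativization_treeSpace (hVV' : V ⊆ V') (hWV : W.In V) (hW : W.IsDistanceMonoid V)
    (hαV : FunIn V α) (hc : W.IsCompletion V' X) (hXV : X.In V') :
    (treeSpace V hα).IsRelativization V' (treeSpace V' (hc.isScale hα))
      (CompletedDynSys V' W) where
  mem := treeSpace_in hXV (funIn_incl_comp hc.sub (hαV.mono hVV'))
  prop := ⟨treeSpace_isDynSys hc.isDistanceMonoid hc.isComplete hXV
    (funIn_incl_comp hc.sub (hαV.mono hVV')), hc⟩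
  sub_dm := hc.sub
  sub_pt := threadSet_mono hVV'
  hom := treeSpace_isHom_incl hVV' hc
  rigid := by
    intro h k _ _ hemb hh hk
    have hid := hc.eq_id_of_monotone hemb.map_le hh
    refine ⟨fun x => ⟨x, hid x⟩, fun x => ⟨x, ?_⟩⟩
    have hx := isThread_of_mem (V := V') (κ := κ) x
    -- The restrictions of `x` are points of the smaller space and are fixed by `k`, and the
    -- distances to them determine `x`. So `k` is the identity.
    refine IsLimit.eq_of_dist_eq (hc.isScale hα) hc.isDistanceMonoid
      (treeSpace_isMetric hc.isDistanceMonoid)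
      (p := fun i => incl (threadSet_mono hVV') (restrictPt (V := V) hα hx i))
      (treeSpace_isLimit_of_agree hc.isDistanceMonoid fun i => hx.agree_restrict) fun i => ?_
    have h1 := hemb.map_dist x (incl (threadSet_mono hVV') (restrictPt (V := V) hα hx i))
    have h2 := hemb.map_dist (incl (threadSet_mono hVV') (restrictPt (V := V) hα hx i)) x
    have h3 := hk (restrictPt (V := V) hα hx i)
    exact ⟨((congrArg _ h3.symm).trans h1.symm).trans (hid _),
      ((congrArg (fun z => DynStr.dist _ z _) h3.symm).trans h2.symm).trans (hid _)⟩
  minimal := by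
    intro Y Q hQV hQ s_dm s_pt hhom
    obtain ⟨h, k, hhV, hkV, hk, h1, h2, -⟩ := exists_extension hVV' hWV hW hαV hc hXV hQ.2 hhom hQ.1
    exact ⟨h, k, hhV, hkV, hk, h1, h2⟩

/-- Every relativization is an isomorphic image of the space of threads of the larger model. -/
theorem DynStr.IsRelativization.exists_iso (hVV' : V ⊆ V') (hWV : W.In V)
    (hW : W.IsDistanceMonoid V) (hαV : FunIn V α) {R : DynStr X}
    (hR : (treeSpace V hα).IsRelativization V' R (CompletedDynSys V' W)) :
    ∃ k : threadSet V' κ → R.points, Function.Bijective k ∧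
      (∀ x y, x.1 = step κ y.1 → k x = R.map (k y)) ∧
      ∀ x, Approximates (fun i => incl hR.sub_dm (α i)) (trace hR.sub_pt (isThread_of_mem x))
        (k x) := by
  obtain ⟨hRd, hc⟩ := hR.prop
  have hXV := hR.mem.1
  have hX := hc.isDistanceMonoid
  obtain ⟨h, k, hhV, hkV, hk, h_incl, k_incl, happ⟩ :=
    exists_extension hVV' hWV hW hαV hc hXV hc hR.hom hRd
  have hid := hc.eq_id_of_monotone hk.map_le h_incl
  have hR₀ := isRelativization_treeSpace (hα := hα) hVV' hWV hW hαV hc hXV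
  obtain ⟨h', k', hhV', hkV', hk', h_incl', k_incl'⟩ :=
    hR.minimal X _ hR₀.mem hR₀.prop hR₀.sub_dm hR₀.sub_pt hR₀.hom
  have hid' := hc.eq_id_of_monotone hk'.map_le h_incl'
  refine ⟨k, ⟨fun x y hxy => ?_, fun y => ?_⟩, fun x y hxy => ?_, happ⟩
  · refine ((treeSpace_isMetric (hα := hc.isScale hα) hX).1 x y).1 ⟨?_, ?_⟩
    · exact (hid _).symm.trans ((hk.map_dist x y).trans
        ((congrArg (R.dist (k x)) hxy.symm).trans (hRd.isMetric.dist_self _)))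
    · exact (hid _).symm.trans ((hk.map_dist y x).trans
        ((congrArg (R.dist (k y)) hxy).trans (hRd.isMetric.dist_self _)))
  -- Both maps are the identity on distances, so `k ∘ k'` is a self-embedding of `R` over the
  -- original system. Rigidity makes it surjective, and hence `k` as well.
  · have hdist : ∀ x y, R.dist (k (k' x)) (k (k' y)) = R.dist x y := fun x y =>
      ((hk.map_dist _ _).symm.trans (hid _)).trans ((hk'.map_dist _ _).symm.trans (hid' _))
    have hidV : FunIn V' (fun x : X.carrier => x) :=
      funIn_of_def hXV.1 hXV.1 (F := fun x => x) inferInstance fun _ => rfl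
    have hemb : IsEmb R R (fun x => x) (fun x => k (k' x)) := by
      refine ⟨⟨fun _ _ => rfl, rfl, fun _ _ => id, fun x y => (hdist x y).symm, fun x => ?_⟩,
        fun _ _ => id, fun x y hxy => ?_, fun _ _ => id⟩
      · exact (congrArg k (hk'.map_map x)).trans (hk.map_map _)
      · refine (hRd.isMetric.1 x y).1 ⟨?_, ?_⟩
        · rw [← hdist, show k (k' x) = k (k' y) from hxy, hRd.isMetric.dist_self]
        · rw [← hdist, show k (k' x) = k (k' y) from hxy, hRd.isMetric.dist_self]
    obtain ⟨x, hx⟩ := (hR.rigid _ _ hidV (FunIn.comp hR.mem.2.1 hkV hkV') hemb (fun _ => rfl)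
      fun x => (congrArg k (k_incl' x)).trans (k_incl x)).2 y
    exact ⟨_, hx⟩
  · rw [← hk.map_map y]
    exact congrArg k (Subtype.ext hxy)

end Relativization

end FixAbs

/-! ### The main theorem -/

open FixAbs in
theorem mainTheorem2 (V₀ V₁ : Set ZFSet.{u})
    (hV₀ : IsModelOfSetTheory V₀) (hV₁ : IsModelOfSetTheory V₁) (hV : V₀ ⊆ V₁)
    (W : DistStr.{u}) (hW : W.In V₀) (hWc : W.IsContinuous V₀)
    (κ : ZFSet.{u}) (hκ : W.IsCoinitiality V₀ κ) (hκω : ZFSet.omega ∈ κ)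
    (hcf : IsCofinality V₁ κ ZFSet.omega) :
    ∃ (S : DynStr W) (le : S.points → S.points → Prop) (α : κ → W.carrier),
      -- `S` is a `W`-dynamical system in `V₀` without fixed points
      S.IsDynSys V₀ ∧ ¬ S.HasFixedPoint ∧
      -- it is the tree metric on a pruned `κ`-tree without paths, with an increasing map
      RelIn V₀ le ∧ Tree.IsTree le κ ∧ Tree.IsPruned le κ ∧
      (¬ ∃ p : κ → S.points, Tree.IsPath le V₀ p) ∧
      W.IsInitialSeq V₀ α ∧ W.IsNice α ∧ S.IsTreeMetric le α ∧
      (∀ t, Tree.Lt le t (S.map t)) ∧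
      -- its relativization to `V₁` exists
      (∃ (X : DistStr.{u}) (R : DynStr X),
        S.IsRelativization V₁ R (DynStr.CompletedDynSys V₁ W)) ∧
      -- the relativization is the Cauchy completion, it has a fixed point, and its fixed points
      -- are exactly the paths
      ∀ (X : DistStr.{u}) (R : DynStr X)
        (hR : S.IsRelativization V₁ R (DynStr.CompletedDynSys V₁ W)),
        DynStr.IsDenseIn V₁ S R hR.sub_pt ∧
        R.HasFixedPoint ∧
        (∀ x, R.map x = x ↔ ∃! p : κ → S.points,
          Tree.IsPath le V₁ p ∧ R.IsLimit (fun i => incl hR.sub_pt (p i)) x) ∧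
        ∀ p : κ → S.points, Tree.IsPath le V₁ p →
          ∃! x, R.IsLimit (fun i => incl hR.sub_pt (p i)) x := by
  have : Fact (IsModelOfSetTheory V₀) := ⟨hV₀⟩
  have : Fact (IsModelOfSetTheory V₁) := ⟨hV₁⟩
  obtain ⟨α, hαV, hα⟩ := hκ.exists_isScale hW hWc hκω
  have hκV : Fact (κ ∈ V₀) := ⟨hαV.dom_mem⟩
  have hκV₁ : Fact (κ ∈ V₁) := ⟨hV hκV.out⟩
  have hκo := hα.isOrdinal
  have hsucc := hα.succ_mem
  have hreg := hκ.isRegularIn hW hWc.1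
  have hdne : ∀ x ∈ threadSet V₀ κ, dom κ x ≠ κ := fun x hx =>
    IsThread.dom_ne hκo hsucc hκω hreg (mem_threadSet.1 hx).1 (mem_threadSet.1 hx).2
  have hlt : ∀ t : threadSet V₀ κ, Tree.Lt nodeLe t ((treeSpace V₀ hα).map t) := fun t =>
    lt_step hκo hsucc (hdne _ t.2) rfl
  refine ⟨treeSpace V₀ hα, nodeLe, α, treeSpace_isDynSys hWc.1 hWc.2.1 hW hαV, ?_,
    relIn_nodeLe (treeSpace_in (hα := hα) hW hαV).2.1,
    isTree_nodeLe hκo fun x => dom_mem hκo (isThread_of_mem x) (hdne _ x.2),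
    isPruned_nodeLe hκo, ?_, ⟨hαV, hα.ne_zero, fun i j => hα.anti hWc.1, hα.coinitial⟩, hα.nice,
    ⟨treeSpace_dist_self, fun x y hxy => ?_⟩, hlt, ?_, fun X R hR => ?_⟩
  · rintro ⟨x, hx⟩
    exact (hlt x).2 hx.symm
  · rintro ⟨p, hp⟩
    obtain ⟨x, hx, hd, -⟩ := exists_thread_of_path hκo hsucc hp
    exact hdne x hx hd
  · obtain ⟨j, hj, hd⟩ := treeSpace_dist_of_ne hxy
    exact ⟨j, hj ▸ isJoin_join hκo hxy, hd⟩
  · have hW₁ : W.In V₁ := hW.mono hV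
    have hWd : W.IsDistanceMonoid V₁ := hWc.1.of_model hW
    exact ⟨_, _, isRelativization_treeSpace hV hW hWc.1 hαV
      (DistStr.completion_isCompletion (hWV := hW₁) (hW := hWd)) DistStr.completion_in⟩
  obtain ⟨k, ⟨hinj, hsurj⟩, hmap, happ⟩ := hR.exists_iso hV hW hWc.1 hαV
  obtain ⟨hRd, hc⟩ := hR.prop
  have hβ := hc.isScale hα
  have hlim : ∀ x : threadSet V₁ κ, R.IsLimit (fun i =>
      incl hR.sub_pt (restrictPt (V := V₀) hα (isThread_of_mem x) i)) (k x) := fun x =>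
    (happ x).isLimit hβ hc.isDistanceMonoid
  -- The bijection `k` carries the one-stage extension to the map of `R`, and the extension fixes
  -- exactly the full threads.
  have hfix : ∀ x : threadSet V₁ κ, R.map (k x) = k x ↔ dom κ x.1 = κ := by
    intro x
    constructor
    · intro h
      by_contra hd
      have hx := isThread_of_mem x
      let y : threadSet V₁ κ := ⟨_, step_mem_threadSet hκo hsucc x⟩
      rw [← hmap y x rfl] at h
      exact (lt_step hκo hsucc hd (rfl : y.1 = _)).2 (hinj h).symm
    · intro hd
      exact (hmap x x (by rw [step, if_pos hd])).symm
  have hpath : ∀ p : κ → threadSet V₀ κ, Tree.IsPath nodeLe V₁ p → ∃ x : threadSet V₁ κ,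
      dom κ x.1 = κ ∧ p = restrictPt hα (isThread_of_mem x) := by
    intro p hp
    obtain ⟨x, hx, hd, hr⟩ := exists_thread_of_path hκo hsucc hp
    exact ⟨⟨x, hx⟩, hd, funext fun i => Subtype.ext (hr i)⟩
  have huniq : ∀ {p : κ → R.points} {x y : R.points}, R.IsLimit p x → R.IsLimit p y → x = y :=
    fun hx hy => hx.unique hβ hc.isDistanceMonoid hRd.isMetric hy
  refine ⟨fun x => ?_, ?_, fun x => ⟨fun h => ?_, ?_⟩, fun p hp => ?_⟩
  · obtain ⟨x, rfl⟩ := hsurj x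
    have hx := isThread_of_mem x
    have hC := (isRegularSeq_trace hc hR.hom hWc.1 hx).isCauchySeq hβ hc.isDistanceMonoid hR.mem
      (funIn_incl_comp hc.sub (hαV.mono hV)) (funIn_trace hV (mem_threadSet.1 x.2).1 hx)
    have hL := (happ x).convergesTo hβ hc.isDistanceMonoid
    exact ⟨_, reindex (fun i => incl hc.sub (α i)) (restrictPt hα hx), hC, hL⟩
  -- Countable cofinality in `V₁` enters here: it provides a full thread, whose image is a fixed
  -- point.
  · obtain ⟨⟨-, g, hgV, hg⟩, -⟩ := hcf
    obtain ⟨x, hxV, hx, hd⟩ := exists_full_thread hκo hsucc hκω hgV hg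
    exact ⟨k ⟨x, mem_threadSet.2 ⟨hxV, hx⟩⟩, (hfix _).2 hd⟩
  · obtain ⟨x, rfl⟩ := hsurj x
    have hp : Tree.IsPath nodeLe V₁ (restrictPt (V := V₀) hα (isThread_of_mem x)) :=
      isPath_restrictPt hV hα (mem_threadSet.1 x.2).1 _ ((hfix x).1 h)
    refine ⟨_, ⟨hp, hlim x⟩, ?_⟩
    rintro p ⟨hp, hpx⟩
    obtain ⟨y, hy, rfl⟩ := hpath p hp
    obtain rfl := hinj (huniq (hlim y) hpx)
    rfl
  · rintro ⟨p, ⟨hp, hpx⟩, -⟩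
    obtain ⟨y, hy, rfl⟩ := hpath p hp
    rw [← huniq (hlim y) hpx]
    exact (hfix y).2 hy
  · obtain ⟨y, hy, rfl⟩ := hpath p hp
    exact ⟨k y, hlim y, fun x hx => huniq hx (hlim y)⟩
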